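/- Let $\rho\in(0,1)$, $\chi=\rho(1-\rho)$, and let $\eta(t)=(\eta_x(t))_{x\in\mathbb Z}\in\{0,1\}^{\mathbb Z}$, $t\ge 0$, be the totally asymmetric simple exclusion process (TASEP) started from the Bernoulli product measure of density $\rho$: every site carries an independent rate one Poisson clock (independent of $\eta(0)$), and when the clock at $x$ rings a particle at $x$ jumps to $x+1$ if $x+1$ is empty, and nothing happens otherwise. Let $N_t(x)$ be the number of jumps from $x$ to $x+1$ up to time $t$. Let $$M_t(x)=\sum_{i=1}^x(2\eta_i(t)-1)\ (x>0),\qquad M_t(0)=0,\qquad M_t(x)=-\sum_{i=x+1}^0(2\eta_i(t)-1)\ (x<0),$$ $$h_t(x)=2N_t(0)-M_t(x),\qquad v(x,t)=\mathrm{Var}(h_t(x)),$$ $$S(x,t)=E[(\eta_x(t)-\rho)(\eta_0(0)-\rho)],\qquad D(t)=(\chi t)^{-1}\sum_{x\in\mathbb Z}(x-(1-2\rho)t)^2S(x,t)\quad(t>0).$$ Write $\{a\}=a-\lfloor a\rfloor$. Then the random variables $N_t(x)$ are square integrable and: 1. For all $t\ge 0$ and $x\in\mathbb Z$, $$v(x,t)=4\chi|x|+4\,\mathrm{Cov}(N_t(0),N_t(x))-4\,\mathrm{sgn}(x)\,\mathrm{Cov}\Big(N_t(0),\sum_{y=-|x|+1}^{|x|}\eta_y(t)\Big).$$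 2. For each $t\ge 0$ there are $C_1<\infty$ and $C_2>0$ such that for all $x\in\mathbb Z$ $$|\mathrm{Cov}(N_t(0),\eta_x(t))|\le C_1e^{-C_2|x|},\qquad |\mathrm{Cov}(N_t(0),N_t(x))|\le C_1e^{-C_2|x|}.$$ 3. For each $t\ge 0$ there are $C_3<\infty$ and $C_4>0$ such that $\big|v(x,t)-4\chi|x-(1-2\rho)t|\big|\le C_3e^{-C_4|x|}$ for all $x\in\mathbb Z$. 4. For each $t>0$ the series defining $D(t)$ and the series below converge absolutely, and $$D(t)=(4\chi t)^{-1}\sum_{x\in\mathbb Z}\big(v(x,t)-4\chi|x-(1-2\rho)t|\big)+\frac{\{(1-2\rho)t\}\,(1-\{(1-2\rho)t\})}{t};$$ in particular the last term vanishes when $(1-2\rho)t$ is an integer. 5. For each $t\ge 0$, with absolute convergence, $$\sum_{x\in\mathbb Z}\big|x-\lfloor(1-2\rho)t\rfloor\big|\,S(x,t)=\tfrac14\,\mathrm{Var}\big(h_t(\lfloor(1-2\rho)t\rfloor)\big).$$ -/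

import Mathlib

open MeasureTheory ProbabilityTheory Filter Topology

namespace TASEP

noncomputable section

/-- The occupation variable in `{0, 1}`, as a real number. -/
def occ (b : Bool) : ℝ := if b then 1 else 0

variable {Ω : Type*}

/-- The `n`-th ring time (`n = 0, 1, 2, …`) of the clock at site `x`, when `ξ x 0, ξ x 1, …` are
the successive waiting times of that clock. -/
def ringTime (ξ : ℤ → ℕ → Ω → ℝ) (x : ℤ) (n : ℕ) (ω : Ω) : ℝ :=
  ∑ k ∈ Finset.range (n + 1), ξ x k ω

/-- `N_t(x)`: the number of jumps from `x` to `x + 1` up to time `t`, that is, of rings of the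
clock at `x` up to time `t` just before which `x` is occupied and `x + 1` is empty. -/
def current (ξ : ℤ → ℕ → Ω → ℝ) (η : ℝ → Ω → ℤ → Bool) (t : ℝ) (x : ℤ) (ω : Ω) : ℝ :=
  (Set.ncard {n : ℕ | ringTime ξ x n ω ≤ t ∧
    ∀ᶠ r in 𝓝[<] (ringTime ξ x n ω), η r ω x = true ∧ η r ω (x + 1) = false} : ℝ)

/-- `η t ω x` (for `t ≥ 0`) is the occupation of `x` at time `t` in the totally asymmetric simple
exclusion process started from the Bernoulli product measure with density `ρ`. Every site carries
an independent rate one Poisson clock (independent exponential waiting times `ξ x n`). When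
the clock at `x` rings, a particle at `x` attempts to jump to `x + 1`; the attempt is suppressed
if `x + 1` is occupied, and nothing else changes the configuration. Stationarity and translation
invariance are not part of the definition. -/
structure IsTASEP [MeasurableSpace Ω] (P : Measure Ω) (ρ : ℝ)
    (ξ : ℤ → ℕ → Ω → ℝ) (η : ℝ → Ω → ℤ → Bool) : Prop where
  measurable_wait : ∀ x n, Measurable (ξ x n)
  measurable_config : ∀ t, 0 ≤ t → Measurable (η t)
  wait_law : ∀ x n, P.map (ξ x n) = expMeasure 1
  wait_indep : iIndepFun (fun (p : ℤ × ℕ) (ω : Ω) => ξ p.1 p.2 ω) P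
  init_law : ∀ x, P {ω | η 0 ω x = true} = ENNReal.ofReal ρ
  init_indep : iIndepFun (fun (x : ℤ) (ω : Ω) => η 0 ω x) P
  init_indep_wait :
    IndepFun (fun ω : Ω => η 0 ω) (fun (ω : Ω) (p : ℤ × ℕ) => ξ p.1 p.2 ω) P
  evolution : ∀ᵐ ω ∂P, ∀ t : ℝ, 0 ≤ t → ∀ x : ℤ,
    occ (η t ω x) = occ (η 0 ω x) + current ξ η t (x - 1) ω - current ξ η t x ω

/-- `M_t(x)`: `∑_{i=1}^x (2 η_i(t) - 1)` for `x ≥ 0` (zero for `x = 0`) and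
`-∑_{i=x+1}^0 (2 η_i(t) - 1)` for `x < 0`. -/
def M (η : ℝ → Ω → ℤ → Bool) (t : ℝ) (x : ℤ) (ω : Ω) : ℝ :=
  if 0 ≤ x then ∑ i ∈ Finset.Icc 1 x, (2 * occ (η t ω i) - 1)
  else -∑ i ∈ Finset.Icc (x + 1) 0, (2 * occ (η t ω i) - 1)

/-- The height function `h_t(x) = 2 N_t(0) - M_t(x)`. -/
def height (ξ : ℤ → ℕ → Ω → ℝ) (η : ℝ → Ω → ℤ → Bool) (t : ℝ) (x : ℤ) (ω : Ω) : ℝ :=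
  2 * current ξ η t 0 ω - M η t x ω

variable [MeasurableSpace Ω]

/-- `v(x,t) = Var(h_t(x))`. -/
def v (P : Measure Ω) (ξ : ℤ → ℕ → Ω → ℝ) (η : ℝ → Ω → ℤ → Bool) (x : ℤ) (t : ℝ) : ℝ :=
  variance (height ξ η t x) P

/-- The compressibility `χ = ρ(1 - ρ)`. -/
def chi (ρ : ℝ) : ℝ := ρ * (1 - ρ)

/-- The two-point function `S(x,t) = E[(η_x(t) - ρ)(η_0(0) - ρ)]`. -/
def S (P : Measure Ω) (ρ : ℝ) (η : ℝ → Ω → ℤ → Bool) (x : ℤ) (t : ℝ) : ℝ :=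
  ∫ ω, (occ (η t ω x) - ρ) * (occ (η 0 ω 0) - ρ) ∂P

/-- The diffusivity `D(t) = (χ t)⁻¹ ∑_x (x - (1 - 2ρ) t)² S(x,t)`. -/
def D (P : Measure Ω) (ρ : ℝ) (η : ℝ → Ω → ℤ → Bool) (t : ℝ) : ℝ :=
  (chi ρ * t)⁻¹ * ∑' x : ℤ, ((x : ℝ) - (1 - 2 * ρ) * t) ^ 2 * S P ρ η x t

end

end TASEP

/-! The identities come from the conservation law `η_x(t) = η_x(0) + N_t(x-1) - N_t(x)`,
stationarity of the Bernoulli measure and exponential decay of correlations at a fixed time. Neither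
stationarity nor translation invariance is part of `IsTASEP`, so both are derived from the graphical
data (waiting times and initial configuration), whose law is the product measure `law`.

Locality: if a clock at `a < 0` and a clock at `b > 0` are silent up to time `t`, nothing crosses
these bonds, and the block `(a, b]` is determined by its initial configuration and the order of its
rings (`IsPath.block_unique`). Observables near the origin are thus functions of a finite `code` on
a good window, and windows of radius `k` fail to be good with probability at most `C r ^ k`
(`law_real_not_good`). This makes the observables measurable, equivariant under shifts, and, after
truncation to disjoint good windows, exponentially decorrelated (`IsTASEP.abs_covariance_value_le`).

Stationarity: a sum of a predictable integrand over the rings of a clock has the mean of its time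
integral (`integrable_integral_ringSum`), which gives Dynkin's formula. The generator has mean zero
under the Bernoulli measure (`IsTASEP.integral_gen`); iterating Dynkin's formula on short time steps
then gives `IsTASEP.stationary`.

Algebra of covariances: write `c(y) = Cov(N_t(0), η_y(t))`. The variances of a block sum at times
`0` and `t` coincide, so conservation relates one-sided sums of `c` to `Cov(N_t(0), N_t(x))`; this
yields the formula for `v`. Conservation at one site gives `c(x) - c(x+1) = S(x,t) - χ 1_{x=0}`,
whence the second difference of `v` is `8 S`.

Sum rule: the sum of `c` over `(-n, n]` is exponentially close to `χ(1-2ρ)t`. By conservation and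
reflection symmetry `η(t)` may be replaced by `η(0)`; the compensator formula turns the current into
the time integral of the jump rate; conservation up to time `s` moves the occupations to time `s`,
where the covariance with the rate is an explicit Bernoulli computation
(`IsTASEP.abs_sum_currentOcc_sub_le`).

Hence `v` is exponentially close to `4χ|x - m|` with `m = (1-2ρ)t`. Summation by parts against
`(x-m)²` and `|x-⌊m⌋|` gives the two moment identities; the second difference of `|x - m|` on the
integers has masses `2(1-{m})` and `2{m}` at `⌊m⌋` and `⌊m⌋+1`, which is the source of the
fractional part correction. -/

namespace TASEP

/-! ### Deterministic trajectories -/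

section Path

/-- The number of jumps across the bond `(x, x + 1)` up to time `t` along a trajectory `σ` driven
by the ring times `T`. -/
noncomputable def pathCurrent (T : ℤ → ℕ → ℝ) (σ : ℝ → ℤ → Bool) (t : ℝ) (x : ℤ) : ℕ :=
  Set.ncard {n : ℕ | T x n ≤ t ∧ ∀ᶠ r in 𝓝[<] (T x n), σ r x = true ∧ σ r (x + 1) = false}

/-- `σ` is a TASEP trajectory driven by the positive, locally finite ring times `T`. -/
structure IsPath (T : ℤ → ℕ → ℝ) (σ : ℝ → ℤ → Bool) : Prop where
  pos : ∀ x n, 0 < T x n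
  mono : ∀ x, Monotone (T x)
  fin : ∀ x t, {n | T x n ≤ t}.Finite
  evol : ∀ t, 0 ≤ t → ∀ x,
    occ (σ t x) = occ (σ 0 x) + pathCurrent T σ t (x - 1) - pathCurrent T σ t x

theorem occ_injective : Function.Injective occ := by
  intro a b h
  cases a <;> cases b <;> simp_all [occ]

/-- The configuration just before time `s`. -/
noncomputable def leftConf (σ : ℝ → ℤ → Bool) (s : ℝ) (x : ℤ) : Bool :=
  open Classical in decide (∀ᶠ r in 𝓝[<] s, σ r x = true)

variable {T T' : ℤ → ℕ → ℝ} {σ σ' : ℝ → ℤ → Bool}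

namespace IsPath

theorem eventually_left (h : IsPath T σ) (A : Finset ℤ) {s : ℝ} (hs : 0 < s) :
    ∀ᶠ r in 𝓝[<] s, 0 ≤ r ∧ r < s ∧ ∀ x ∈ A, ∀ m, T x m ≤ r ↔ T x m < s := by
  have h1 : ∀ᶠ r in 𝓝[<] s, 0 ≤ r :=
    (eventually_ge_nhds hs).filter_mono nhdsWithin_le_nhds
  have h2 : ∀ᶠ r in 𝓝[<] s, r < s := self_mem_nhdsWithin
  have h3 : ∀ᶠ r in 𝓝[<] s, ∀ x ∈ A, ∀ m, T x m < s → T x m ≤ r := by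
    rw [Filter.eventually_all_finset]
    intro x _
    have hf : {n | T x n < s}.Finite := (h.fin x s).subset fun n (hn : T x n < s) => hn.le
    have := (Filter.eventually_all_finite (l := 𝓝[<] s) (p := fun m r => T x m ≤ r) hf).2 (by
      intro m hm
      exact (eventually_ge_nhds hm).filter_mono nhdsWithin_le_nhds)
    filter_upwards [this] with r hr m hm using hr m hm
  filter_upwards [h1, h2, h3] with r a b c
  exact ⟨a, b, fun x hx m => ⟨fun hm => hm.trans_lt b, c x hx m⟩⟩

theorem pathCurrent_congr {t t' : ℝ} {x : ℤ} (hx : ∀ m, T x m ≤ t ↔ T x m ≤ t') :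
    pathCurrent T σ t x = pathCurrent T σ t' x := by
  simp only [pathCurrent, hx]

theorem conf_congr (h : IsPath T σ) {t t' : ℝ} (ht : 0 ≤ t) (ht' : 0 ≤ t') {x : ℤ}
    (hx : ∀ m, T x m ≤ t ↔ T x m ≤ t') (hx' : ∀ m, T (x - 1) m ≤ t ↔ T (x - 1) m ≤ t') :
    σ t x = σ t' x := by
  apply occ_injective
  rw [h.evol t ht, h.evol t' ht', pathCurrent_congr hx, pathCurrent_congr hx']

/-- Only finitely many rings of the relevant clocks precede `s`, so a trajectory restricted to a
finite set is constant on a left neighbourhood of `s`. The `decide` in `leftConf` therefore returns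
a genuine left limit and never a default value. -/
theorem eventually_leftConf (h : IsPath T σ) (A : Finset ℤ) {s : ℝ} (hs : 0 < s) :
    ∀ᶠ r in 𝓝[<] s, 0 ≤ r ∧ r < s ∧ (∀ x ∈ A, ∀ m, T x m ≤ r ↔ T x m < s) ∧
      ∀ x ∈ A, σ r x = leftConf σ s x := by
  have h1 := h.eventually_left (A ∪ A.image (fun x => x - 1)) hs
  have key : ∀ x ∈ A, ∃ b : Bool, ∀ᶠ r in 𝓝[<] s, σ r x = b := by
    intro x hx
    obtain ⟨r₀, hr₀⟩ := h1.exists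
    refine ⟨σ r₀ x, ?_⟩
    filter_upwards [h1] with r hr
    refine h.conf_congr hr.1 hr₀.1 (fun m => ?_) fun m => ?_
    · rw [hr.2.2 x (by simp [hx]), hr₀.2.2 x (by simp [hx])]
    · have : x - 1 ∈ A ∪ A.image (fun x => x - 1) :=
        Finset.mem_union_right _ (Finset.mem_image_of_mem _ hx)
      rw [hr.2.2 _ this, hr₀.2.2 _ this]
  have h2 : ∀ᶠ r in 𝓝[<] s, ∀ x ∈ A, σ r x = leftConf σ s x := by
    rw [Filter.eventually_all_finset]
    intro x hx
    obtain ⟨b, hb⟩ := key x hx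
    have : leftConf σ s x = b := by
      cases b with
      | true => simpa [leftConf] using hb
      | false =>
        simp only [leftConf, decide_eq_false_iff_not]
        intro h'
        obtain ⟨r, hr1, hr2⟩ := (hb.and h').exists
        simp_all
    rw [this]
    exact hb
  filter_upwards [h1, h2] with r a b
  exact ⟨a.1, a.2.1, fun x hx => a.2.2 x (by simp [hx]), b⟩

theorem eventually_pair_iff (h : IsPath T σ) {s : ℝ} (hs : 0 < s) (x : ℤ) :
    (∀ᶠ r in 𝓝[<] s, σ r x = true ∧ σ r (x + 1) = false) ↔
      leftConf σ s x = true ∧ leftConf σ s (x + 1) = false := by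
  have h1 := h.eventually_leftConf {x, x + 1} hs
  constructor
  · intro h2
    obtain ⟨r, hr, hr'⟩ := (h1.and h2).exists
    rw [← hr.2.2.2 x (by simp), ← hr.2.2.2 (x + 1) (by simp)]
    exact hr'
  · intro h2
    filter_upwards [h1] with r hr
    rw [hr.2.2.2 x (by simp), hr.2.2.2 (x + 1) (by simp)]
    exact h2

theorem pathCurrent_eq (h : IsPath T σ) (t : ℝ) (x : ℤ) : pathCurrent T σ t x =
    Set.ncard {n : ℕ | T x n ≤ t ∧
      leftConf σ (T x n) x = true ∧ leftConf σ (T x n) (x + 1) = false} := by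
  simp only [pathCurrent, h.eventually_pair_iff (h.pos _ _)]

theorem leftConf_eq (h : IsPath T σ) {s : ℝ} (hs : 0 < s) {x : ℤ}
    (hx : ∀ m, T x m ≠ s) (hx' : ∀ m, T (x - 1) m ≠ s) : leftConf σ s x = σ s x := by
  obtain ⟨r, hr⟩ := (h.eventually_leftConf {x, x - 1} hs).exists
  rw [← hr.2.2.2 x (by simp)]
  refine h.conf_congr hr.1 hs.le (fun m => ?_) fun m => ?_
  · rw [hr.2.2.1 x (by simp)]; exact ⟨le_of_lt, fun h => lt_of_le_of_ne h (hx m)⟩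
  · rw [hr.2.2.1 _ (by simp)]; exact ⟨le_of_lt, fun h => lt_of_le_of_ne h (hx' m)⟩

theorem pathCurrent_eq_zero {t : ℝ} {x : ℤ} (hx : ∀ m, ¬ T x m ≤ t) :
    pathCurrent T σ t x = 0 := by
  simp [pathCurrent, hx]

/-- The rings of the clocks in `A` up to time `t`. -/
theorem finite_rings (h : IsPath T σ) (A : Finset ℤ) (t : ℝ) :
    {p : ℤ × ℕ | p.1 ∈ A ∧ T p.1 p.2 ≤ t}.Finite := by
  have : {p : ℤ × ℕ | p.1 ∈ A ∧ T p.1 p.2 ≤ t} ⊆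
      ⋃ x ∈ (A : Set ℤ), (Prod.mk x) '' {n | T x n ≤ t} := by
    rintro ⟨x, n⟩ ⟨hx, hn⟩
    simp only [Set.mem_iUnion]
    exact ⟨x, hx, n, hn, rfl⟩
  exact (A.finite_toSet.biUnion fun x _ => (h.fin x t).image _).subset this

/-- If ring `k` came after `t`, monotonicity would leave at most the `k` earlier rings to produce
jumps. This converts tails of the current into tails of ring times. -/
theorem current_le (h : IsPath T σ) (t : ℝ) (x : ℤ) (k : ℕ) (hk : k < pathCurrent T σ t x) :
    T x k ≤ t := by
  by_contra hcon
  have : {n : ℕ | T x n ≤ t ∧ ∀ᶠ r in 𝓝[<] (T x n), σ r x = true ∧ σ r (x + 1) = false} ⊆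
      (Finset.range k : Set ℕ) := by
    rintro n ⟨hn, -⟩
    simp only [Finset.coe_range, Set.mem_Iio]
    by_contra hkn
    exact hcon ((h.mono x (not_lt.1 hkn)).trans hn)
  have h2 := Set.ncard_le_ncard this (Finset.finite_toSet _)
  rw [Set.ncard_coe_finset, Finset.card_range] at h2
  exact absurd hk (not_lt.2 h2)

/-- Two trajectories with the same initial condition on a block whose boundary clocks are silent,
and with the same rings in the same order inside the block, agree on the block. -/
theorem block_unique (h : IsPath T σ) (h' : IsPath T' σ') {a b : ℤ}
    (h0 : ∀ y ∈ Finset.Ioc a b, σ 0 y = σ' 0 y) {t t' : ℝ} (ht : 0 ≤ t) (ht' : 0 ≤ t')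
    (ha : ∀ m, ¬ T a m ≤ t) (hb : ∀ m, ¬ T b m ≤ t)
    (hring : ∀ x ∈ Finset.Icc a b, ∀ m, T x m ≤ t ↔ T' x m ≤ t')
    (hord : ∀ x ∈ Finset.Icc a b, ∀ y ∈ Finset.Icc a b, ∀ m l, T y l ≤ t →
      (T x m < T y l ↔ T' x m < T' y l)) :
    ∀ y ∈ Finset.Ioc a b, σ t y = σ' t' y := by
  -- Strong induction on the number of rings in the block: just before any of them fewer have
  -- occurred, so the two trajectories agree there, and the ring produces a jump in both or in
  -- neither. Equal currents then give equal configurations.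
  induction hn : (h.finite_rings (Finset.Icc a b) t).toFinset.card using
    Nat.strong_induction_on generalizing t t' with
  | _ n ih =>
  have ha' : ∀ m, ¬ T' a m ≤ t' ∨ b < a := by
    intro m
    by_cases hab : a ≤ b
    · left; rw [← hring a (by simp [hab])]; exact ha m
    · right; omega
  have hb' : ∀ m, ¬ T' b m ≤ t' ∨ b < a := by
    intro m
    by_cases hab : a ≤ b
    · left; rw [← hring b (by simp [hab])]; exact hb m
    · right; omega
  have hcur : ∀ x ∈ Finset.Icc a b, pathCurrent T σ t x = pathCurrent T' σ' t' x := by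
    intro x hx
    have hab : a ≤ b := by rw [Finset.mem_Icc] at hx; omega
    rcases eq_or_ne x a with rfl | hxa
    · rw [pathCurrent_eq_zero ha, pathCurrent_eq_zero fun m => (ha' m).resolve_right (by omega)]
    rcases eq_or_ne x b with rfl | hxb
    · rw [pathCurrent_eq_zero hb, pathCurrent_eq_zero fun m => (hb' m).resolve_right (by omega)]
    rw [Finset.mem_Icc] at hx
    have hx1 : x ∈ Finset.Ioc a b := by rw [Finset.mem_Ioc]; omega
    have hx2 : x + 1 ∈ Finset.Ioc a b := by rw [Finset.mem_Ioc]; omega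
    have hx3 : x ∈ Finset.Icc a b := by rw [Finset.mem_Icc]; omega
    rw [h.pathCurrent_eq, h'.pathCurrent_eq]
    congr 1
    ext m
    simp only [Set.mem_ofPred_eq]
    rw [hring x hx3]
    refine and_congr_right fun hm' => ?_
    have hm := (hring x hx3 m).2 hm'
    obtain ⟨r, hr0, hrs, hr1, hr2⟩ :=
      (h.eventually_leftConf (Finset.Icc a b) (h.pos x m)).exists
    obtain ⟨r', hr0', hrs', hr1', hr2'⟩ :=
      (h'.eventually_leftConf (Finset.Icc a b) (h'.pos x m)).exists
    have hsub : Finset.Ioc a b ⊆ Finset.Icc a b := Finset.Ioc_subset_Icc_self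
    have hlt : r < t := hrs.trans_le hm
    have key := ih (h.finite_rings (Finset.Icc a b) r).toFinset.card (by
        rw [← hn]
        refine Finset.card_lt_card ?_
        rw [Finset.ssubset_iff_of_subset]
        · refine ⟨(x, m), ?_, ?_⟩
          · simp only [Set.Finite.mem_toFinset, Set.mem_ofPred_eq]; exact ⟨hx3, hm⟩
          · simp only [Set.Finite.mem_toFinset, Set.mem_ofPred_eq, not_and, not_le]
            exact fun _ => hrs
        · intro p
          simp only [Set.Finite.mem_toFinset, Set.mem_ofPred_eq]
          exact fun hp => ⟨hp.1, hp.2.trans hlt.le⟩) hr0 hr0'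
      (fun l hl => ha l (hl.trans hlt.le)) (fun l hl => hb l (hl.trans hlt.le))
      (fun y hy l => by rw [hr1 y hy, hr1' y hy, hord y hy x hx3 l m hm])
      (fun y hy z hz l k hk => hord y hy z hz l k (hk.trans hlt.le)) rfl
    rw [← hr2 x hx3, ← hr2 (x + 1) (hsub hx2), ← hr2' x hx3, ← hr2' (x + 1) (hsub hx2),
      key x hx1, key (x + 1) hx2]
  intro y hy
  apply occ_injective
  have hy' := Finset.mem_Ioc.1 hy
  rw [h.evol t ht, h'.evol t' ht', h0 y hy, hcur y (by rw [Finset.mem_Icc]; omega),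
    hcur (y - 1) (by rw [Finset.mem_Icc]; omega)]

/-- Conservation of particles. -/
theorem sum_occ (h : IsPath T σ) {t : ℝ} (ht : 0 ≤ t) {a b : ℤ} (hab : a ≤ b) :
    ∑ y ∈ Finset.Ioc a b, occ (σ t y) =
      ∑ y ∈ Finset.Ioc a b, occ (σ 0 y) + pathCurrent T σ t a - pathCurrent T σ t b := by
  induction b, hab using Int.leInduction with
  | base => simp
  | succ b hab ih =>
    have : Finset.Ioc a (b + 1) = insert (b + 1) (Finset.Ioc a b) := by
      ext z; simp only [Finset.mem_insert, Finset.mem_Ioc]; omega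
    rw [this, Finset.sum_insert (by simp), Finset.sum_insert (by simp), ih, h.evol t ht (b + 1)]
    simp only [add_sub_cancel_right]
    ring

/-- The change of `g` produced by an allowed jump from `x` to `x + 1`. -/
def jump (g : (ℤ → Bool) → ℝ) (x : ℤ) (c : ℤ → Bool) : ℝ :=
  if c x = true ∧ c (x + 1) = false then g (c ∘ Equiv.swap x (x + 1)) - g c else 0

/-- Induction on the number of rings, removing the last one: between it and `t` nothing relevant
moves, and the ring itself changes `g` by `jump`. Distinctness of the ring times makes the last ring
unique. Both `x` and `x - 1` must lie in `A`, since an occupation is altered by jumps across either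
adjacent bond. -/
theorem sub_eq_sum_jump (h : IsPath T σ) {g : (ℤ → Bool) → ℝ} {A B : Finset ℤ}
    (hg : DependsOn g (B : Set ℤ)) (hBA : ∀ x ∈ B, x ∈ A ∧ x - 1 ∈ A)
    (hinj : ∀ x ∈ A, ∀ y ∈ A, ∀ m l, T x m = T y l → x = y ∧ m = l) {t : ℝ} (ht : 0 ≤ t) :
    g (σ t) - g (σ 0) =
      ∑ p ∈ (h.finite_rings A t).toFinset, jump g p.1 (leftConf σ (T p.1 p.2)) := by
  induction hn : (h.finite_rings A t).toFinset.card generalizing t with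
  | zero =>
    rw [Finset.card_eq_zero] at hn
    rw [hn, Finset.sum_empty, sub_eq_zero]
    refine hg fun x hx => h.conf_congr ht le_rfl (fun m => ?_) fun m => ?_
    all_goals
      refine iff_of_false (fun hm => ?_) (not_le.2 (h.pos _ _))
      have : ∀ p, p ∉ (h.finite_rings A t).toFinset := by simp [hn]
    · exact this (x, m) (by simpa using ⟨(hBA x hx).1, hm⟩)
    · exact this (x - 1, m) (by simpa using ⟨(hBA x hx).2, hm⟩)
  | succ n ih =>
    have hne : (h.finite_rings A t).toFinset.Nonempty := by
      rw [← Finset.card_pos]; omega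
    obtain ⟨⟨x, m⟩, hq, hmax⟩ :=
      Finset.exists_max_image _ (fun p : ℤ × ℕ => T p.1 p.2) hne
    simp only [Set.Finite.mem_toFinset, Set.mem_ofPred_eq] at hq hmax
    obtain ⟨hxA, hxt⟩ := hq
    obtain ⟨r, hr0, hrs, hr1, hr2⟩ :=
      (h.eventually_leftConf (A ∪ B) (h.pos x m)).exists
    have hrings : (h.finite_rings A t).toFinset =
        insert (x, m) (h.finite_rings A r).toFinset := by
      ext ⟨y, l⟩
      simp only [Set.Finite.mem_toFinset, Set.mem_ofPred_eq, Finset.mem_insert, Prod.mk.injEq]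
      constructor
      · rintro ⟨hy, hl⟩
        by_cases heq : T y l = T x m
        · exact Or.inl (hinj y hy x hxA l m heq)
        · right
          refine ⟨hy, (hr1 y (by simp [hy]) l).2 (lt_of_le_of_ne (hmax (y, l) ⟨hy, hl⟩) heq)⟩
      · rintro (⟨rfl, rfl⟩ | ⟨hy, hl⟩)
        · exact ⟨hxA, hxt⟩
        · exact ⟨hy, hl.trans (hrs.le.trans hxt)⟩
    have hnot : (x, m) ∉ (h.finite_rings A r).toFinset := by
      simp only [Set.Finite.mem_toFinset, Set.mem_ofPred_eq, not_and, not_le]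
      exact fun _ => hrs
    have hle : ∀ y ∈ A, ∀ l, T y l ≤ t ↔ (y = x ∧ l = m) ∨ T y l ≤ r := by
      intro y hy l
      have := congrArg (fun s => (y, l) ∈ s) hrings
      simp only [Set.Finite.mem_toFinset, Set.mem_ofPred_eq, Finset.mem_insert, Prod.mk.injEq, hy,
        true_and, eq_iff_iff] at this
      exact this
    rw [hrings, Finset.sum_insert hnot]
    rw [hrings, Finset.card_insert_of_notMem hnot] at hn
    rw [← ih hr0 (by omega)]
    set c := leftConf σ (T x m) with hc
    have hgr : g (σ r) = g c := hg fun y hy => hr2 y (by simp at hy; simp [hy])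
    have hcur : ∀ y ∈ A, (pathCurrent T σ t y : ℝ) = pathCurrent T σ r y +
        if y = x ∧ c x = true ∧ c (x + 1) = false then 1 else 0 := by
      intro y hy
      by_cases hyx : y = x ∧ c x = true ∧ c (x + 1) = false
      · rw [if_pos hyx]
        obtain ⟨rfl, hyx⟩ := hyx
        rw [h.pathCurrent_eq, h.pathCurrent_eq]
        have hset : {n : ℕ | T y n ≤ t ∧
            leftConf σ (T y n) y = true ∧ leftConf σ (T y n) (y + 1) = false} =
            insert m {n : ℕ | T y n ≤ r ∧
              leftConf σ (T y n) y = true ∧ leftConf σ (T y n) (y + 1) = false} := by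
          ext l
          simp only [Set.mem_ofPred_eq, Set.mem_insert_iff, hle y hy, true_and]
          constructor
          · rintro ⟨rfl | h1, h2⟩
            · exact Or.inl rfl
            · exact Or.inr ⟨h1, h2⟩
          · rintro (rfl | h1)
            · exact ⟨Or.inl rfl, hyx⟩
            · exact ⟨Or.inr h1.1, h1.2⟩
        rw [hset, Set.ncard_insert_of_notMem _ ((h.fin y r).subset fun l hl => hl.1)]
        · push_cast; ring
        · intro hcon; exact absurd hcon.1 (not_le.2 hrs)
      · rw [if_neg hyx, add_zero]
        rw [h.pathCurrent_eq, h.pathCurrent_eq]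
        congr 2
        ext l
        simp only [Set.mem_ofPred_eq, hle y hy]
        constructor
        · rintro ⟨⟨rfl, rfl⟩ | h1, h2⟩
          · exact absurd ⟨rfl, h2⟩ hyx
          · exact ⟨h1, h2⟩
        · exact fun h1 => ⟨Or.inr h1.1, h1.2⟩
    have hconf : ∀ y ∈ B, σ t y =
        (if c x = true ∧ c (x + 1) = false then c ∘ Equiv.swap x (x + 1) else c) y := by
      intro y hy
      apply occ_injective
      have e1 := h.evol t ht y
      have e2 := h.evol r hr0 y
      rw [hcur y (hBA y hy).1, hcur (y - 1) (hBA y hy).2] at e1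
      have e3 : occ (σ t y) = occ (c y) + (if y - 1 = x ∧ c x = true ∧ c (x + 1) = false then 1
          else 0) - (if y = x ∧ c x = true ∧ c (x + 1) = false then 1 else 0) := by
        rw [← hr2 y (by simp [hy])]; linarith
      rw [e3]
      by_cases hcx : c x = true ∧ c (x + 1) = false
      · simp only [hcx, and_self, and_true, if_true, Function.comp_apply]
        by_cases hy1 : y = x
        · subst hy1; simp [hcx, occ]
        by_cases hy2 : y = x + 1
        · subst hy2; simp [hcx, occ]
        rw [if_neg (by omega), if_neg hy1, Equiv.swap_apply_of_ne_of_ne hy1 hy2]; ring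
      · simp [hcx]
    have hgt := hg (x := σ t) hconf
    rw [hgt, hgr, jump]
    split_ifs <;> ring

end IsPath

end Path

/-! ### The graphical data and local observables -/

/-- Waiting times of all clocks together with the initial configuration. -/
abbrev Data := (ℤ × ℕ → ℝ) × (ℤ → Bool)

/-- The ring times encoded by the data. -/
def ring (d : Data) (x : ℤ) (n : ℕ) : ℝ := ∑ k ∈ Finset.range (n + 1), d.1 (x, k)

@[fun_prop]
theorem measurable_ring (x : ℤ) (n : ℕ) : Measurable fun d : Data => ring d x n := by
  unfold ring; fun_prop

/-- The window `[-k, k]`. -/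
abbrev Win (k : ℕ) := ↥(Finset.Icc (-k : ℤ) k)

/-- The combinatorial information on the first `k + 1` rings of every clock in a window. -/
abbrev Code (k : ℕ) := (Win k × Fin (k + 1) → Prop) ×
  ((Win k × Fin (k + 1)) × (Win k × Fin (k + 1)) → Prop) × (Win k → Bool)

/-- Which rings occurred up to time `s`, in which order, and the initial configuration. -/
def code (k : ℕ) (s : ℝ) (d : Data) : Code k :=
  (fun p => ring d p.1 p.2 ≤ s,
    fun p => ring d p.1.1 p.1.2 < ring d p.2.1 p.2.2 ∧ ring d p.2.1 p.2.2 ≤ s,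
    fun x => d.2 x)

/-- There are silent clocks on both sides of the origin, and few rings in the window. -/
def Good {k : ℕ} (c : Code k) : Prop :=
  (∃ z : Win k, (z : ℤ) < 0 ∧ ¬ c.1 (z, 0)) ∧ (∃ z : Win k, 0 < (z : ℤ) ∧ ¬ c.1 (z, 0)) ∧
    ∀ z : Win k, ¬ c.1 (z, Fin.last k)

theorem measurable_code (k : ℕ) : Measurable fun p : ℝ × Data => code k p.1 p.2 := by
  unfold code
  have hr : ∀ (x : ℤ) (n : ℕ), Measurable fun p : ℝ × Data => ring p.2 x n := fun x n =>
    (measurable_ring x n).comp measurable_snd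
  refine Measurable.prodMk ?_ (Measurable.prodMk ?_ ?_)
  · refine measurable_pi_lambda _ fun p => measurableSet_setOfPred.1 ?_
    exact measurableSet_le (hr _ _) measurable_fst
  · refine measurable_pi_lambda _ fun p => measurableSet_setOfPred.1 ?_
    exact (measurableSet_lt (hr _ _) (hr _ _)).inter (measurableSet_le (hr _ _) measurable_fst)
  · fun_prop

/-- An observable of trajectories which is determined by the code on good windows. -/
def LocalObs {β : Type*} (Q : Data → (ℝ → ℤ → Bool) → ℝ → β) : Prop :=
  ∀ (k : ℕ) (d d' : Data) (σ σ' : ℝ → ℤ → Bool) (s s' : ℝ), IsPath (ring d) σ →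
    IsPath (ring d') σ' → σ 0 = d.2 → σ' 0 = d'.2 → 0 ≤ s → 0 ≤ s' → Good (code k s d) →
    code k s d = code k s' d' → Q d σ s = Q d' σ' s'

/-- On a good window the last recorded ring, of index `k`, has not yet occurred, so by monotonicity
the code misses no ring up to time `s`. -/
theorem IsPath.ring_le_iff {d : Data} {σ : ℝ → ℤ → Bool} (h : IsPath (ring d) σ) {k : ℕ} {s : ℝ}
    (hg : Good (code k s d)) {x : ℤ} (hx : x ∈ Finset.Icc (-k : ℤ) k) {m : ℕ}
    (hm : ring d x m ≤ s) : m < k := by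
  by_contra hcon
  exact hg.2.2 ⟨x, hx⟩ ((h.mono x (not_lt.1 hcon)).trans hm)

/-- The silent clocks of the common code isolate the same block for both data, and `block_unique`
applies there. Since `a < 0 < b`, the block contains the sites `0` and `1`; the vanishing current at
`b` is retained because it determines the current at `0`. -/
theorem eq_on_block {k : ℕ} {d d' : Data} {σ σ' : ℝ → ℤ → Bool} {s s' : ℝ}
    (h : IsPath (ring d) σ) (h' : IsPath (ring d') σ') (h0 : σ 0 = d.2) (h0' : σ' 0 = d'.2)
    (hs : 0 ≤ s) (hs' : 0 ≤ s') (hg : Good (code k s d)) (hc : code k s d = code k s' d') :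
    ∃ a b : ℤ, -k ≤ a ∧ a < 0 ∧ 0 < b ∧ b ≤ k ∧
      (∀ y ∈ Finset.Ioc a b, σ s y = σ' s' y) ∧ (∀ y ∈ Finset.Ioc a b, σ 0 y = σ' 0 y) ∧
      pathCurrent (ring d) σ s b = 0 ∧ pathCurrent (ring d') σ' s' b = 0 := by
  have hg' : Good (code k s' d') := hc ▸ hg
  obtain ⟨⟨a, ha0, ha⟩, ⟨b, hb0, hb⟩, -⟩ := id hg
  have hb' : ¬ (code k s' d').1 (b, 0) := hc ▸ hb
  have hka := Finset.mem_Icc.1 a.2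
  have hkb := Finset.mem_Icc.1 b.2
  have hsub : ∀ x, x ∈ Finset.Icc (a : ℤ) b → x ∈ Finset.Icc (-k : ℤ) k := fun x hx => by
    rw [Finset.mem_Icc] at *; omega
  have hc0 : ∀ y ∈ Finset.Ioc (a : ℤ) b, σ 0 y = σ' 0 y := by
    intro y hy
    rw [h0, h0']
    exact congrFun (congrArg (fun c => c.2.2) hc) ⟨y, hsub y (Finset.Ioc_subset_Icc_self hy)⟩
  have hring : ∀ x ∈ Finset.Icc (-k : ℤ) k, ∀ m, ring d x m ≤ s ↔ ring d' x m ≤ s' := by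
    intro x hx m
    by_cases hm : m < k + 1
    · exact iff_of_eq (congrFun (congrArg (fun c => c.1) hc) (⟨x, hx⟩, ⟨m, hm⟩))
    · refine iff_of_false (fun hcon => ?_) fun hcon => ?_
      · have := h.ring_le_iff hg hx hcon; omega
      · have := h'.ring_le_iff hg' hx hcon; omega
  refine ⟨a, b, hka.1, ha0, hb0, hkb.2, ?_, hc0, IsPath.pathCurrent_eq_zero fun m hm => ?_,
    IsPath.pathCurrent_eq_zero fun m hm => ?_⟩
  · refine h.block_unique h' hc0 hs hs' (fun m hm => ?_) (fun m hm => ?_)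
      (fun x hx => hring x (hsub x hx)) fun x hx y hy m l hl => ?_
    · exact ha ((h.mono a (Nat.zero_le m)).trans hm)
    · exact hb ((h.mono b (Nat.zero_le m)).trans hm)
    · have hlk := h.ring_le_iff hg (hsub y hy) hl
      have hl' := (hring y (hsub y hy) l).1 hl
      by_cases hm : m < k + 1
      · have := iff_of_eq (congrFun (congrArg (fun c => c.2.1) hc)
          ((⟨x, hsub x hx⟩, ⟨m, hm⟩), (⟨y, hsub y hy⟩, ⟨l, by omega⟩)))
        simp only [code, hl, hl', and_true] at this
        exact this
      · refine iff_of_false (fun hcon => ?_) fun hcon => ?_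
        · have := h.ring_le_iff hg (hsub x hx) (hcon.le.trans hl); omega
        · have := h'.ring_le_iff hg' (hsub x hx) (hcon.le.trans hl'); omega
  · exact hb ((h.mono b (Nat.zero_le m)).trans hm)
  · exact hb' ((h'.mono b (Nat.zero_le m)).trans hm)

theorem localObs_conf : LocalObs fun _ σ s => σ s 0 := by
  intro k d d' σ σ' s s' h h' h0 h0' hs hs' hg hc
  obtain ⟨a, b, _, ha, hb, _, h1, -⟩ := eq_on_block h h' h0 h0' hs hs' hg hc
  exact h1 0 (Finset.mem_Ioc.2 ⟨ha, hb.le⟩)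

theorem localObs_occ : LocalObs fun _ σ s => occ (σ s 0) := by
  intro k d d' σ σ' s s' h h' h0 h0' hs hs' hg hc
  exact congrArg occ (localObs_conf k d d' σ σ' s s' h h' h0 h0' hs hs' hg hc)

/-- The instantaneous jump rate across the bond `(0, 1)`. -/
def rate (c : ℤ → Bool) : ℝ := occ (c 0) * (1 - occ (c 1))

theorem localObs_rate : LocalObs fun _ σ s => rate (σ s) := by
  intro k d d' σ σ' s s' h h' h0 h0' hs hs' hg hc
  obtain ⟨a, b, _, ha, hb, _, h1, -⟩ := eq_on_block h h' h0 h0' hs hs' hg hc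
  simp only [rate]
  rw [h1 0 (Finset.mem_Ioc.2 ⟨ha, hb.le⟩), h1 1 (Finset.mem_Ioc.2 ⟨by omega, by omega⟩)]

/-- With no current at `b`, conservation expresses the current at `0` as the gain of particles in
`(0, b]`, so it is read off from the block at the initial and final times. -/
theorem localObs_current : LocalObs fun d σ s => (pathCurrent (ring d) σ s 0 : ℝ) := by
  intro k d d' σ σ' s s' h h' h0 h0' hs hs' hg hc
  obtain ⟨a, b, _, ha, hb, _, h1, h2, h3, h4⟩ := eq_on_block h h' h0 h0' hs hs' hg hc
  have e1 := h.sum_occ hs hb.le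
  have e2 := h'.sum_occ hs' hb.le
  rw [h3] at e1
  rw [h4] at e2
  have hmem : ∀ y ∈ Finset.Ioc 0 b, y ∈ Finset.Ioc a b := fun y hy => by
    rw [Finset.mem_Ioc] at *; omega
  have e3 : ∑ y ∈ Finset.Ioc 0 b, occ (σ s y) = ∑ y ∈ Finset.Ioc 0 b, occ (σ' s' y) :=
    Finset.sum_congr rfl fun y hy => by rw [h1 y (hmem y hy)]
  have e4 : ∑ y ∈ Finset.Ioc 0 b, occ (σ 0 y) = ∑ y ∈ Finset.Ioc 0 b, occ (σ' 0 y) :=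
    Finset.sum_congr rfl fun y hy => by rw [h2 y (hmem y hy)]
  push_cast at e1 e2
  linarith

/-! ### Local observables as measurable functions of the data -/

section Value

variable {β : Type*} [Inhabited β] {Q : Data → (ℝ → ℤ → Bool) → ℝ → β}

open Classical in
/-- The value of a local observable read off from a good code. -/
noncomputable def codeValue (Q : Data → (ℝ → ℤ → Bool) → ℝ → β) (k : ℕ) (c : Code k) : β :=
  if h : ∃ p : Data × (ℝ → ℤ → Bool) × ℝ, IsPath (ring p.1) p.2.1 ∧ p.2.1 0 = p.1.2 ∧ 0 ≤ p.2.2 ∧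
    Good c ∧ code k p.2.2 p.1 = c then Q h.choose.1 h.choose.2.1 h.choose.2.2 else default

theorem codeValue_eq (hQ : LocalObs Q) {k : ℕ} {d : Data} {σ : ℝ → ℤ → Bool} {s : ℝ}
    (h : IsPath (ring d) σ) (h0 : σ 0 = d.2) (hs : 0 ≤ s) (hg : Good (code k s d)) :
    codeValue Q k (code k s d) = Q d σ s := by
  have hex : ∃ p : Data × (ℝ → ℤ → Bool) × ℝ, IsPath (ring p.1) p.2.1 ∧ p.2.1 0 = p.1.2 ∧
      0 ≤ p.2.2 ∧ Good (code k s d) ∧ code k p.2.2 p.1 = code k s d :=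
    ⟨(d, σ, s), h, h0, hs, hg, rfl⟩
  rw [codeValue, dif_pos hex]
  obtain ⟨h1, h2, h3, h4, h5⟩ := hex.choose_spec
  exact hQ k _ _ _ _ _ _ h1 h h2 h0 h3 hs (h5.symm ▸ h4) h5

open Classical in
/-- The value of a local observable as a function of time and data. -/
noncomputable def value (Q : Data → (ℝ → ℤ → Bool) → ℝ → β) (s : ℝ) (d : Data) : β :=
  if h : ∃ k, Good (code k s d) then codeValue Q (Nat.find h) (code (Nat.find h) s d) else default

theorem value_eq (hQ : LocalObs Q) {d : Data} {σ : ℝ → ℤ → Bool} {s : ℝ}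
    (h : IsPath (ring d) σ) (h0 : σ 0 = d.2) (hs : 0 ≤ s) (hg : ∃ k, Good (code k s d)) :
    value Q s d = Q d σ s := by
  classical
  rw [value, dif_pos hg]
  exact codeValue_eq hQ h h0 hs (Nat.find_spec hg)

theorem value_congr {s : ℝ} {d d' : Data} (h : ∀ k, code k s d = code k s d') :
    value Q s d = value Q s d' := by
  classical
  exact congrArg (fun c : ∀ k, Code k => if h : ∃ k, Good (c k) then
    codeValue Q (Nat.find h) (c (Nat.find h)) else default) (funext h)

theorem measurable_of_code {γ : Type*} [MeasurableSpace γ] {k : ℕ} (f : Code k → γ) :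
    Measurable f := measurable_of_countable f

theorem measurableSet_good (k : ℕ) : MeasurableSet {p : ℝ × Data | Good (code k p.1 p.2)} :=
  measurable_code k (measurableSet_setOfPred.2 (measurable_of_code (Good (k := k))))

theorem measurable_value [MeasurableSpace β] :
    Measurable fun p : ℝ × Data => value Q p.1 p.2 := by
  classical
  -- The second alternative makes the search for the least good window terminate everywhere, as
  -- `Measurable.find` requires; it only matters where the default value is used.
  have hex : ∀ p : ℝ × Data, ∃ k, Good (code k p.1 p.2) ∨ ∀ m, ¬ Good (code m p.1 p.2) := by
    intro p
    by_cases h : ∃ k, Good (code k p.1 p.2)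
    · exact ⟨h.choose, Or.inl h.choose_spec⟩
    · exact ⟨0, Or.inr (not_exists.1 h)⟩
  have hm : MeasurableSet {p : ℝ × Data | ∃ k, Good (code k p.1 p.2)} := by
    have := MeasurableSet.iUnion measurableSet_good
    convert this using 1
    ext; simp
  have h1 : Measurable fun p : ℝ × Data =>
      codeValue Q (Nat.find (hex p)) (code (Nat.find (hex p)) p.1 p.2) := by
    refine Measurable.find (f := fun k (p : ℝ × Data) => codeValue Q k (code k p.1 p.2))
      (p := fun k p => Good (code k p.1 p.2) ∨ ∀ m, ¬ Good (code m p.1 p.2))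
      (fun k => (measurable_of_code (codeValue Q k)).comp (measurable_code k)) (fun k => ?_) hex
    have := (measurableSet_good k).union hm.compl
    convert this using 1
    ext; simp
  have h3 : (fun p : ℝ × Data => value Q p.1 p.2) = fun p =>
      if ∃ k, Good (code k p.1 p.2) then codeValue Q (Nat.find (hex p))
        (code (Nat.find (hex p)) p.1 p.2) else default := by
    funext p
    rw [value]
    by_cases h : ∃ k, Good (code k p.1 p.2)
    · have hf : Nat.find h = Nat.find (hex p) := by
        apply Nat.find_congr'
        intro n
        exact ⟨Or.inl, fun hh => hh.resolve_right fun hn => h.elim hn⟩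
      rw [dif_pos h, if_pos h, hf]
    · rw [dif_neg h, if_neg h]
  rw [h3]
  exact Measurable.ite hm h1 measurable_const

end Value

open scoped ENNReal

/-! ### The exponential distribution -/

instance : IsProbabilityMeasure (expMeasure 1) := isProbabilityMeasure_expMeasure one_pos

theorem expMeasure_eq : expMeasure 1 = volume.withDensity (exponentialPDF 1) := rfl

theorem measurable_exponentialPDF : Measurable (exponentialPDF 1) :=
  (measurable_exponentialPDFReal 1).ennreal_ofReal

instance : NullSingletonClass (expMeasure 1) := by
  rw [expMeasure_eq]
  refine ⟨fun x => ?_⟩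
  exact (withDensity_absolutelyContinuous volume (exponentialPDF 1)) (measure_singleton x)

theorem expMeasure_Iic (x : ℝ) (hx : 0 ≤ x) :
    expMeasure 1 (Set.Iic x) = ENNReal.ofReal (1 - Real.exp (-x)) := by
  rw [expMeasure_eq, withDensity_apply _ measurableSet_Iic,
    lintegral_exponentialPDF_eq_antiDeriv one_pos, if_pos hx, one_mul]

theorem expMeasure_Ioi (x : ℝ) (hx : 0 ≤ x) :
    expMeasure 1 (Set.Ioi x) = ENNReal.ofReal (Real.exp (-x)) := by
  rw [← Set.compl_Iic, prob_compl_eq_one_sub measurableSet_Iic, expMeasure_Iic x hx,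
    ← ENNReal.ofReal_one, ← ENNReal.ofReal_sub]
  · congr 1; ring
  · simpa using hx

theorem expMeasure_ae_pos : ∀ᵐ u ∂(expMeasure 1), 0 < u := by
  rw [ae_iff]
  have := expMeasure_Iic 0 le_rfl
  simp only [neg_zero, Real.exp_zero, sub_self, ENNReal.ofReal_zero] at this
  convert this using 2
  ext; simp

/-- `e^{-u}` times the rate one density is half the rate two density. This Laplace transform feeds
the Chernoff bound `law_ring_le`. -/
theorem lintegral_exp_neg_expMeasure :
    ∫⁻ u, ENNReal.ofReal (Real.exp (-u)) ∂(expMeasure 1) = 2⁻¹ := by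
  rw [expMeasure_eq, lintegral_withDensity_eq_lintegral_mul _ measurable_exponentialPDF
    (by fun_prop)]
  have : ∀ u, (exponentialPDF 1 * fun u => ENNReal.ofReal (Real.exp (-u))) u =
      2⁻¹ * exponentialPDF 2 u := by
    intro u
    simp only [Pi.mul_apply, exponentialPDF_eq]
    split_ifs with h
    · rw [← ENNReal.ofReal_mul (by positivity)]
      have : (2⁻¹ : ℝ≥0∞) = ENNReal.ofReal 2⁻¹ := by
        rw [ENNReal.ofReal_inv_of_pos two_pos]; simp
      rw [this, ← ENNReal.ofReal_mul (by positivity)]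
      congr 1
      rw [one_mul, ← Real.exp_add]
      have : -(1 * u) + -u = -(2 * u) := by ring
      rw [this]; ring
    · simp
  rw [lintegral_congr this, lintegral_const_mul' _ _ (by simp),
    lintegral_exponentialPDF_eq_one two_pos, mul_one]

/-- The hazard rate of the exponential distribution is one. -/
theorem lintegral_expMeasure {Φ : ℝ → ℝ≥0∞} (hΦ : Measurable Φ) :
    ∫⁻ u, Φ u ∂(expMeasure 1) =
      ∫⁻ u, (∫⁻ s in Set.Ioc 0 u, Φ s) ∂(expMeasure 1) := by
  have h1 : ∀ u, ∫⁻ s in Set.Ioc 0 u, Φ s =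
      ∫⁻ s, (Set.Ioi 0).indicator Φ s * (Set.Ioi s).indicator 1 u := by
    intro u
    rw [setLIntegral_congr Ioo_ae_eq_Ioc.symm, ← lintegral_indicator measurableSet_Ioo]
    refine lintegral_congr fun s => ?_
    by_cases h1 : 0 < s <;> by_cases h2 : s < u <;> simp [Set.indicator, h1, h2]
  simp_rw [h1]
  have hm : Measurable fun p : ℝ × ℝ => (Set.Ioi (0 : ℝ)).indicator Φ p.2 *
      (Set.Ioi p.2).indicator (1 : ℝ → ℝ≥0∞) p.1 := by
    refine Measurable.mul ((hΦ.indicator measurableSet_Ioi).comp measurable_snd) ?_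
    have : (fun p : ℝ × ℝ => (Set.Ioi p.2).indicator (1 : ℝ → ℝ≥0∞) p.1) =
        {p : ℝ × ℝ | p.2 < p.1}.indicator 1 := by
      ext p; simp [Set.indicator]
    rw [this]
    exact measurable_one.indicator (measurableSet_lt measurable_snd measurable_fst)
  -- After Tonelli the inner integral is the tail probability `e^{-s}`, which equals the density at
  -- `s`.
  rw [lintegral_lintegral_swap hm.aemeasurable]
  rw [expMeasure_eq, lintegral_withDensity_eq_lintegral_mul _ measurable_exponentialPDF hΦ,
    ← expMeasure_eq]
  -- At `s = 0` the density is one while the indicator of `Ioi 0` vanishes, so this null point is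
  -- discarded.
  have hae : ∀ᵐ s : ℝ, s ≠ 0 := by simp [ae_iff, measure_singleton]
  refine lintegral_congr_ae ?_
  filter_upwards [hae] with s hs
  rw [lintegral_const_mul _ (measurable_one.indicator measurableSet_Ioi),
    lintegral_indicator_one measurableSet_Ioi, Pi.mul_apply]
  by_cases h : 0 < s
  · rw [expMeasure_Ioi s h.le, exponentialPDF_of_nonneg h.le]
    simp [Set.indicator, h, mul_comm]
  · rw [exponentialPDF_of_neg (lt_of_le_of_ne (not_lt.1 h) hs)]
    simp [Set.indicator, h]

/-! ### The law of the data -/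

/-- The Bernoulli distribution on `Bool`. -/
noncomputable def bern (ρ : ℝ) : Measure Bool :=
  ENNReal.ofReal ρ • Measure.dirac true + ENNReal.ofReal (1 - ρ) • Measure.dirac false

theorem isProbabilityMeasure_bern {ρ : ℝ} (h0 : 0 < ρ) (h1 : ρ < 1) :
    IsProbabilityMeasure (bern ρ) := by
  refine ⟨?_⟩
  simp only [bern, Measure.add_apply, Measure.smul_apply, measure_univ, smul_eq_mul, mul_one]
  rw [← ENNReal.ofReal_add h0.le (by linarith)]
  simp

/-- The law of the graphical data. -/
noncomputable def law (ρ : ℝ) : Measure Data :=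
  (Measure.infinitePi fun _ : ℤ × ℕ => expMeasure 1).prod
    (Measure.infinitePi fun _ : ℤ => bern ρ)

/-- The data of a TASEP. -/
def dataOf {Ω : Type*} (ξ : ℤ → ℕ → Ω → ℝ) (η : ℝ → Ω → ℤ → Bool) (ω : Ω) : Data :=
  (fun p => ξ p.1 p.2 ω, η 0 ω)

section Law

variable {Ω : Type*} [MeasurableSpace Ω] {P : Measure Ω}
    {ρ : ℝ} {ξ : ℤ → ℕ → Ω → ℝ} {η : ℝ → Ω → ℤ → Bool}

theorem IsTASEP.measurable_data (h : IsTASEP P ρ ξ η) : Measurable (dataOf ξ η) :=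
  Measurable.prodMk (measurable_pi_lambda _ fun p => h.measurable_wait p.1 p.2)
    (h.measurable_config 0 le_rfl)

theorem IsTASEP.map_data [IsProbabilityMeasure P] (h : IsTASEP P ρ ξ η) (h0 : 0 < ρ) (h1 : ρ < 1) :
    P.map (dataOf ξ η) = law ρ := by
  have hm0 : ∀ x, Measurable fun ω => η 0 ω x := fun x =>
    (measurable_pi_apply x).comp (h.measurable_config 0 le_rfl)
  have e1 : P.map (dataOf ξ η) = (P.map fun ω (p : ℤ × ℕ) => ξ p.1 p.2 ω).prod
      (P.map fun ω => η 0 ω) :=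
    (indepFun_iff_map_prod_eq_prod_map_map
      (measurable_pi_lambda _ fun p : ℤ × ℕ => h.measurable_wait p.1 p.2).aemeasurable
      (h.measurable_config 0 le_rfl).aemeasurable).1 h.init_indep_wait.symm
  rw [e1, law]
  congr 1
  · rw [h.wait_indep.map_fun_eq_infinitePi_map fun p : ℤ × ℕ => h.measurable_wait p.1 p.2]
    congr 1
    funext p
    exact h.wait_law p.1 p.2
  · have := h.init_indep.map_fun_eq_infinitePi_map hm0
    refine this.trans ?_
    congr 1
    funext x
    have hp : IsProbabilityMeasure (P.map fun ω => η 0 ω x) :=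
      Measure.isProbabilityMeasure_map (hm0 x).aemeasurable
    have hb := isProbabilityMeasure_bern h0 h1
    have ht : (P.map fun ω => η 0 ω x) {true} = bern ρ {true} := by
      rw [Measure.map_apply (hm0 x) (measurableSet_singleton _)]
      have := h.init_law x
      simp only [bern, Measure.add_apply, Measure.smul_apply, smul_eq_mul]
      rw [Measure.dirac_apply' _ (measurableSet_singleton _),
        Measure.dirac_apply' _ (measurableSet_singleton _)]
      simp only [Set.mem_singleton_iff, Set.indicator_of_mem, Pi.one_apply, mul_one,
        Bool.false_eq_true, not_false_eq_true, Set.indicator_of_notMem, mul_zero, add_zero]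
      exact this
    have hc : ({false} : Set Bool) = {true}ᶜ := by ext b; cases b <;> simp
    have hf : (P.map fun ω => η 0 ω x) {false} = bern ρ {false} := by
      rw [hc, prob_compl_eq_one_sub (measurableSet_singleton _),
        prob_compl_eq_one_sub (measurableSet_singleton _), ht]
    refine Measure.ext_of_singleton fun b => ?_
    cases b
    · exact hf
    · exact ht

end Law

/-! ### Resampling, translation and exchangeability of the data -/

/-- Replace the waiting time with index `p`. -/
def resample (p : ℤ × ℕ) (u : ℝ) (d : Data) : Data := (Function.update d.1 p u, d.2)

theorem measurable_resample (p : ℤ × ℕ) :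
    Measurable fun q : Data × ℝ => resample p q.2 q.1 := by
  unfold resample
  refine Measurable.prodMk ?_ (by fun_prop)
  refine measurable_pi_lambda _ fun q => ?_
  by_cases h : q = p
  · subst h; simp only [Function.update_self]; fun_prop
  · simp only [Function.update_of_ne h]; fun_prop

/-- Translation of the data. -/
def shift (c : ℤ) (d : Data) : Data := (fun p => d.1 (p.1 + c, p.2), fun x => d.2 (x + c))

theorem measurable_shift (c : ℤ) : Measurable (shift c) := by unfold shift; fun_prop

theorem ring_shift (c : ℤ) (d : Data) (x : ℤ) (n : ℕ) : ring (shift c d) x n = ring d (x + c) n :=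
  rfl

section

variable {ρ : ℝ} [IsProbabilityMeasure (bern ρ)]

instance : IsProbabilityMeasure (law ρ) := by unfold law; infer_instance

variable (ρ) in
theorem measurePreserving_shift (c : ℤ) : MeasurePreserving (shift c) (law ρ) (law ρ) := by
  have h1 : MeasurePreserving (fun (f : ℤ × ℕ → ℝ) p => f (p.1 + c, p.2))
      (Measure.infinitePi fun _ : ℤ × ℕ => expMeasure 1)
      (Measure.infinitePi fun _ : ℤ × ℕ => expMeasure 1) := by
    refine ⟨by fun_prop, ?_⟩
    refine Measure.map_infinitePi_infinitePi_of_inj (P := fun _ : ℤ × ℕ => expMeasure 1)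
      (f := fun p : ℤ × ℕ => (p.1 + c, p.2)) ?_
    rintro ⟨a, b⟩ ⟨a', b'⟩ h
    simpa using h
  have h2 : MeasurePreserving (fun (f : ℤ → Bool) x => f (x + c))
      (Measure.infinitePi fun _ : ℤ => bern ρ) (Measure.infinitePi fun _ : ℤ => bern ρ) := by
    refine ⟨by fun_prop, ?_⟩
    exact Measure.map_infinitePi_infinitePi_of_inj (P := fun _ : ℤ => bern ρ)
      (f := fun x : ℤ => x + c) (add_left_injective c)
  exact h1.prod h2

variable (ρ) in
/-- The initial configuration has an exchangeable law. -/
theorem measurePreserving_perm (e : Equiv.Perm ℤ) :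
    MeasurePreserving (fun d : Data => (d.1, d.2 ∘ e)) (law ρ) (law ρ) := by
  have h2 : MeasurePreserving (fun (f : ℤ → Bool) => f ∘ e)
      (Measure.infinitePi fun _ : ℤ => bern ρ) (Measure.infinitePi fun _ : ℤ => bern ρ) := by
    refine ⟨by unfold Function.comp; fun_prop, ?_⟩
    exact Measure.map_infinitePi_infinitePi_of_inj (P := fun _ : ℤ => bern ρ)
      (f := e) e.injective
  exact (MeasurePreserving.id _).prod h2

/-- Overwriting one coordinate of a product measure by an independent variable of the same law
preserves the measure, as is seen on finite boxes. This is Fubini in a single waiting time without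
splitting the index set. -/
theorem lintegral_resample (p : ℤ × ℕ) {f : Data → ℝ≥0∞} (hf : Measurable f) :
    ∫⁻ d, f d ∂(law ρ) = ∫⁻ d, ∫⁻ u, f (resample p u d) ∂(expMeasure 1) ∂(law ρ) := by
  set m := Measure.infinitePi fun _ : ℤ × ℕ => expMeasure 1 with hm
  have hmeas : Measurable fun q : (ℤ × ℕ → ℝ) × ℝ => Function.update q.1 p q.2 := by
    refine measurable_pi_lambda _ fun q => ?_
    by_cases h : q = p
    · subst h; simp only [Function.update_self]; fun_prop
    · simp only [Function.update_of_ne h]; fun_prop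
  have h1 : MeasurePreserving (fun q : (ℤ × ℕ → ℝ) × ℝ => Function.update q.1 p q.2)
      (m.prod (expMeasure 1)) m := by
    refine ⟨hmeas, ?_⟩
    refine Measure.eq_infinitePi _ fun s t ht => ?_
    rw [Measure.map_apply hmeas (MeasurableSet.pi s.countable_toSet fun i _ => ht i)]
    by_cases hp : p ∈ s
    · have : (fun q : (ℤ × ℕ → ℝ) × ℝ => Function.update q.1 p q.2) ⁻¹' (Set.pi s t) =
          (Set.pi (s.erase p : Finset _) t) ×ˢ t p := by
        ext ⟨f, u⟩
        simp only [Set.mem_preimage, Set.mem_pi, Finset.mem_coe, Set.mem_prod, Finset.mem_erase]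
        constructor
        · intro h
          refine ⟨fun i hi => ?_, by simpa using h p hp⟩
          simpa [Function.update_of_ne hi.1] using h i hi.2
        · rintro ⟨h1, h2⟩ i hi
          by_cases hip : i = p
          · subst hip; simpa using h2
          · simpa [Function.update_of_ne hip] using h1 i ⟨hip, hi⟩
      rw [this, Measure.prod_prod, hm, Measure.infinitePi_pi _ fun i _ => ht i, mul_comm,
        Finset.mul_prod_erase _ (fun i => expMeasure 1 (t i)) hp]
    · have : (fun q : (ℤ × ℕ → ℝ) × ℝ => Function.update q.1 p q.2) ⁻¹' (Set.pi s t) =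
          (Set.pi s t) ×ˢ Set.univ := by
        ext ⟨f, u⟩
        simp only [Set.mem_preimage, Set.mem_pi, Finset.mem_coe, Set.mem_prod, Set.mem_univ,
          and_true]
        refine forall₂_congr fun i hi => ?_
        rw [Function.update_of_ne (by rintro rfl; exact hp hi)]
      rw [this, Measure.prod_prod, hm, Measure.infinitePi_pi _ fun i _ => ht i, measure_univ,
        mul_one]
  have hm2 : Measurable fun d => ∫⁻ u, f (resample p u d) ∂(expMeasure 1) :=
    (hf.comp (measurable_resample p)).lintegral_prod_right'
  rw [law, lintegral_prod_symm _ hf.aemeasurable, lintegral_prod_symm _ hm2.aemeasurable]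
  refine lintegral_congr fun y => ?_
  have hfy : Measurable fun x => f (x, y) := hf.comp measurable_prodMk_right
  rw [← hm]
  refine (h1.lintegral_comp hfy).symm.trans ?_
  exact lintegral_prod (fun q : (ℤ × ℕ → ℝ) × ℝ => f (Function.update q.1 p q.2, y))
    (hfy.comp hmeas).aemeasurable

end

/-! ### Independence of disjoint windows -/

/-- For fixed second coordinate `b`, independence under `μ` factorises the measure of the section;
the two factors are functions of `B₁ b` and `B₂ b`, which are independent under `ν`. -/
theorem indepFun_prod_prod {α β α₁ α₂ β₁ β₂ : Type*} [MeasurableSpace α] [MeasurableSpace β]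
    [MeasurableSpace α₁] [MeasurableSpace α₂] [MeasurableSpace β₁] [MeasurableSpace β₂]
    {μ : Measure α} {ν : Measure β} [IsProbabilityMeasure μ] [IsProbabilityMeasure ν]
    {A₁ : α → α₁} {A₂ : α → α₂} {B₁ : β → β₁} {B₂ : β → β₂}
    (hA₁ : Measurable A₁) (hA₂ : Measurable A₂) (hB₁ : Measurable B₁) (hB₂ : Measurable B₂)
    (hA : IndepFun A₁ A₂ μ) (hB : IndepFun B₁ B₂ ν) :
    IndepFun (fun p : α × β => (A₁ p.1, B₁ p.2)) (fun p : α × β => (A₂ p.1, B₂ p.2))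
      (μ.prod ν) := by
  rw [indepFun_iff_measure_inter_preimage_eq_mul]
  intro s t hs ht
  have m₁ : Measurable fun p : α × β => (A₁ p.1, B₁ p.2) := by fun_prop
  have m₂ : Measurable fun p : α × β => (A₂ p.1, B₂ p.2) := by fun_prop
  have f₁ : Measurable fun b => (μ.map A₁) ((fun a => (a, b)) ⁻¹' s) :=
    measurable_measure_prodMk_right hs
  have f₂ : Measurable fun b => (μ.map A₂) ((fun a => (a, b)) ⁻¹' t) :=
    measurable_measure_prodMk_right ht
  rw [Measure.prod_apply_symm ((m₁ hs).inter (m₂ ht)), Measure.prod_apply_symm (m₁ hs),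
    Measure.prod_apply_symm (m₂ ht)]
  have e₁ : ∀ b, μ ((fun a => (a, b)) ⁻¹' ((fun p : α × β => (A₁ p.1, B₁ p.2)) ⁻¹' s)) =
      (μ.map A₁) ((fun a => (a, B₁ b)) ⁻¹' s) := fun b => by
    rw [Measure.map_apply hA₁ (measurable_prodMk_right hs)]; rfl
  have e₂ : ∀ b, μ ((fun a => (a, b)) ⁻¹' ((fun p : α × β => (A₂ p.1, B₂ p.2)) ⁻¹' t)) =
      (μ.map A₂) ((fun a => (a, B₂ b)) ⁻¹' t) := fun b => by
    rw [Measure.map_apply hA₂ (measurable_prodMk_right ht)]; rfl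
  have e₃ : ∀ b, μ ((fun a => (a, b)) ⁻¹' ((fun p : α × β => (A₁ p.1, B₁ p.2)) ⁻¹' s ∩
      (fun p : α × β => (A₂ p.1, B₂ p.2)) ⁻¹' t)) =
      (μ.map A₁) ((fun a => (a, B₁ b)) ⁻¹' s) * (μ.map A₂) ((fun a => (a, B₂ b)) ⁻¹' t) := by
    intro b
    rw [← e₁, ← e₂]
    exact hA.measure_inter_preimage_eq_mul ((fun a => (a, B₁ b)) ⁻¹' s)
      ((fun a => (a, B₂ b)) ⁻¹' t) (measurable_prodMk_right hs) (measurable_prodMk_right ht)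
  simp_rw [e₁, e₂, e₃]
  exact lintegral_mul_eq_lintegral_mul_lintegral_of_indepFun (f₁.comp hB₁) (f₂.comp hB₂)
    (hB.comp f₁ f₂)

section

variable (ρ : ℝ) [IsProbabilityMeasure (bern ρ)]

theorem indepFun_restrict {I I' : Finset (ℤ × ℕ)} {W W' : Finset ℤ} (hI : Disjoint I I')
    (hW : Disjoint W W') :
    IndepFun (fun d : Data => (fun i : I => d.1 i, fun x : W => d.2 x))
      (fun d : Data => (fun i : I' => d.1 i, fun x : W' => d.2 x)) (law ρ) := by
  refine indepFun_prod_prod (A₁ := fun (f : ℤ × ℕ → ℝ) (i : I) => f i)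
    (A₂ := fun (f : ℤ × ℕ → ℝ) (i : I') => f i) (B₁ := fun (f : ℤ → Bool) (i : W) => f i)
    (B₂ := fun (f : ℤ → Bool) (i : W') => f i) (by fun_prop) (by fun_prop) (by fun_prop)
    (by fun_prop) ?_ ?_
  · exact (iIndepFun_infinitePi (P := fun _ : ℤ × ℕ => expMeasure 1) (X := fun _ u => u)
      (by fun_prop)).indepFun_finset I I' hI (by fun_prop)
  · exact (iIndepFun_infinitePi (P := fun _ : ℤ => bern ρ) (X := fun _ u => u)
      (by fun_prop)).indepFun_finset W W' hW (by fun_prop)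

/-- Extend partial data by zero waiting times and empty sites. -/
def extendData (I : Finset (ℤ × ℕ)) (W : Finset ℤ) (q : (I → ℝ) × (W → Bool)) : Data :=
  (fun p => if h : p ∈ I then q.1 ⟨p, h⟩ else 0, fun y => if h : y ∈ W then q.2 ⟨y, h⟩ else false)

theorem measurable_extendData (I : Finset (ℤ × ℕ)) (W : Finset ℤ) :
    Measurable (extendData I W) := by
  refine Measurable.prodMk (measurable_pi_lambda _ fun p => ?_) (measurable_pi_lambda _ fun p => ?_)
  · split_ifs <;> fun_prop
  · split_ifs <;> fun_prop

theorem code_shift_congr {k : ℕ} {s : ℝ} {x : ℤ} {d d' : Data}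
    (h1 : ∀ p ∈ Finset.Icc (x - k) (x + k) ×ˢ Finset.range (k + 1), d.1 p = d'.1 p)
    (h2 : ∀ y ∈ Finset.Icc (x - k) (x + k), d.2 y = d'.2 y) :
    code k s (shift x d) = code k s (shift x d') := by
  have hr : ∀ (z : Win k) (n : Fin (k + 1)), ring (shift x d) z n = ring (shift x d') z n := by
    intro z n
    refine Finset.sum_congr rfl fun i hi => h1 _ ?_
    have hz := Finset.mem_Icc.1 z.2
    have hi' := Finset.mem_range.1 hi
    have hn := n.2
    exact Finset.mem_product.2 ⟨Finset.mem_Icc.2 ⟨by dsimp only; omega, by dsimp only; omega⟩,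
      Finset.mem_range.2 (by dsimp only; omega)⟩
  have hc : ∀ z : Win k, (shift x d).2 z = (shift x d').2 z := by
    intro z
    have hz := Finset.mem_Icc.1 z.2
    exact h2 _ (Finset.mem_Icc.2 ⟨by omega, by omega⟩)
  simp only [code, hr, hc]

/-- The code of a window only depends on the data in that window. -/
theorem code_shift_eq (k : ℕ) (s : ℝ) (x : ℤ) (d : Data) : code k s (shift x d) =
    code k s (shift x (extendData (Finset.Icc (x - k) (x + k) ×ˢ Finset.range (k + 1))
      (Finset.Icc (x - k) (x + k)) (fun i => d.1 i, fun y => d.2 y))) :=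
  code_shift_congr (fun p hp => by simp only [extendData]; rw [dif_pos hp])
    (fun y hy => by simp only [extendData]; rw [dif_pos hy])

theorem measurable_code_right (k : ℕ) (s : ℝ) : Measurable (code k s) :=
  (measurable_code k).comp measurable_prodMk_left

/-- The windows of radius `k` around `0` and `x` are disjoint, and each code factors through the
coordinates of its own window by `code_shift_eq`. -/
theorem indepFun_code {k : ℕ} {x : ℤ} (hx : 2 * (k : ℤ) < |x|) (s s' : ℝ) :
    IndepFun (fun d : Data => code k s (shift 0 d)) (fun d : Data => code k s' (shift x d))
      (law ρ) := by
  have hW : Disjoint (Finset.Icc ((0 : ℤ) - k) (0 + k)) (Finset.Icc (x - k) (x + k)) := by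
    rw [Finset.disjoint_left]
    intro y hy hy'
    rw [Finset.mem_Icc] at hy hy'
    rcases abs_cases x with h | h <;> omega
  have hm : ∀ (s : ℝ) (x : ℤ), Measurable fun q => code k s (shift x (extendData
      (Finset.Icc (x - k) (x + k) ×ˢ Finset.range (k + 1)) (Finset.Icc (x - k) (x + k)) q)) :=
    fun s x => (measurable_code_right k s).comp
      ((measurable_shift x).comp (measurable_extendData _ _))
  have := (indepFun_restrict ρ (Finset.disjoint_product.2 (Or.inl hW)) hW).comp (hm s 0) (hm s' x)
  rw [funext (code_shift_eq k s 0), funext (code_shift_eq k s' x)]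
  exact this

end

/-! ### Almost sure properties of the clocks -/

section

variable {ρ : ℝ} [IsProbabilityMeasure (bern ρ)]

/-- It suffices to check nullity conditionally on all other coordinates. Coincidences of ring times
then reduce to single points, which the exponential law does not charge. -/
theorem law_null_of_resample (p : ℤ × ℕ) {A : Set Data} (hA : MeasurableSet A)
    (h : ∀ d, expMeasure 1 {u | resample p u d ∈ A} = 0) : law ρ A = 0 := by
  have hm : ∀ d, MeasurableSet {u | resample p u d ∈ A} := fun d =>
    ((measurable_resample p).comp measurable_prodMk_left) hA
  rw [← lintegral_indicator_one hA, lintegral_resample p (measurable_one.indicator hA)]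
  have : ∀ d, ∫⁻ u, A.indicator (1 : Data → ℝ≥0∞) (resample p u d) ∂(expMeasure 1) = 0 := by
    intro d
    rw [← h d, ← lintegral_indicator_one (hm d)]
    rfl
  simp [this]

theorem ring_resample_self (x : ℤ) (n : ℕ) (u : ℝ) (d : Data) :
    ring (resample (x, n) u d) x n = ∑ k ∈ Finset.range n, d.1 (x, k) + u := by
  rw [ring, Finset.sum_range_succ]
  congr 1
  · refine Finset.sum_congr rfl fun k hk => ?_
    have : (x, k) ≠ (x, n) := by
      have := Finset.mem_range.1 hk
      simp only [ne_eq, Prod.mk.injEq, true_and]; omega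
    simp [resample, Function.update_of_ne this]
  · simp [resample]

theorem ring_resample_of_ne {x y : ℤ} (hxy : y ≠ x) (n m : ℕ) (u : ℝ) (d : Data) :
    ring (resample (x, n) u d) y m = ring d y m := by
  refine Finset.sum_congr rfl fun k _ => ?_
  have : (y, k) ≠ (x, n) := by simp [hxy]
  simp [resample, Function.update_of_ne this]

theorem ring_resample_of_lt (x : ℤ) {n m : ℕ} (hm : m < n) (u : ℝ) (d : Data) :
    ring (resample (x, n) u d) x m = ring d x m := by
  refine Finset.sum_congr rfl fun k hk => ?_
  have : (x, k) ≠ (x, n) := by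
    have := Finset.mem_range.1 hk
    simp only [ne_eq, Prod.mk.injEq, true_and]; omega
  simp [resample, Function.update_of_ne this]

theorem ae_pos : ∀ᵐ d ∂(law ρ), ∀ p, 0 < d.1 p := by
  rw [ae_all_iff]
  intro p
  rw [ae_iff]
  refine law_null_of_resample p ?_ fun d => ?_
  · simp only [not_lt]
    exact measurableSet_le (by fun_prop) measurable_const
  · have := expMeasure_ae_pos
    rw [ae_iff] at this
    convert this using 2
    ext u; simp [resample]

theorem ae_ring_ne (s : ℝ) : ∀ᵐ d ∂(law ρ), ∀ x n, ring d x n ≠ s := by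
  simp only [ae_all_iff]
  intro x n
  rw [ae_iff]
  refine law_null_of_resample (x, n) ?_ fun d => ?_
  · simp only [not_not]
    exact measurableSet_eq_fun (measurable_ring x n) measurable_const
  · refine measure_mono_null (t := {s - ∑ k ∈ Finset.range n, d.1 (x, k)}) ?_
      (measure_singleton _)
    intro u hu
    have hu' : ¬ (ring (resample (x, n) u d) x n ≠ s) := hu
    rw [not_not, ring_resample_self] at hu'
    rw [Set.mem_singleton_iff]; linarith

theorem ae_ring_injective : ∀ᵐ d ∂(law ρ), ∀ x y m l, ring d x m = ring d y l → x = y ∧ m = l := by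
  have h1 : ∀ᵐ d ∂(law ρ), ∀ x y m l, x ≠ y → ring d x m ≠ ring d y l := by
    simp only [ae_all_iff]
    intro x y m l hxy
    rw [ae_iff]
    refine law_null_of_resample (x, m) ?_ fun d => ?_
    · simp only [not_not]
      exact measurableSet_eq_fun (measurable_ring x m) (measurable_ring y l)
    · refine measure_mono_null (t := {ring d y l - ∑ k ∈ Finset.range m, d.1 (x, k)}) ?_
        (measure_singleton _)
      intro u hu
      have hu' : ¬ (ring (resample (x, m) u d) x m ≠ ring (resample (x, m) u d) y l) := hu
      rw [not_not, ring_resample_self, ring_resample_of_ne hxy.symm] at hu'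
      rw [Set.mem_singleton_iff]; linarith
  filter_upwards [h1, ae_pos] with d hd hpos x y m l heq
  by_cases hxy : x = y
  · subst hxy
    refine ⟨rfl, ?_⟩
    have hs : StrictMono (ring d x) := strictMono_nat_of_lt_succ fun n => by
      unfold ring; rw [Finset.sum_range_succ _ (n + 1)]; linarith [hpos (x, n + 1)]
    exact hs.injective heq
  · exact absurd heq (hd x y m l hxy)

theorem lintegral_exp_neg_sum (x : ℤ) (n : ℕ) :
    ∫⁻ d, ENNReal.ofReal (Real.exp (-∑ k ∈ Finset.range n, d.1 (x, k))) ∂(law ρ) = 2⁻¹ ^ n := by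
  induction n with
  | zero => simp
  | succ n ih =>
    rw [lintegral_resample (x, n) (by fun_prop)]
    have : ∀ d : Data, ∫⁻ u, ENNReal.ofReal (Real.exp (-∑ k ∈ Finset.range (n + 1),
        (resample (x, n) u d).1 (x, k))) ∂(expMeasure 1) =
        ENNReal.ofReal (Real.exp (-∑ k ∈ Finset.range n, d.1 (x, k))) * 2⁻¹ := by
      intro d
      rw [← lintegral_exp_neg_expMeasure, ← lintegral_const_mul _ (by fun_prop)]
      refine lintegral_congr fun u => ?_
      rw [← ENNReal.ofReal_mul (Real.exp_pos _).le, ← Real.exp_add]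
      have := ring_resample_self x n u d
      rw [ring] at this
      rw [this, neg_add]
    simp_rw [this]
    rw [lintegral_mul_const _ (by fun_prop), ih, pow_succ]

/-- Chernoff's bound: Markov's inequality for `e^{-ring}`, whose mean is `2^{-(n+1)}`. -/
theorem law_ring_le (x : ℤ) (n : ℕ) (t : ℝ) :
    (law ρ) {d | ring d x n ≤ t} ≤ ENNReal.ofReal (Real.exp t) * 2⁻¹ ^ (n + 1) := by
  have h := mul_meas_ge_le_lintegral (μ := law ρ) (f := fun d : Data =>
    ENNReal.ofReal (Real.exp (-∑ k ∈ Finset.range (n + 1), d.1 (x, k)))) (by fun_prop)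
    (ENNReal.ofReal (Real.exp (-t)))
  rw [lintegral_exp_neg_sum] at h
  have hset : {d : Data | ring d x n ≤ t} = {d : Data | ENNReal.ofReal (Real.exp (-t)) ≤
      ENNReal.ofReal (Real.exp (-∑ k ∈ Finset.range (n + 1), d.1 (x, k)))} := by
    ext d
    simp only [Set.mem_ofPred_eq, ring]
    rw [ENNReal.ofReal_le_ofReal_iff (Real.exp_pos _).le, Real.exp_le_exp, neg_le_neg_iff]
  rw [hset]
  calc _ = ENNReal.ofReal (Real.exp t) * (ENNReal.ofReal (Real.exp (-t)) * law ρ {d : Data |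
        ENNReal.ofReal (Real.exp (-t)) ≤
          ENNReal.ofReal (Real.exp (-∑ k ∈ Finset.range (n + 1), d.1 (x, k)))}) := by
        rw [← mul_assoc, ← ENNReal.ofReal_mul (Real.exp_pos _).le, ← Real.exp_add]; simp
    _ ≤ _ := by gcongr

theorem law_real_ring_le (x : ℤ) (n : ℕ) (t : ℝ) :
    (law ρ).real {d | ring d x n ≤ t} ≤ Real.exp t * (1 / 2) ^ (n + 1) := by
  refine ENNReal.toReal_le_of_le_ofReal (by positivity) ((law_ring_le x n t).trans_eq ?_)
  rw [ENNReal.ofReal_mul (Real.exp_pos _).le, ENNReal.ofReal_pow (by norm_num)]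
  congr 2
  rw [one_div, ENNReal.ofReal_inv_of_pos two_pos]; simp

theorem ae_finite_ring : ∀ᵐ d ∂(law ρ), ∀ x t, {n | ring d x n ≤ t}.Finite := by
  have h : ∀ᵐ d ∂(law ρ), ∀ (x : ℤ) (N : ℕ), {n | ring d x n ≤ N}.Finite := by
    simp only [ae_all_iff]
    intro x N
    refine ae_finite_setOfPred_mem (s := fun n => {d : Data | ring d x n ≤ N}) ?_
    refine ne_top_of_le_ne_top ?_ (ENNReal.tsum_le_tsum fun n => law_ring_le x n N)
    rw [ENNReal.tsum_mul_left]
    refine ENNReal.mul_ne_top ENNReal.ofReal_ne_top ?_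
    simp_rw [pow_succ]
    rw [ENNReal.tsum_mul_right, ENNReal.tsum_geometric]
    simp
  filter_upwards [h] with d hd x t
  obtain ⟨N, hN⟩ := exists_nat_ge t
  exact (hd x N).subset fun n (hn : ring d x n ≤ t) => hn.trans hN

theorem good_antitone {k : ℕ} {s t : ℝ} (hst : s ≤ t) {d : Data} (h : Good (code k t d)) :
    Good (code k s d) := by
  obtain ⟨⟨a, ha0, ha⟩, ⟨b, hb0, hb⟩, hc⟩ := h
  exact ⟨⟨a, ha0, fun h => ha (h.trans hst)⟩, ⟨b, hb0, fun h => hb (h.trans hst)⟩,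
    fun z h => hc z (h.trans hst)⟩

theorem law_real_silent (W : Finset ℤ) {t : ℝ} (ht : 0 ≤ t) :
    (law ρ).real {d | ∀ z ∈ W, ring d z 0 ≤ t} = (1 - Real.exp (-t)) ^ W.card := by
  have hset : {d : Data | ∀ z ∈ W, ring d z 0 ≤ t} =
      (Set.pi (W.map ⟨fun z => (z, 0), fun a b h => (Prod.ext_iff.1 h).1⟩ : Finset (ℤ × ℕ))
        fun _ => Set.Iic t) ×ˢ Set.univ := by
    ext d
    simp [ring, Set.mem_pi]
    rfl
  rw [hset, measureReal_def, law, Measure.prod_prod,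
    Measure.infinitePi_pi _ fun _ _ => measurableSet_Iic]
  simp only [measure_univ, mul_one, Finset.prod_const, Finset.card_map, ENNReal.toReal_pow]
  rw [expMeasure_Iic t ht, ENNReal.toReal_ofReal]
  simpa using ht

/-- Good windows fail with exponentially small probability. -/
theorem law_real_not_good {t : ℝ} (ht : 0 ≤ t) : ∃ C r : ℝ, 0 ≤ C ∧ 0 < r ∧ r < 1 ∧
    ∀ s ≤ t, ∀ k : ℕ, (law ρ).real {d | ¬ Good (code k s d)} ≤ C * r ^ k := by
  set q := 1 - Real.exp (-t) with hq
  have hq0 : 0 ≤ q := by simpa [hq] using ht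
  have hq1 : q < 1 := by simp [hq, Real.exp_pos]
  -- `q` is the probability that a given clock has rung by time `t`, so `q ^ k` bounds the absence
  -- of a silent clock on either side. The rate `3/4` absorbs the number `2k + 1` of sites
  -- multiplying `2^{-(k+1)}`.
  refine ⟨2 + 2 * Real.exp t, max q (3 / 4), by positivity, by positivity,
    max_lt hq1 (by norm_num), fun s hs k => ?_⟩
  have hsub : {d : Data | ¬ Good (code k s d)} ⊆
      ({d | ∀ z ∈ Finset.Ico (-k : ℤ) 0, ring d z 0 ≤ t} ∪
        {d | ∀ z ∈ Finset.Ioc 0 (k : ℤ), ring d z 0 ≤ t}) ∪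
        ⋃ z ∈ Finset.Icc (-k : ℤ) k, {d | ring d z k ≤ t} := by
    intro d hd
    by_contra hcon
    simp only [Set.mem_union, Set.mem_ofPred_eq, Set.mem_iUnion, not_or, not_forall, not_le,
      exists_prop, not_exists, not_and] at hcon
    obtain ⟨⟨⟨a, ha, ha'⟩, b, hb, hb'⟩, hc⟩ := hcon
    rw [Finset.mem_Ico] at ha
    rw [Finset.mem_Ioc] at hb
    refine hd (good_antitone hs ⟨⟨⟨a, Finset.mem_Icc.2 ⟨ha.1, by omega⟩⟩, ha.2, not_le.2 ha'⟩,
      ⟨⟨b, Finset.mem_Icc.2 ⟨by omega, hb.2⟩⟩, hb.1, not_le.2 hb'⟩, fun z => not_le.2 (hc z z.2)⟩)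
  have h1 := law_real_silent (ρ := ρ) (Finset.Ico (-k : ℤ) 0) ht
  have h2 := law_real_silent (ρ := ρ) (Finset.Ioc 0 (k : ℤ)) ht
  have h3 : (law ρ).real (⋃ z ∈ Finset.Icc (-k : ℤ) k, {d | ring d z k ≤ t}) ≤
      (2 * k + 1) * (Real.exp t * (1 / 2) ^ (k + 1)) := by
    refine (measureReal_biUnion_finset_le _ _).trans ?_
    refine (Finset.sum_le_sum fun z _ => law_real_ring_le z k t).trans_eq ?_
    rw [Finset.sum_const, Int.card_Icc, nsmul_eq_mul]
    congr 1
    have : ((k : ℤ) + 1 - -k).toNat = 2 * k + 1 := by omega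
    rw [this]; push_cast; ring
  have h4 : (2 * k + 1 : ℝ) * (1 / 2) ^ (k + 1) ≤ 2 * (3 / 4) ^ k := by
    -- Bernoulli's inequality `1 + k/2 ≤ (3/2)^k` beats the linear factor.
    have := one_add_mul_le_pow (a := (1 / 2 : ℝ)) (by norm_num) k
    have e : (3 / 4 : ℝ) ^ k = (1 + 1 / 2) ^ k * (1 / 2) ^ k := by
      rw [← mul_pow]; norm_num
    rw [e, pow_succ]
    have hp : (0 : ℝ) < (1 / 2) ^ k := by positivity
    nlinarith
  have hqr : q ^ k ≤ (max q (3 / 4)) ^ k := pow_le_pow_left₀ hq0 (le_max_left _ _) k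
  have h3r : (3 / 4 : ℝ) ^ k ≤ (max q (3 / 4)) ^ k :=
    pow_le_pow_left₀ (by norm_num) (le_max_right _ _) k
  calc (law ρ).real {d | ¬ Good (code k s d)}
      ≤ q ^ k + q ^ k + (2 * k + 1) * (Real.exp t * (1 / 2) ^ (k + 1)) := by
        refine (measureReal_mono hsub).trans ((measureReal_union_le _ _).trans ?_)
        refine add_le_add ((measureReal_union_le _ _).trans ?_) h3
        rw [h1, h2, ← hq]
        simp
    _ ≤ _ := by
        have := mul_le_mul_of_nonneg_left (h4.trans (mul_le_mul_of_nonneg_left h3r two_pos.le))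
          (Real.exp_pos t).le
        nlinarith

/-- Goodness passes to earlier times, so integer times and integer translates suffice and a single
null set serves all real times. -/
theorem ae_exists_good : ∀ᵐ d ∂(law ρ), ∀ (c : ℤ) (s : ℝ), ∃ k, Good (code k s (shift c d)) := by
  have h0 : ∀ N : ℕ, ∀ᵐ d ∂(law ρ), ∃ k, Good (code k N d) := by
    intro N
    obtain ⟨C, r, hC, hr0, hr1, h⟩ := law_real_not_good (ρ := ρ) (t := N) (Nat.cast_nonneg N)
    rw [ae_iff, ← measureReal_eq_zero_iff]
    refine le_antisymm ?_ measureReal_nonneg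
    have hlim : Tendsto (fun k : ℕ => C * r ^ k) atTop (𝓝 0) := by
      simpa using (tendsto_pow_atTop_nhds_zero_of_lt_one hr0.le hr1).const_mul C
    refine ge_of_tendsto' hlim fun k => ?_
    refine (measureReal_mono ?_).trans (h N le_rfl k)
    intro d hd hg
    exact hd ⟨k, hg⟩
  have h1 : ∀ᵐ d ∂(law ρ), ∀ (c : ℤ) (N : ℕ), ∃ k, Good (code k N (shift c d)) := by
    simp only [ae_all_iff]
    exact fun c N => (measurePreserving_shift ρ c).quasiMeasurePreserving.ae (h0 N)
  filter_upwards [h1] with d hd c s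
  obtain ⟨N, hN⟩ := exists_nat_ge s
  obtain ⟨k, hk⟩ := hd c N
  exact ⟨k, good_antitone hN hk⟩

end

/-! ### The compensator of the clock rings -/

/-- `H s d` does not depend on the rings of the clock `x` at or after time `s`. -/
def Predictable {β : Type*} (x : ℤ) (H : ℝ → Data → β) : Prop :=
  ∀ (d : Data) (n : ℕ) (u u' s : ℝ), (∀ p, 0 < d.1 p) → 0 < u → 0 < u' →
    s ≤ ring (resample (x, n) u d) x n → s ≤ ring (resample (x, n) u' d) x n →
    H s (resample (x, n) u d) = H s (resample (x, n) u' d)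

theorem measurable_lintegral_between {H : ℝ → Data → ℝ≥0∞}
    (hH : Measurable (Function.uncurry H)) (x : ℤ) (n : ℕ) (t : ℝ) :
    Measurable fun d : Data => ∫⁻ s in Set.Ioc (∑ k ∈ Finset.range n, d.1 (x, k))
      (∑ k ∈ Finset.range (n + 1), d.1 (x, k)), (Set.Iic t).indicator (fun s => H s d) s := by
  have e : (fun d : Data => ∫⁻ s in Set.Ioc (∑ k ∈ Finset.range n, d.1 (x, k))
      (∑ k ∈ Finset.range (n + 1), d.1 (x, k)), (Set.Iic t).indicator (fun s => H s d) s) =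
      fun d => ∫⁻ s, ({q : Data × ℝ | ∑ k ∈ Finset.range n, q.1.1 (x, k) < q.2 ∧
      q.2 ≤ ring q.1 x n ∧ q.2 ≤ t}).indicator (fun q : Data × ℝ => H q.2 q.1) (d, s) := by
    funext d
    rw [← lintegral_indicator measurableSet_Ioc]
    refine lintegral_congr fun s => ?_
    by_cases h1 : ∑ k ∈ Finset.range n, d.1 (x, k) < s <;>
    by_cases h2 : s ≤ ∑ k ∈ Finset.range (n + 1), d.1 (x, k) <;>
    by_cases h3 : s ≤ t <;> simp [Set.indicator, ring, h1, h2, h3]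
  rw [e]
  refine Measurable.lintegral_prod_right' ?_
  refine (hH.comp measurable_swap).indicator ?_
  refine (measurableSet_lt (by fun_prop) measurable_snd).inter
    ((measurableSet_le measurable_snd ((measurable_ring x n).comp measurable_fst)).inter
      (measurableSet_le measurable_snd measurable_const))

section

variable {ρ : ℝ} [IsProbabilityMeasure (bern ρ)]

/-- Resample the `n`-th waiting time of the clock. The hazard rate identity `lintegral_expMeasure`
replaces the value at the ring by an integral over the waiting interval, and predictability allows
the data whose ring falls at `s` to be exchanged for the data whose ring falls later. -/
theorem lintegral_ring {x : ℤ} {H : ℝ → Data → ℝ≥0∞} (hH : Measurable (Function.uncurry H))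
    (hp : Predictable x H) (t : ℝ) (n : ℕ) :
    ∫⁻ d, (if ring d x n ≤ t then H (ring d x n) d else 0) ∂(law ρ) =
      ∫⁻ d, (∫⁻ s in Set.Ioc (∑ k ∈ Finset.range n, d.1 (x, k))
        (∑ k ∈ Finset.range (n + 1), d.1 (x, k)), (Set.Iic t).indicator (fun s => H s d) s)
        ∂(law ρ) := by
  set L : Data → ℝ≥0∞ := fun d => if ring d x n ≤ t then H (ring d x n) d else 0 with hL
  set G : Data → ℝ≥0∞ := fun d => ∫⁻ s in Set.Ioc (∑ k ∈ Finset.range n, d.1 (x, k))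
        (∑ k ∈ Finset.range (n + 1), d.1 (x, k)), (Set.Iic t).indicator (fun s => H s d) s with hG
  have hmr := measurable_ring x n
  have hLm : Measurable L := by
    refine Measurable.ite (measurableSet_le hmr measurable_const) ?_ measurable_const
    exact hH.comp (hmr.prodMk measurable_id)
  have hGm : Measurable G := measurable_lintegral_between hH x n t
  change ∫⁻ d, L d ∂(law ρ) = ∫⁻ d, G d ∂(law ρ)
  rw [lintegral_resample (x, n) hLm, lintegral_resample (x, n) hGm]
  refine lintegral_congr_ae ?_
  filter_upwards [ae_pos (ρ := ρ)] with d hd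
  have hLu : Measurable fun u => L (resample (x, n) u d) :=
    hLm.comp ((measurable_resample (x, n)).comp measurable_prodMk_left)
  rw [lintegral_expMeasure hLu]
  refine lintegral_congr_ae ?_
  filter_upwards [expMeasure_ae_pos] with u hu
  have e1 : ∀ s ∈ Set.Ioc 0 u, L (resample (x, n) s d) = (Set.Iic t).indicator
      (fun s => H s (resample (x, n) u d)) (∑ k ∈ Finset.range n, d.1 (x, k) + s) := by
    intro s hs
    simp only [hL, ring_resample_self]
    by_cases h : ∑ k ∈ Finset.range n, d.1 (x, k) + s ≤ t
    · rw [if_pos h, Set.indicator_of_mem (by exact h)]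
      refine hp d n s u _ hd hs.1 hu ?_ ?_
      · rw [ring_resample_self]
      · rw [ring_resample_self]; linarith [hs.2]
    · rw [if_neg h, Set.indicator_of_notMem (by exact h)]
  rw [setLIntegral_congr_fun measurableSet_Ioc e1]
  have e2 : ∑ k ∈ Finset.range (n + 1), (resample (x, n) u d).1 (x, k) =
      ∑ k ∈ Finset.range n, d.1 (x, k) + u := ring_resample_self x n u d
  have e3 : ∑ k ∈ Finset.range n, (resample (x, n) u d).1 (x, k) =
      ∑ k ∈ Finset.range n, d.1 (x, k) := by
    rw [Finset.sum_range_succ] at e2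
    simp only [resample, Function.update_self] at e2 ⊢
    linarith
  simp only [hG, e2, e3]
  rw [← lintegral_indicator measurableSet_Ioc, ← lintegral_indicator measurableSet_Ioc]
  conv_rhs => rw [← lintegral_add_left_eq_self _ (∑ k ∈ Finset.range n, d.1 (x, k))]
  refine lintegral_congr fun s => ?_
  by_cases h1 : 0 < s <;> by_cases h2 : s ≤ u <;> simp [Set.indicator, h1, h2]

/-- The successive waiting intervals of a clock tile `(0, ∞)`, since its rings do not accumulate;
summing `lintegral_ring` over `n` restores the full time integral. -/
theorem lintegral_tsum_ring {x : ℤ} {H : ℝ → Data → ℝ≥0∞} (hH : Measurable (Function.uncurry H))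
    (hp : Predictable x H) (t : ℝ) :
    ∫⁻ d, (∑' n, if ring d x n ≤ t then H (ring d x n) d else 0) ∂(law ρ) =
      ∫⁻ s in Set.Ioc 0 t, (∫⁻ d, H s d ∂(law ρ)) := by
  have hmr := measurable_ring x
  have hLm : ∀ n, Measurable fun d => if ring d x n ≤ t then H (ring d x n) d else 0 := fun n =>
    Measurable.ite (measurableSet_le (hmr n) measurable_const)
      (hH.comp ((hmr n).prodMk measurable_id)) measurable_const
  rw [lintegral_tsum fun n => (hLm n).aemeasurable]
  simp_rw [lintegral_ring hH hp t]
  have hm := fun n => (measurable_lintegral_between hH x n t).aemeasurable (μ := law ρ)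
  rw [← lintegral_tsum hm, lintegral_lintegral_swap hH.aemeasurable]
  refine lintegral_congr_ae ?_
  filter_upwards [ae_pos (ρ := ρ), ae_finite_ring (ρ := ρ)] with d hpos hfin
  have hmono : Monotone fun n => ∑ k ∈ Finset.range n, d.1 (x, k) :=
    monotone_nat_of_le_succ fun n => by
      rw [Finset.sum_range_succ]; linarith [hpos (x, n)]
  rw [← lintegral_iUnion (s := fun n => Set.Ioc (∑ k ∈ Finset.range n, d.1 (x, k))
    (∑ k ∈ Finset.range (n + 1), d.1 (x, k))) (fun n => measurableSet_Ioc)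
    hmono.pairwise_disjoint_on_Ioc_succ]
  have hU : ⋃ n, Set.Ioc (∑ k ∈ Finset.range n, d.1 (x, k))
      (∑ k ∈ Finset.range (n + 1), d.1 (x, k)) = Set.Ioi 0 := by
    have := iUnion_Ioc_map_succ_eq_Ioi (f := fun n => ∑ k ∈ Finset.range n, d.1 (x, k))
      (fun n => hmono (Nat.zero_le n)) ?_
    · simpa using this
    · rintro ⟨b, hb⟩
      refine Set.infinite_univ ((hfin x b).subset fun n _ => ?_)
      exact hb ⟨n + 1, rfl⟩
  rw [hU, ← lintegral_indicator measurableSet_Ioi, ← lintegral_indicator measurableSet_Ioc]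
  refine lintegral_congr fun s => ?_
  by_cases h1 : 0 < s <;> by_cases h2 : s ≤ t <;> simp [Set.indicator, h1, h2]

end

/-- The sum of `H` over the rings of the clock `x` up to time `t`. -/
noncomputable def ringSum (x : ℤ) (H : ℝ → Data → ℝ) (t : ℝ) (d : Data) : ℝ :=
  ∑' n, if ring d x n ≤ t then H (ring d x n) d else 0

section

variable {ρ : ℝ} [IsProbabilityMeasure (bern ρ)]

theorem summable_ring {d : Data} {x : ℤ} {t : ℝ} (hfin : {n | ring d x n ≤ t}.Finite)
    (H : ℝ → Data → ℝ) : Summable fun n => if ring d x n ≤ t then H (ring d x n) d else 0 :=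
  summable_of_hasFiniteSupport (hfin.subset fun n hn => by
    by_contra hcon
    exact hn (if_neg hcon))

theorem ringSum_nonneg_aux {x : ℤ} {H : ℝ → Data → ℝ} (hH : Measurable (Function.uncurry H))
    (hp : Predictable x H) (h0 : ∀ s d, 0 ≤ H s d) {C : ℝ} (hC : ∀ s d, H s d ≤ C) (t : ℝ) :
    Integrable (ringSum x H t) (law ρ) ∧
      ∫ d, ringSum x H t d ∂(law ρ) = ∫ s in Set.Ioc 0 t, (∫ d, H s d ∂(law ρ)) := by
  set E : Data → ℝ≥0∞ := fun d =>
    ∑' n, if ring d x n ≤ t then ENNReal.ofReal (H (ring d x n) d) else 0 with hE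
  have hp' : Predictable x fun s d => ENNReal.ofReal (H s d) := by
    intro d n u u' s h1 h2 h3 h4 h5
    simp only [hp d n u u' s h1 h2 h3 h4 h5]
  have hH' : Measurable (Function.uncurry fun s d => ENNReal.ofReal (H s d)) := hH.ennreal_ofReal
  have hEl := lintegral_tsum_ring (ρ := ρ) hH' hp' t
  have hmr := measurable_ring x
  have hEm : Measurable E := Measurable.tsum fun n =>
    Measurable.ite (measurableSet_le (hmr n) measurable_const)
      (hH'.comp ((hmr n).prodMk measurable_id)) measurable_const
  have hfin : ∫⁻ s in Set.Ioc 0 t, (∫⁻ d, ENNReal.ofReal (H s d) ∂(law ρ)) < ∞ := by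
    calc _ ≤ ∫⁻ s in Set.Ioc 0 t, (∫⁻ d, ENNReal.ofReal C ∂(law ρ)) :=
          lintegral_mono fun s => lintegral_mono fun d => ENNReal.ofReal_le_ofReal (hC s d)
      _ < ∞ := by simp [ENNReal.mul_lt_top]
  have hEeq : ringSum x H t =ᵐ[law ρ] fun d => (E d).toReal := by
    filter_upwards [ae_finite_ring (ρ := ρ)] with d hd
    have hs := summable_ring (hd x t) H
    have hnn : ∀ n, 0 ≤ if ring d x n ≤ t then H (ring d x n) d else 0 := fun n => by
      split_ifs; exacts [h0 _ _, le_rfl]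
    have : E d = ENNReal.ofReal (ringSum x H t d) := by
      rw [ringSum, ENNReal.ofReal_tsum_of_nonneg hnn hs]
      refine tsum_congr fun n => ?_
      split_ifs <;> simp
    rw [this, ENNReal.toReal_ofReal]
    exact tsum_nonneg hnn
  have hEfin : ∫⁻ d, E d ∂(law ρ) ≠ ∞ := by rw [hEl]; exact hfin.ne
  refine ⟨(integrable_toReal_of_lintegral_ne_top hEm.aemeasurable hEfin).congr hEeq.symm, ?_⟩
  rw [integral_congr_ae hEeq, integral_toReal hEm.aemeasurable (ae_lt_top hEm hEfin), hEl]
  have hswap : Measurable fun s => ∫⁻ d, ENNReal.ofReal (H s d) ∂(law ρ) :=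
    hH'.lintegral_prod_right'
  rw [← integral_toReal hswap.aemeasurable (ae_lt_top hswap hfin.ne)]
  refine integral_congr_ae (Eventually.of_forall fun s => ?_)
  simp only
  rw [integral_eq_lintegral_of_nonneg_ae (Eventually.of_forall (h0 s))]
  exact (hH.comp measurable_prodMk_left).aestronglyMeasurable

/-- The compensator formula for bounded predictable integrands. -/
theorem integrable_integral_ringSum {x : ℤ} {H : ℝ → Data → ℝ}
    (hH : Measurable (Function.uncurry H)) (hp : Predictable x H) {C : ℝ}
    (hC : ∀ s d, |H s d| ≤ C) (t : ℝ) :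
    Integrable (ringSum x H t) (law ρ) ∧
      ∫ d, ringSum x H t d ∂(law ρ) = ∫ s in Set.Ioc 0 t, (∫ d, H s d ∂(law ρ)) := by
  -- Adding `C` makes the integrand nonnegative; the constant integrand obeys the same formula and
  -- is subtracted again.
  have h1 := ringSum_nonneg_aux (ρ := ρ) (H := fun s d => H s d + C) (x := x) (C := C + C)
    (hH.add_const C)
    (fun d n u u' s h1 h2 h3 h4 h5 => by simp only [hp d n u u' s h1 h2 h3 h4 h5])
    (fun s d => by linarith [neg_abs_le (H s d), hC s d])
    (fun s d => by linarith [le_abs_self (H s d), hC s d]) t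
  have hC0 : 0 ≤ C := (abs_nonneg _).trans (hC 0 (0, fun _ => true))
  have h2 := ringSum_nonneg_aux (ρ := ρ) (H := fun _ _ => C) (x := x) (C := C)
    measurable_const (fun d n u u' s h1 h2 h3 h4 h5 => rfl) (fun s d => hC0) (fun s d => le_rfl) t
  have he : ringSum x H t =ᵐ[law ρ] fun d => ringSum x (fun s d => H s d + C) t d -
      ringSum x (fun _ _ => C) t d := by
    filter_upwards [ae_finite_ring (ρ := ρ)] with d hd
    rw [ringSum, ringSum, ringSum, ← Summable.tsum_sub
      (summable_ring (hd x t) fun s d => H s d + C)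
      (summable_ring (hd x t) fun _ _ => C)]
    refine tsum_congr fun n => ?_
    split_ifs <;> simp
  refine ⟨(h1.1.sub h2.1).congr he.symm, ?_⟩
  rw [integral_congr_ae he, integral_sub h1.1 h2.1, h1.2, h2.2]
  have hHi : ∀ s, Integrable (H s) (law ρ) := fun s =>
    Integrable.of_bound (hH.comp measurable_prodMk_left).aestronglyMeasurable C
      (Eventually.of_forall fun d => by simpa using hC s d)
  have hm : StronglyMeasurable fun s => ∫ d, H s d ∂(law ρ) :=
    hH.stronglyMeasurable.integral_prod_right'
  have hI : Integrable (fun s => ∫ d, H s d ∂(law ρ)) (volume.restrict (Set.Ioc 0 t)) := by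
    refine Integrable.of_bound hm.aestronglyMeasurable C (Eventually.of_forall fun s => ?_)
    refine (norm_integral_le_of_norm_le_const (Eventually.of_forall (hC s))).trans ?_
    simp
  have e : ∀ s, ∫ d, (H s d + C) ∂(law ρ) = ∫ d, H s d ∂(law ρ) + C := fun s => by
    rw [integral_add (hHi s) (integrable_const C)]; simp
  simp_rw [e]
  rw [integral_add hI (integrable_const _)]
  simp

end

/-! ### The configuration as a function of the data -/

/-- The configuration at time `s` read off from the data. -/
noncomputable def config (s : ℝ) (d : Data) (y : ℤ) : Bool :=
  value (fun _ σ s => σ s 0) s (shift y d)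

/-- The configuration just before time `s` read off from the data. -/
noncomputable def leftConfig (s : ℝ) (d : Data) (y : ℤ) : Bool :=
  open Classical in decide (∃ i : ℕ, ∀ j : ℕ, i ≤ j → config (s - 1 / (j + 1)) d y = true)

theorem measurable_config : Measurable fun p : ℝ × Data => config p.1 p.2 := by
  refine measurable_pi_lambda _ fun y => ?_
  exact measurable_value.comp (measurable_fst.prodMk ((measurable_shift y).comp measurable_snd))

theorem measurable_leftConfig : Measurable fun p : ℝ × Data => leftConfig p.1 p.2 := by
  refine measurable_pi_lambda _ fun y => ?_
  refine measurable_to_bool ?_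
  have : (fun p : ℝ × Data => leftConfig p.1 p.2 y) ⁻¹' {true} =
      ⋃ i : ℕ, ⋂ j : ℕ, ⋂ _ : i ≤ j,
        {p : ℝ × Data | config (p.1 - 1 / (j + 1)) p.2 y = true} := by
    ext p; simp [leftConfig]
  rw [this]
  refine MeasurableSet.iUnion fun i => MeasurableSet.iInter fun j => MeasurableSet.iInter fun _ => ?_
  have h1 : Measurable fun p : ℝ × Data => config (p.1 - 1 / (j + 1)) p.2 y :=
    (measurable_pi_apply y).comp (measurable_config.comp
      ((measurable_fst.sub_const _).prodMk measurable_snd))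
  exact h1 (measurableSet_singleton true)

/-- The order of two rings is recorded only if the later one occurs by time `s`, so the code ignores
everything after `s`. Predictability rests on this. -/
theorem code_congr {k : ℕ} {s : ℝ} {d d' : Data} (h0 : d.2 = d'.2)
    (h : ∀ x n, (ring d x n = ring d' x n) ∨ (s < ring d x n ∧ s < ring d' x n)) :
    code k s d = code k s d' := by
  have h1 : ∀ x n, ring d x n ≤ s ↔ ring d' x n ≤ s := by
    intro x n
    rcases h x n with h | ⟨h, h'⟩
    · rw [h]
    · exact iff_of_false (not_le.2 h) (not_le.2 h')
  have h2 : ∀ x n y m, (ring d x n < ring d y m ∧ ring d y m ≤ s) ↔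
      (ring d' x n < ring d' y m ∧ ring d' y m ≤ s) := by
    intro x n y m
    rcases h y m with hy | ⟨hy, hy'⟩
    · rw [hy]
      rcases h x n with hx | ⟨hx, hx'⟩
      · rw [hx]
      · exact iff_of_false (fun h => absurd (h.1.le.trans h.2) (not_le.2 hx))
          (fun h => absurd (h.1.le.trans h.2) (not_le.2 hx'))
    · exact iff_of_false (fun h => absurd h.2 (not_le.2 hy)) (fun h => absurd h.2 (not_le.2 hy'))
  exact Prod.ext (funext fun p => propext (h1 _ _))
    (Prod.ext (funext fun p => propext (h2 _ _ _ _)) (funext fun x => congrFun h0 x))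

theorem ring_le_ring {d : Data} (hd : ∀ p, 0 < d.1 p) (x : ℤ) {n m : ℕ} (h : n ≤ m) :
    ring d x n ≤ ring d x m :=
  Finset.sum_le_sum_of_subset_of_nonneg (Finset.range_mono (by omega)) fun i _ _ => (hd _).le

/-- `leftConfig s` samples only times strictly before `s`. Changing the waiting time `(x, n)` moves
only the rings of `x` with index at least `n`, and these are at or after `s` for both values. -/
theorem predictable_leftConfig (x : ℤ) : Predictable x leftConfig := by
  intro d n u u' s hd hu hu' hs hs'
  funext y
  have key : ∀ j : ℕ, config (s - 1 / (j + 1)) (resample (x, n) u d) y =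
      config (s - 1 / (j + 1)) (resample (x, n) u' d) y := by
    intro j
    have hj : s - 1 / ((j : ℝ) + 1) < s := by
      have : (0 : ℝ) < 1 / (j + 1) := by positivity
      linarith
    refine value_congr fun k => code_congr rfl fun z m => ?_
    rw [ring_shift, ring_shift]
    by_cases hz : z + y = x
    · rw [hz]
      by_cases hm : m < n
      · left
        rw [ring_resample_of_lt x hm, ring_resample_of_lt x hm]
      · right
        have hpos : ∀ v, 0 < v → ∀ p, 0 < (resample (x, n) v d).1 p := by
          intro v hv p
          by_cases hp : p = (x, n)
          · subst hp; simpa [resample] using hv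
          · simpa [resample, Function.update_of_ne hp] using hd p
        exact ⟨hj.trans_le (hs.trans (ring_le_ring (hpos u hu) x (not_lt.1 hm))),
          hj.trans_le (hs'.trans (ring_le_ring (hpos u' hu') x (not_lt.1 hm)))⟩
    · left
      rw [ring_resample_of_ne hz, ring_resample_of_ne hz]
  simp only [leftConfig, decide_eq_decide, key]

/-- A trajectory driven by typical data. -/
structure Typical (d : Data) (σ : ℝ → ℤ → Bool) : Prop where
  path : IsPath (ring d) σ
  init : σ 0 = d.2
  inj : ∀ x y m l, ring d x m = ring d y l → x = y ∧ m = l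
  good : ∀ c s, ∃ k, Good (code k s (shift c d))

theorem IsTASEP.ae_typical {Ω : Type*} [MeasurableSpace Ω] {P : Measure Ω} [IsProbabilityMeasure P]
    {ρ : ℝ} {ξ : ℤ → ℕ → Ω → ℝ} {η : ℝ → Ω → ℤ → Bool} (h : IsTASEP P ρ ξ η) (h0 : 0 < ρ)
    (h1 : ρ < 1) : ∀ᵐ ω ∂P, Typical (dataOf ξ η ω) fun t => η t ω := by
  have := isProbabilityMeasure_bern h0 h1
  have hq : ∀ {p : Data → Prop}, (∀ᵐ d ∂(law ρ), p d) → ∀ᵐ ω ∂P, p (dataOf ξ η ω) := by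
    intro p hp
    rw [← h.map_data h0 h1] at hp
    exact ae_of_ae_map h.measurable_data.aemeasurable hp
  filter_upwards [hq ae_pos, hq ae_finite_ring, hq ae_ring_injective, hq ae_exists_good,
    h.evolution] with ω w1 w2 w3 w4 w5
  refine ⟨⟨fun x n => ?_, fun x n m hnm => ring_le_ring w1 x hnm, w2, w5⟩, rfl, w3, w4⟩
  exact Finset.sum_pos (fun i _ => w1 _) ⟨0, by simp⟩

theorem pathCurrent_shift (T : ℤ → ℕ → ℝ) (σ : ℝ → ℤ → Bool) (c : ℤ) (t : ℝ) (x : ℤ) :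
    pathCurrent (fun x n => T (x + c) n) (fun t y => σ t (y + c)) t x =
      pathCurrent T σ t (x + c) := by
  simp only [pathCurrent, add_right_comm x 1 c]

namespace Typical

variable {d : Data} {σ : ℝ → ℤ → Bool}

theorem shift_path (h : Typical d σ) (c : ℤ) :
    IsPath (ring (shift c d)) fun t y => σ t (y + c) := by
  refine ⟨fun x n => h.path.pos (x + c) n, fun x => h.path.mono (x + c),
    fun x => h.path.fin (x + c), ?_⟩
  intro t ht x
  have := h.path.evol t ht (x + c)
  have e : ring (shift c d) = fun x n => ring d (x + c) n := rfl
  rw [e, pathCurrent_shift, pathCurrent_shift, this, sub_add_eq_add_sub]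

theorem value_shift {β : Type*} [Inhabited β] {Q : Data → (ℝ → ℤ → Bool) → ℝ → β}
    (hQ : LocalObs Q) (h : Typical d σ) (c : ℤ) {s : ℝ} (hs : 0 ≤ s) :
    value Q s (shift c d) = Q (shift c d) (fun t y => σ t (y + c)) s :=
  value_eq hQ (h.shift_path c) (by rw [h.init]; rfl) hs (h.good c s)

theorem codeValue_shift {β : Type*} [Inhabited β] {Q : Data → (ℝ → ℤ → Bool) → ℝ → β}
    (hQ : LocalObs Q) (h : Typical d σ) (c : ℤ) {s : ℝ} (hs : 0 ≤ s) {k : ℕ}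
    (hg : Good (code k s (shift c d))) :
    codeValue Q k (code k s (shift c d)) = Q (shift c d) (fun t y => σ t (y + c)) s :=
  codeValue_eq hQ (h.shift_path c) (by rw [h.init]; rfl) hs hg

theorem config_eq (h : Typical d σ) {s : ℝ} (hs : 0 ≤ s) : config s d = σ s := by
  funext y
  have := h.value_shift localObs_conf y hs
  simpa [config] using this

theorem leftConfig_eq (h : Typical d σ) {s : ℝ} (hs : 0 < s) : leftConfig s d = leftConf σ s := by
  funext y
  have hlim : Tendsto (fun j : ℕ => s - 1 / ((j : ℝ) + 1)) atTop (𝓝[<] s) := by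
    refine tendsto_nhdsWithin_iff.2 ⟨?_, Eventually.of_forall fun j => ?_⟩
    · simpa using tendsto_const_nhds.sub (tendsto_one_div_add_atTop_nhds_zero_nat (𝕜 := ℝ))
    · have : (0 : ℝ) < 1 / (j + 1) := by positivity
      simp only [Set.mem_Iio]; linarith
  have hev := hlim.eventually (h.path.eventually_leftConf {y} hs)
  have hev' : ∀ᶠ j : ℕ in atTop, config (s - 1 / ((j : ℝ) + 1)) d y = leftConf σ s y := by
    filter_upwards [hev] with j hj
    rw [h.config_eq hj.1, hj.2.2.2 y (by simp)]
  rw [leftConfig]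
  cases hb : leftConf σ s y with
  | true =>
    rw [hb] at hev'
    simpa using eventually_atTop.1 hev'
  | false =>
    rw [hb] at hev'
    simp only [decide_eq_false_iff_not]
    intro hcon
    obtain ⟨j, hj1, hj2⟩ := (hev'.and (eventually_atTop.2 hcon)).exists
    rw [hj1] at hj2
    exact absurd hj2 (by simp)

theorem tsum_ring_eq (h : Typical d σ) (x : ℤ) (t : ℝ) (f : ℕ → ℝ) :
    ∑' n, (if ring d x n ≤ t then f n else 0) = ∑ n ∈ (h.path.fin x t).toFinset, f n := by
  rw [tsum_eq_sum (s := (h.path.fin x t).toFinset)]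
  · refine Finset.sum_congr rfl fun n hn => ?_
    rw [if_pos]
    simpa using hn
  · intro n hn
    rw [if_neg]
    simpa using hn

theorem sum_jump_eq (h : Typical d σ) (g : (ℤ → Bool) → ℝ) (A : Finset ℤ) (t : ℝ) :
    ∑ p ∈ (h.path.finite_rings A t).toFinset, IsPath.jump g p.1 (leftConf σ (ring d p.1 p.2)) =
      ∑ x ∈ A, ringSum x (fun s d => IsPath.jump g x (leftConfig s d)) t d := by
  rw [Finset.sum_finset_product _ A fun x => (h.path.fin x t).toFinset]
  · refine Finset.sum_congr rfl fun x _ => ?_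
    rw [ringSum, h.tsum_ring_eq x t fun n => IsPath.jump g x (leftConfig (ring d x n) d)]
    refine Finset.sum_congr rfl fun n _ => ?_
    rw [h.leftConfig_eq (h.path.pos x n)]
  · intro p
    simp

/-- `rate` is the indicator that a ring at the origin produces a jump, so its sum over the rings
counts the jumps. -/
theorem pathCurrent_eq (h : Typical d σ) (t : ℝ) : (pathCurrent (ring d) σ t 0 : ℝ) =
    ringSum 0 (fun s d => rate (leftConfig s d)) t d := by
  rw [ringSum, h.tsum_ring_eq 0 t fun n => rate (leftConfig (ring d 0 n) d), h.path.pathCurrent_eq]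
  have : {n : ℕ | ring d 0 n ≤ t ∧ leftConf σ (ring d 0 n) 0 = true ∧
      leftConf σ (ring d 0 n) (0 + 1) = false} = ((h.path.fin 0 t).toFinset.filter fun n =>
        leftConf σ (ring d 0 n) 0 = true ∧ leftConf σ (ring d 0 n) (0 + 1) = false :
          Finset ℕ) := by
    ext n; simp
  rw [this, Set.ncard_coe_finset, Finset.card_filter]
  push_cast
  refine Finset.sum_congr rfl fun n _ => ?_
  rw [h.leftConfig_eq (h.path.pos 0 n), rate]
  cases leftConf σ (ring d 0 n) 0 <;> cases leftConf σ (ring d 0 n) 1 <;> simp [occ]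

end Typical

/-! ### Local functions and Dynkin's formula -/

theorem measurable_of_dependsOn {g : (ℤ → Bool) → ℝ} {W : Finset ℤ}
    (hg : DependsOn g (W : Set ℤ)) : Measurable g := by
  let e : (W → Bool) → ℤ → Bool := fun q y => if h : y ∈ W then q ⟨y, h⟩ else false
  have h1 : g = (g ∘ e) ∘ fun c (y : W) => c y := by
    funext c
    refine hg fun y hy => ?_
    simp only [e]
    rw [dif_pos (by exact hy)]
  rw [h1]
  exact (measurable_of_countable (g ∘ e)).comp (by fun_prop)

theorem dependsOn_jump {g : (ℤ → Bool) → ℝ} {W : Set ℤ} (hg : DependsOn g W) (x : ℤ) :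
    DependsOn (IsPath.jump g x) (W ∪ {x, x + 1}) := by
  intro c c' h
  have hx := h x (by simp)
  have hx1 := h (x + 1) (by simp)
  have h1 : g c = g c' := hg fun y hy => h y (Or.inl hy)
  have h2 : g (c ∘ Equiv.swap x (x + 1)) = g (c' ∘ Equiv.swap x (x + 1)) := by
    refine hg fun y hy => ?_
    simp only [Function.comp_apply]
    by_cases e1 : y = x
    · rw [e1, Equiv.swap_apply_left]; exact hx1
    by_cases e2 : y = x + 1
    · rw [e2, Equiv.swap_apply_right]; exact hx
    rw [Equiv.swap_apply_of_ne_of_ne e1 e2]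
    exact h y (Or.inl hy)
  simp only [IsPath.jump, hx, hx1, h1, h2]

theorem abs_jump_le {g : (ℤ → Bool) → ℝ} {C : ℝ} (hC : ∀ c, |g c| ≤ C) (x : ℤ) (c : ℤ → Bool) :
    |IsPath.jump g x c| ≤ 2 * C := by
  have h0 : 0 ≤ C := (abs_nonneg _).trans (hC c)
  rw [IsPath.jump]
  split_ifs
  · refine (abs_sub _ _).trans ?_
    linarith [hC c, hC (c ∘ Equiv.swap x (x + 1))]
  · simpa using h0

section Dynkin

variable {Ω : Type*} [MeasurableSpace Ω] {P : Measure Ω} [IsProbabilityMeasure P]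
    {ρ : ℝ} {ξ : ℤ → ℕ → Ω → ℝ} {η : ℝ → Ω → ℤ → Bool}

theorem IsTASEP.integral_data (h : IsTASEP P ρ ξ η) (h0 : 0 < ρ) (h1 : ρ < 1) {f : Data → ℝ}
    (hf : Measurable f) : ∫ ω, f (dataOf ξ η ω) ∂P = ∫ d, f d ∂(law ρ) := by
  rw [← h.map_data h0 h1, integral_map h.measurable_data.aemeasurable hf.aestronglyMeasurable]

/-- A fixed time is almost surely not a ring time, so left limits may be replaced by values inside
expectations. -/
theorem IsTASEP.ae_leftConfig (h : IsTASEP P ρ ξ η) (h0 : 0 < ρ) (h1 : ρ < 1) {s : ℝ}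
    (hs : 0 < s) : ∀ᵐ ω ∂P, leftConfig s (dataOf ξ η ω) = η s ω := by
  have := isProbabilityMeasure_bern h0 h1
  have hq := ae_ring_ne (ρ := ρ) s
  rw [← h.map_data h0 h1] at hq
  filter_upwards [h.ae_typical h0 h1, ae_of_ae_map h.measurable_data.aemeasurable hq] with ω w1 w2
  rw [w1.leftConfig_eq hs]
  funext y
  exact w1.path.leftConf_eq hs (w2 y) (w2 (y - 1))

/-- Expectations of bounded observables are integrable in time. -/
theorem IsTASEP.integrableOn_expect (h : IsTASEP P ρ ξ η) (h0 : 0 < ρ) (h1 : ρ < 1)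
    {F : Data → (ℤ → Bool) → ℝ} (hF : Measurable (Function.uncurry F)) {C : ℝ}
    (hC : ∀ d c, |F d c| ≤ C) (t : ℝ) :
    IntegrableOn (fun s => ∫ ω, F (dataOf ξ η ω) (η s ω) ∂P) (Set.Ioc 0 t) := by
  have := isProbabilityMeasure_bern h0 h1
  have hm : StronglyMeasurable fun s => ∫ d, F d (leftConfig s d) ∂(law ρ) :=
    StronglyMeasurable.integral_prod_right' (f := fun p : ℝ × Data => F p.2 (leftConfig p.1 p.2))
      (hF.comp (measurable_snd.prodMk measurable_leftConfig)).stronglyMeasurable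
  refine Integrable.of_bound (C := C) ?_ (Eventually.of_forall fun s => ?_)
  · refine hm.aestronglyMeasurable.congr ?_
    filter_upwards [ae_restrict_mem measurableSet_Ioc] with s hs
    rw [← h.integral_data h0 h1 (f := fun d => F d (leftConfig s d))
      (hF.comp (measurable_id.prodMk (measurable_leftConfig.comp measurable_prodMk_left)))]
    refine integral_congr_ae ?_
    filter_upwards [h.ae_leftConfig h0 h1 hs.1] with ω hω
    simp only [hω]
  · refine (norm_integral_le_of_norm_le_const (Eventually.of_forall fun ω =>
      (Real.norm_eq_abs _).trans_le (hC (dataOf ξ η ω) (η s ω)))).trans ?_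
    simp

/-- The compensator formula along the process. -/
theorem IsTASEP.ringSum_left (h : IsTASEP P ρ ξ η) (h0 : 0 < ρ) (h1 : ρ < 1) (x : ℤ)
    {F : Data → (ℤ → Bool) → ℝ} (hF : Measurable (Function.uncurry F))
    (hFp : ∀ d u n c, F (resample (x, n) u d) c = F d c) {C : ℝ} (hC : ∀ d c, |F d c| ≤ C)
    (t : ℝ) :
    Integrable (fun ω => ringSum x (fun s d => F d (leftConfig s d)) t (dataOf ξ η ω)) P ∧
      ∫ ω, ringSum x (fun s d => F d (leftConfig s d)) t (dataOf ξ η ω) ∂P =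
        ∫ s in Set.Ioc 0 t, (∫ ω, F (dataOf ξ η ω) (η s ω) ∂P) := by
  have := isProbabilityMeasure_bern h0 h1
  have hm : Measurable (Function.uncurry fun s d => F d (leftConfig s d)) :=
    hF.comp (measurable_snd.prodMk measurable_leftConfig)
  have key := integrable_integral_ringSum (ρ := ρ) (x := x)
    (H := fun s d => F d (leftConfig s d)) hm
    (fun d n u u' s a1 a2 a3 a4 a5 => by
      simp only [hFp, predictable_leftConfig x d n u u' s a1 a2 a3 a4 a5])
    (fun s d => hC _ _) t
  have hi := key.1
  rw [← h.map_data h0 h1] at hi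
  refine ⟨hi.comp_measurable h.measurable_data, ?_⟩
  have e1 := key.2
  rw [← h.map_data h0 h1, integral_map h.measurable_data.aemeasurable hi.aestronglyMeasurable] at e1
  rw [e1]
  refine setIntegral_congr_fun measurableSet_Ioc fun s hs => ?_
  have hms : Measurable fun d => F d (leftConfig s d) := hm.comp measurable_prodMk_left
  rw [integral_map h.measurable_data.aemeasurable hms.aestronglyMeasurable]
  refine integral_congr_ae ?_
  filter_upwards [h.ae_leftConfig h0 h1 hs.1] with ω hω
  simp only [hω]

/-- The generator acting on functions supported in `[a, a + ℓ]`. -/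
noncomputable def gen (a : ℤ) (ℓ : ℕ) (g : (ℤ → Bool) → ℝ) (c : ℤ → Bool) : ℝ :=
  ∑ x ∈ Finset.Icc (a - 1) (a + ℓ), IsPath.jump g x c

/-- Jumps across the two boundary bonds read one further site at each end; the support thus grows by
two sites per application, which the iteration of Dynkin's formula has to pay for. -/
theorem dependsOn_gen {a : ℤ} {ℓ : ℕ} {g : (ℤ → Bool) → ℝ}
    (hg : DependsOn g (Finset.Icc a (a + ℓ) : Set ℤ)) :
    DependsOn (gen a ℓ g) (Finset.Icc (a - 1) (a - 1 + (ℓ + 2 : ℕ)) : Set ℤ) := by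
  intro c c' h
  refine Finset.sum_congr rfl fun x hx => dependsOn_jump hg x fun y hy => h y ?_
  rw [Finset.mem_Icc] at hx
  simp only [Finset.coe_Icc, Set.mem_union, Set.mem_Icc, Set.mem_insert_iff,
    Set.mem_singleton_iff] at hy ⊢
  push_cast
  omega

theorem abs_gen_le {a : ℤ} {ℓ : ℕ} {g : (ℤ → Bool) → ℝ} {C : ℝ} (hC : ∀ c, |g c| ≤ C)
    (c : ℤ → Bool) : |gen a ℓ g c| ≤ (ℓ + 2) * (2 * C) := by
  refine (Finset.abs_sum_le_sum_abs _ _).trans ?_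
  refine (Finset.sum_le_sum fun x _ => abs_jump_le hC x c).trans_eq ?_
  rw [Finset.sum_const, Int.card_Icc, nsmul_eq_mul]
  have : (a + ℓ + 1 - (a - 1)).toNat = ℓ + 2 := by omega
  rw [this]; push_cast; ring

/-- Dynkin's formula. -/
theorem IsTASEP.dynkin (h : IsTASEP P ρ ξ η) (h0 : 0 < ρ) (h1 : ρ < 1) {a : ℤ} {ℓ : ℕ}
    {g : (ℤ → Bool) → ℝ} (hg : DependsOn g (Finset.Icc a (a + ℓ) : Set ℤ)) {C : ℝ}
    (hC : ∀ c, |g c| ≤ C) {t : ℝ} (ht : 0 ≤ t) :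
    ∫ ω, g (η t ω) ∂P - ∫ ω, g (η 0 ω) ∂P =
      ∫ s in Set.Ioc 0 t, (∫ ω, gen a ℓ g (η s ω) ∂P) := by
  have hgm := measurable_of_dependsOn hg
  have hint : ∀ s, 0 ≤ s → Integrable (fun ω => g (η s ω)) P := fun s hs =>
    Integrable.of_bound (hgm.comp (h.measurable_config s hs)).aestronglyMeasurable C
      (Eventually.of_forall fun ω => hC _)
  have hjm : ∀ x, Measurable (IsPath.jump g x) := fun x => by
    have : (Finset.Icc a (a + ℓ) : Set ℤ) ∪ {x, x + 1} =
        ((Finset.Icc a (a + ℓ) ∪ {x, x + 1} : Finset ℤ) : Set ℤ) := by push_cast; rfl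
    exact measurable_of_dependsOn (this ▸ dependsOn_jump hg x)
  rw [← integral_sub (hint t ht) (hint 0 le_rfl)]
  have hR := fun x => h.ringSum_left h0 h1 x (F := fun _ c => IsPath.jump g x c)
    ((hjm x).comp measurable_snd) (fun _ _ _ _ => rfl) (fun _ c => abs_jump_le hC x c) t
  have e1 : ∫ ω, (g (η t ω) - g (η 0 ω)) ∂P = ∫ ω, ∑ x ∈ Finset.Icc (a - 1) (a + ℓ),
      ringSum x (fun s d => IsPath.jump g x (leftConfig s d)) t (dataOf ξ η ω) ∂P := by
    refine integral_congr_ae ?_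
    filter_upwards [h.ae_typical h0 h1] with ω hω
    rw [← hω.sum_jump_eq]
    refine hω.path.sub_eq_sum_jump hg (fun x hx => ?_) (fun x _ y _ => hω.inj x y) ht
    rw [Finset.mem_Icc] at hx
    constructor <;> rw [Finset.mem_Icc] <;> omega
  rw [e1, integral_finsetSum _ fun x _ => (hR x).1]
  have hji : ∀ x, IntegrableOn (fun s => ∫ ω, IsPath.jump g x (η s ω) ∂P) (Set.Ioc 0 t) :=
    fun x => h.integrableOn_expect h0 h1 (F := fun _ c => IsPath.jump g x c)
      ((hjm x).comp measurable_snd) (fun _ c => abs_jump_le hC x c) t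
  simp_rw [fun x => (hR x).2]
  rw [← integral_finsetSum _ fun x _ => hji x]
  refine setIntegral_congr_fun measurableSet_Ioc fun s hs => ?_
  simp only [gen]
  rw [integral_finsetSum]
  intro x _
  exact Integrable.of_bound ((hjm x).comp (h.measurable_config s hs.1.le)).aestronglyMeasurable
    (2 * C) (Eventually.of_forall fun ω => abs_jump_le hC x _)

end Dynkin

/-! ### Stationarity -/

section Stationary

variable {Ω : Type*} [MeasurableSpace Ω] {P : Measure Ω} [IsProbabilityMeasure P]
    {ρ : ℝ} {ξ : ℤ → ℕ → Ω → ℝ} {η : ℝ → Ω → ℤ → Bool}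

theorem IsTASEP.integral_perm (h : IsTASEP P ρ ξ η) (h0 : 0 < ρ) (h1 : ρ < 1)
    {f : (ℤ → Bool) → ℝ} (hf : Measurable f) (e : Equiv.Perm ℤ) :
    ∫ ω, f (η 0 ω ∘ e) ∂P = ∫ ω, f (η 0 ω) ∂P := by
  have := isProbabilityMeasure_bern h0 h1
  have e1 := h.integral_data h0 h1 (f := fun d => f d.2) (hf.comp measurable_snd)
  have hce : Measurable fun c : ℤ → Bool => c ∘ e := by unfold Function.comp; fun_prop
  have e2 := h.integral_data h0 h1 (f := fun d => f (d.2 ∘ e))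
    (hf.comp (hce.comp measurable_snd))
  have hp := measurePreserving_perm ρ e
  have e3 : ∫ d, f (d.2 ∘ e) ∂(law ρ) = ∫ d, f d.2 ∂(law ρ) := by
    conv_rhs => rw [← hp.map_eq]
    rw [integral_map (f := fun d : Data => f d.2) hp.measurable.aemeasurable
      (hf.comp measurable_snd).aestronglyMeasurable]
  simp only [dataOf] at e1 e2
  rw [e1, e2, e3]

theorem measurable_occ : Measurable occ := measurable_of_countable _

theorem abs_occ_le (b : Bool) : |occ b| ≤ 1 := by cases b <;> simp [occ]

/-- Exchangeability of the initial law undoes the swap in the gain term, and `(1 - η_x) η_{x+1} -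
η_x (1 - η_{x+1}) = η_{x+1} - η_x`. -/
theorem IsTASEP.integral_jump (h : IsTASEP P ρ ξ η) (h0 : 0 < ρ) (h1 : ρ < 1)
    {g : (ℤ → Bool) → ℝ} (hg : Measurable g) {C : ℝ} (hC : ∀ c, |g c| ≤ C) (x : ℤ) :
    ∫ ω, IsPath.jump g x (η 0 ω) ∂P =
      ∫ ω, g (η 0 ω) * (occ (η 0 ω (x + 1)) - occ (η 0 ω x)) ∂P := by
  have hev : ∀ y : ℤ, Measurable fun c : ℤ → Bool => occ (c y) := fun y =>
    measurable_occ.comp (measurable_pi_apply y)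
  have hm0 : Measurable (η 0) := h.measurable_config 0 le_rfl
  set ψ : (ℤ → Bool) → ℝ := fun c => (1 - occ (c x)) * occ (c (x + 1)) * g c with hψ
  have hψm : Measurable ψ := ((measurable_const.sub (hev x)).mul (hev (x + 1))).mul hg
  set φ : (ℤ → Bool) → ℝ := fun c => occ (c x) * (1 - occ (c (x + 1))) * g c with hφ
  have hφm : Measurable φ := ((hev x).mul (measurable_const.sub (hev (x + 1)))).mul hg
  have hC0 : 0 ≤ C := (abs_nonneg _).trans (hC fun _ => true)
  have hψb : ∀ c, ‖ψ c‖ ≤ C := by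
    intro c
    simp only [hψ, Real.norm_eq_abs]
    cases c x <;> cases c (x + 1) <;> simp [occ, hC0, hC]
  have hφb : ∀ c, ‖φ c‖ ≤ C := by
    intro c
    simp only [hφ, Real.norm_eq_abs]
    cases c x <;> cases c (x + 1) <;> simp [occ, hC0, hC]
  have hψi : Integrable (fun ω => ψ (η 0 ω)) P :=
    Integrable.of_bound (hψm.comp hm0).aestronglyMeasurable C (Eventually.of_forall fun ω => hψb _)
  have hφi : Integrable (fun ω => φ (η 0 ω)) P :=
    Integrable.of_bound (hφm.comp hm0).aestronglyMeasurable C (Eventually.of_forall fun ω => hφb _)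
  have hce : Measurable fun c : ℤ → Bool => c ∘ Equiv.swap x (x + 1) := by
    unfold Function.comp; fun_prop
  have hψi' : Integrable (fun ω => ψ (η 0 ω ∘ Equiv.swap x (x + 1))) P :=
    Integrable.of_bound ((hψm.comp hce).comp hm0).aestronglyMeasurable C
      (Eventually.of_forall fun ω => hψb _)
  have e1 : ∀ c, IsPath.jump g x c = ψ (c ∘ Equiv.swap x (x + 1)) - φ c := by
    intro c
    simp only [IsPath.jump, hψ, hφ, Function.comp_apply, Equiv.swap_apply_left,
      Equiv.swap_apply_right]
    cases h1 : c x <;> cases h2 : c (x + 1) <;> simp [occ]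
  have e2 : ∀ c, g c * (occ (c (x + 1)) - occ (c x)) = ψ c - φ c := by
    intro c
    simp only [hψ, hφ]; ring
  simp_rw [e1, e2]
  rw [integral_sub hψi' hφi, integral_sub hψi hφi, h.integral_perm h0 h1 hψm]

/-- By `integral_jump` the sum over bonds telescopes to the difference of `E[g η_y]` at `y = a + ℓ +
1` and `y = a - 1`. Both sites lie outside the support of `g`, so exchanging them shows that the two
expectations agree. -/
theorem IsTASEP.integral_gen (h : IsTASEP P ρ ξ η) (h0 : 0 < ρ) (h1 : ρ < 1)
    {a : ℤ} {ℓ : ℕ} {g : (ℤ → Bool) → ℝ} (hg : DependsOn g (Finset.Icc a (a + ℓ) : Set ℤ)) {C : ℝ}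
    (hC : ∀ c, |g c| ≤ C) : ∫ ω, gen a ℓ g (η 0 ω) ∂P = 0 := by
  have hgm := measurable_of_dependsOn hg
  have hm0 : Measurable (η 0) := h.measurable_config 0 le_rfl
  have hjm : ∀ x, Measurable (IsPath.jump g x) := fun x => by
    have : (Finset.Icc a (a + ℓ) : Set ℤ) ∪ {x, x + 1} =
        ((Finset.Icc a (a + ℓ) ∪ {x, x + 1} : Finset ℤ) : Set ℤ) := by push_cast; rfl
    exact measurable_of_dependsOn (this ▸ dependsOn_jump hg x)
  have hev : ∀ y : ℤ, Measurable fun c : ℤ → Bool => occ (c y) := fun y =>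
    measurable_occ.comp (measurable_pi_apply y)
  have hC0 : 0 ≤ C := (abs_nonneg _).trans (hC fun _ => true)
  have hi : ∀ y, Integrable (fun ω => g (η 0 ω) * occ (η 0 ω y)) P := fun y =>
    Integrable.of_bound ((hgm.mul (hev y)).comp hm0).aestronglyMeasurable C
      (Eventually.of_forall fun ω => by
        rw [norm_mul, Real.norm_eq_abs, Real.norm_eq_abs]
        exact (mul_le_mul (hC _) (abs_occ_le _) (abs_nonneg _) hC0).trans_eq (mul_one C))
  simp only [gen]
  have hji : ∀ x, Integrable (fun ω => IsPath.jump g x (η 0 ω)) P := fun x =>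
    Integrable.of_bound ((hjm x).comp hm0).aestronglyMeasurable (2 * C)
      (Eventually.of_forall fun ω => abs_jump_le hC x _)
  rw [integral_finsetSum _ fun x _ => hji x]
  simp_rw [h.integral_jump h0 h1 hgm hC, mul_sub]
  have e1 : ∀ x, ∫ ω, (g (η 0 ω) * occ (η 0 ω (x + 1)) - g (η 0 ω) * occ (η 0 ω x)) ∂P =
      ∫ ω, g (η 0 ω) * occ (η 0 ω (x + 1)) ∂P - ∫ ω, g (η 0 ω) * occ (η 0 ω x) ∂P := fun x =>
    integral_sub (hi _) (hi _)
  simp_rw [e1]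
  have tele : ∀ (F : ℤ → ℝ) (n : ℕ), ∑ x ∈ Finset.Icc (a - 1) (a - 1 + n), (F (x + 1) - F x) =
      F (a - 1 + n + 1) - F (a - 1) := by
    intro F n
    induction n with
    | zero => simp
    | succ n ih =>
      have : Finset.Icc (a - 1) (a - 1 + (n + 1 : ℕ)) =
          insert (a - 1 + (n + 1 : ℕ)) (Finset.Icc (a - 1) (a - 1 + n)) := by
        ext z; simp only [Finset.mem_insert, Finset.mem_Icc]; push_cast; omega
      rw [this, Finset.sum_insert (by simp), ih]
      push_cast
      have : a - 1 + ((n : ℤ) + 1) = a - 1 + n + 1 := by ring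
      rw [this]; ring
  have hfin : a + (ℓ : ℤ) = a - 1 + (ℓ + 1 : ℕ) := by push_cast; ring
  rw [hfin, tele fun x => ∫ ω, g (η 0 ω) * occ (η 0 ω x) ∂P, sub_eq_zero]
  have hperm := h.integral_perm h0 h1 (hgm.mul (hev (a - 1)))
    (Equiv.swap (a - 1) (a - 1 + (ℓ + 1 : ℕ) + 1))
  simp only [Pi.mul_apply, Function.comp_apply, Equiv.swap_apply_left] at hperm
  rw [← hperm]
  refine integral_congr_ae (Eventually.of_forall fun ω => ?_)
  simp only
  congr 1
  refine hg fun y hy => ?_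
  simp only [Finset.coe_Icc, Set.mem_Icc] at hy
  rw [Function.comp_apply, Equiv.swap_apply_of_ne_of_ne]
  · omega
  · push_cast; omega

/-- Dynkin's formula iterated `n` times from a time `t₀` at which stationarity is known. Each
generator costs a factor `2(ℓ + 2) ≤ 4m` and raises `m` by one; the factorial from the repeated time
integrals turns the product `m (m+1) ⋯ (m+n-1)` into something below a binomial coefficient. The
generator has initial mean zero, so its expectation can be fed back into the induction. -/
theorem IsTASEP.abs_integral_sub_le (h : IsTASEP P ρ ξ η) (h0 : 0 < ρ) (h1 : ρ < 1) {t₀ : ℝ}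
    (ht₀ : 0 ≤ t₀) (hstat : ∀ (a : ℤ) (ℓ : ℕ) (g : (ℤ → Bool) → ℝ) (C : ℝ),
      DependsOn g (Finset.Icc a (a + ℓ) : Set ℤ) → (∀ c, |g c| ≤ C) →
      ∫ ω, g (η t₀ ω) ∂P = ∫ ω, g (η 0 ω) ∂P) (n m : ℕ) (a : ℤ) (ℓ : ℕ) (hm : ℓ + 2 ≤ 2 * m)
    (g : (ℤ → Bool) → ℝ) (C : ℝ) (hg : DependsOn g (Finset.Icc a (a + ℓ) : Set ℤ))
    (hC : ∀ c, |g c| ≤ C) {t : ℝ} (ht : t₀ ≤ t) :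
    |∫ ω, g (η t ω) ∂P - ∫ ω, g (η 0 ω) ∂P| ≤
      2 * C * (4 * (t - t₀)) ^ n * ((n + m).choose n : ℝ) := by
  have hC0 : 0 ≤ C := (abs_nonneg _).trans (hC fun _ => true)
  induction n generalizing m a ℓ g C t with
  | zero =>
    have hb : ∀ s, |∫ ω, g (η s ω) ∂P| ≤ C := fun s => by
      refine (norm_integral_le_of_norm_le_const (Eventually.of_forall fun ω =>
        (Real.norm_eq_abs _).trans_le (hC (η s ω)))).trans ?_
      simp
    simp only [pow_zero, mul_one, zero_add, Nat.choose_zero_right, Nat.cast_one]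
    exact (abs_sub _ _).trans (by linarith [hb t, hb 0])
  | succ n ih =>
    have hgen := dependsOn_gen hg
    have hgenb : ∀ c, |gen a ℓ g c| ≤ 4 * m * C := fun c => by
      refine (abs_gen_le hC c).trans ?_
      have : (ℓ + 2 : ℝ) ≤ 2 * m := by exact_mod_cast hm
      nlinarith
    have hint := h.integrableOn_expect h0 h1 (F := fun _ c => gen a ℓ g c)
      ((measurable_of_dependsOn hgen).comp measurable_snd) (fun _ c => hgenb c) t
    have d1 := h.dynkin h0 h1 hg hC (ht₀.trans ht)
    have d2 := h.dynkin h0 h1 hg hC ht₀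
    rw [hstat a ℓ g C hg hC, sub_self] at d2
    rw [← Set.Ioc_union_Ioc_eq_Ioc ht₀ ht, setIntegral_union (Set.Ioc_disjoint_Ioc_of_le le_rfl)
      measurableSet_Ioc (hint.mono_set (Set.Ioc_subset_Ioc_right ht))
      (hint.mono_set (Set.Ioc_subset_Ioc_left ht₀)), ← d2, zero_add] at d1
    rw [d1]
    have hb : ∀ s ∈ Set.Ioc t₀ t, ‖∫ ω, gen a ℓ g (η s ω) ∂P‖ ≤
        2 * (4 * m * C) * 4 ^ n * ((n + (m + 1)).choose n : ℝ) * (s - t₀) ^ n := by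
      intro s hs
      have := ih (m + 1) (a - 1) (ℓ + 2) (by omega) (gen a ℓ g) (4 * m * C) hgen hgenb hs.1.le
        (by positivity)
      rw [h.integral_gen h0 h1 hg hC, sub_zero, mul_pow] at this
      rw [Real.norm_eq_abs]
      exact this.trans_eq (by ring)
    have hpoly : IntegrableOn (fun s => 2 * (4 * m * C) * 4 ^ n *
        ((n + (m + 1)).choose n : ℝ) * (s - t₀) ^ n) (Set.Ioc t₀ t) := by
      apply Continuous.integrableOn_Ioc; fun_prop
    rw [← Real.norm_eq_abs]
    refine (norm_integral_le_of_norm_le hpoly ?_).trans ?_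
    · exact (ae_restrict_mem measurableSet_Ioc).mono hb
    · rw [← intervalIntegral.integral_of_le ht, intervalIntegral.integral_const_mul,
        intervalIntegral.integral_comp_sub_right (fun s => s ^ n), sub_self, integral_pow]
      have hch : ((n + 1 + m).choose (n + 1) : ℝ) * (n + 1) =
          ((n + (m + 1)).choose n : ℝ) * (m + 1) := by
        have := Nat.choose_succ_right_eq (n + 1 + m) n
        have e : n + 1 + m - n = m + 1 := by omega
        rw [e] at this
        have e' : n + (m + 1) = n + 1 + m := by omega
        rw [e']
        exact_mod_cast this
      have hc0 : (0 : ℝ) ≤ ((n + (m + 1)).choose n : ℝ) := by positivity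
      have hle : (m : ℝ) * ((n + (m + 1)).choose n : ℝ) / (n + 1) ≤
          ((n + 1 + m).choose (n + 1) : ℝ) := by
        rw [div_le_iff₀ (by positivity), hch]
        nlinarith
      have ht0 : 0 ≤ t - t₀ := by linarith
      calc _ = 2 * C * (4 * (t - t₀)) ^ (n + 1) *
            ((m : ℝ) * ((n + (m + 1)).choose n : ℝ) / (n + 1)) := by
            rw [mul_pow]; field_simp; ring
        _ ≤ _ := by gcongr

/-- The Bernoulli measure is stationary. -/
theorem IsTASEP.stationary (h : IsTASEP P ρ ξ η) (h0 : 0 < ρ) (h1 : ρ < 1) {t : ℝ} (ht : 0 ≤ t)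
    {a : ℤ} {ℓ : ℕ} {g : (ℤ → Bool) → ℝ} {C : ℝ}
    (hg : DependsOn g (Finset.Icc a (a + ℓ) : Set ℤ)) (hC : ∀ c, |g c| ≤ C) :
    ∫ ω, g (η t ω) ∂P = ∫ ω, g (η 0 ω) ∂P := by
  -- On a step of length `1/16` the factor `4(t - t₀)` is at most `1/4`, which beats the bound
  -- `2^{n+ℓ+2}` for the binomial coefficient. The step length does not depend on `g`, so
  -- stationarity propagates to all times.
  have key : ∀ k : ℕ, ∀ t : ℝ, 0 ≤ t → t ≤ k / 16 → ∀ (a : ℤ) (ℓ : ℕ) (g : (ℤ → Bool) → ℝ) (C : ℝ),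
      DependsOn g (Finset.Icc a (a + ℓ) : Set ℤ) → (∀ c, |g c| ≤ C) →
      ∫ ω, g (η t ω) ∂P = ∫ ω, g (η 0 ω) ∂P := by
    intro k
    induction k with
    | zero =>
      intro t ht ht' a ℓ g C _ _
      have : t = 0 := le_antisymm (by simpa using ht') ht
      rw [this]
    | succ k ih =>
      intro t ht ht' a ℓ g C hg hC
      by_cases hk : t ≤ k / 16
      · exact ih t ht hk a ℓ g C hg hC
      have hk0 : (0 : ℝ) ≤ k / 16 := by positivity
      have hb := fun n => h.abs_integral_sub_le h0 h1 hk0 (ih (k / 16) hk0 le_rfl) n (ℓ + 2) a ℓ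
        (by omega) g C hg hC (not_le.1 hk).le
      have hC0 : 0 ≤ C := (abs_nonneg _).trans (hC fun _ => true)
      have hlim : Tendsto (fun n : ℕ => 2 * C * 2 ^ (ℓ + 2) * (1 / 2 : ℝ) ^ n) atTop (𝓝 0) := by
        simpa using (tendsto_pow_atTop_nhds_zero_of_lt_one (by norm_num : (0 : ℝ) ≤ 1 / 2)
          (by norm_num)).const_mul (2 * C * 2 ^ (ℓ + 2))
      have h0' : |∫ ω, g (η t ω) ∂P - ∫ ω, g (η 0 ω) ∂P| ≤ 0 := by
        refine ge_of_tendsto' hlim fun n => (hb n).trans ?_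
        have hch : ((n + (ℓ + 2)).choose n : ℝ) ≤ 2 ^ (n + (ℓ + 2)) := by
          exact_mod_cast Nat.choose_le_two_pow _ _
        have hτ : 4 * (t - k / 16) ≤ 1 / 4 := by
          push_cast at ht'; linarith
        have hτ0 : 0 ≤ 4 * (t - k / 16) := by linarith
        calc 2 * C * (4 * (t - k / 16)) ^ n * ((n + (ℓ + 2)).choose n : ℝ)
            ≤ 2 * C * (1 / 4) ^ n * 2 ^ (n + (ℓ + 2)) := by gcongr
          _ = 2 * C * 2 ^ (ℓ + 2) * ((1 / 4) ^ n * 2 ^ n) := by rw [pow_add]; ring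
          _ = _ := by rw [← mul_pow]; norm_num
      exact sub_eq_zero.1 (abs_eq_zero.1 (le_antisymm h0' (abs_nonneg _)))
  obtain ⟨k, hk⟩ := exists_nat_ge (16 * t)
  exact key k t ht (by linarith) a ℓ g C hg hC

end Stationary

/-! ### Covariances of approximately independent variables -/

section Approx

variable {α : Type*} [MeasurableSpace α] {μ : Measure α} [IsProbabilityMeasure μ]

/-- A weighted form of Cauchy–Schwarz: `2|Z| ≤ l⁻¹ + l Z²` on `B`. A set of measure of order `l²`
contributes only order `l`, at the price of a square root of its probability. -/
theorem setIntegral_abs_le {Z : α → ℝ} (hZ : AEStronglyMeasurable Z μ)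
    (hZ2 : Integrable (fun a => Z a ^ 2) μ) {K c l : ℝ} (hK : ∫ a, Z a ^ 2 ∂μ ≤ K) (hl : 0 < l)
    {B : Set α} (hB : MeasurableSet B) (hBl : μ.real B ≤ c * l ^ 2) :
    ∫ a, B.indicator (fun a => |Z a|) a ∂μ ≤ l * (c + K) := by
  have hZi : Integrable Z μ := ((memLp_two_iff_integrable_sq hZ).2 hZ2).integrable (by norm_num)
  have h1 : Integrable (B.indicator fun _ => l⁻¹ : α → ℝ) μ := (integrable_const _).indicator hB
  calc ∫ a, B.indicator (fun a => |Z a|) a ∂μ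
      ≤ ∫ a, (B.indicator (fun _ => l⁻¹) a + l * Z a ^ 2) ∂μ := by
        refine integral_mono (hZi.abs.indicator hB) (h1.add (hZ2.const_mul l)) fun a => ?_
        by_cases ha : a ∈ B
        · simp only [Set.indicator_of_mem ha]
          rw [← sq_abs (Z a)]
          have : 0 ≤ l⁻¹ * (l * |Z a| - 1) ^ 2 := by positivity
          have e : l⁻¹ * (l * |Z a| - 1) ^ 2 = l⁻¹ + l * |Z a| ^ 2 - 2 * |Z a| := by
            field_simp; ring
          linarith [abs_nonneg (Z a)]
        · simp only [Set.indicator_of_notMem ha, zero_add]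
          positivity
    _ = l⁻¹ * μ.real B + l * ∫ a, Z a ^ 2 ∂μ := by
        rw [integral_add h1 (hZ2.const_mul l), integral_indicator_const _ hB, integral_const_mul,
          smul_eq_mul, mul_comm]
    _ ≤ l⁻¹ * (c * l ^ 2) + l * K := by gcongr
    _ = _ := by field_simp

/-- Fourth moments at most `K`. -/
structure FourthMoment (X : α → ℝ) (μ : Measure α) (K : ℝ) : Prop where
  meas : AEStronglyMeasurable X μ
  int : Integrable (fun a => X a ^ 4) μ
  le : ∫ a, X a ^ 4 ∂μ ≤ K

namespace FourthMoment

variable {X Y : α → ℝ} {K : ℝ}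

theorem nonneg (h : FourthMoment X μ K) : 0 ≤ K :=
  (integral_nonneg fun a => by positivity).trans h.le

theorem integrable_sq (h : FourthMoment X μ K) : Integrable (fun a => X a ^ 2) μ := by
  refine ((integrable_const (1 : ℝ)).add h.int).mono' (h.meas.pow 2)
    (Eventually.of_forall fun a => ?_)
  simp only [Pi.add_apply, Real.norm_eq_abs, abs_pow, sq_abs]
  nlinarith [sq_nonneg (X a ^ 2 - 1)]

theorem memLp (h : FourthMoment X μ K) : MemLp X 2 μ :=
  (memLp_two_iff_integrable_sq h.meas).2 h.integrable_sq

theorem integral_sq_le (h : FourthMoment X μ K) : ∫ a, X a ^ 2 ∂μ ≤ K + 1 := by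
  have : ∫ a, X a ^ 2 ∂μ ≤ ∫ a, (1 + X a ^ 4) ∂μ :=
    integral_mono h.integrable_sq ((integrable_const _).add h.int) fun a => by
      nlinarith [sq_nonneg (X a ^ 2 - 1)]
  rw [integral_add (integrable_const _) h.int] at this
  simp only [integral_const, probReal_univ, smul_eq_mul, mul_one] at this
  linarith [h.le]

theorem integral_abs_le (h : FourthMoment X μ K) : ∫ a, |X a| ∂μ ≤ K + 1 := by
  have : ∫ a, |X a| ∂μ ≤ ∫ a, (1 + X a ^ 4) ∂μ :=
    integral_mono (h.memLp.integrable (by norm_num)).abs ((integrable_const _).add h.int) fun a => by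
      have e : X a ^ 4 = |X a| ^ 4 := by rw [← abs_pow, abs_of_nonneg (by positivity)]
      simp only [e]
      nlinarith [sq_nonneg (|X a| ^ 2 - 1), sq_nonneg (|X a| - 1)]
  rw [integral_add (integrable_const _) h.int] at this
  simp only [integral_const, probReal_univ, smul_eq_mul, mul_one] at this
  linarith [h.le]

theorem integrable_mul_sq (h : FourthMoment X μ K) (h' : FourthMoment Y μ K) :
    Integrable (fun a => (X a * Y a) ^ 2) μ := by
  refine (h.int.add h'.int).mono' ((h.meas.mul h'.meas).pow 2) (Eventually.of_forall fun a => ?_)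
  simp only [Pi.add_apply, Real.norm_eq_abs, abs_pow, sq_abs]
  nlinarith [sq_nonneg (X a ^ 2 - Y a ^ 2), sq_nonneg (X a * Y a)]

theorem integral_mul_sq_le (h : FourthMoment X μ K) (h' : FourthMoment Y μ K) :
    ∫ a, (X a * Y a) ^ 2 ∂μ ≤ K := by
  have : ∫ a, (X a * Y a) ^ 2 ∂μ ≤ ∫ a, (1 / 2) * (X a ^ 4 + Y a ^ 4) ∂μ :=
    integral_mono (h.integrable_mul_sq h') ((h.int.add h'.int).const_mul _) fun a => by
      nlinarith [sq_nonneg (X a ^ 2 - Y a ^ 2)]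
  rw [integral_const_mul, integral_add h.int h'.int] at this
  linarith [h.le, h'.le]

/-- `X'` and `Y'` are uncorrelated truncations, so the covariance is made of the errors in `E[XY]`,
`E[X]` and `E[Y]`, each an integral over `B` handled by `setIntegral_abs_le`. Fourth moments enter
through the second moment of `XY`; on `B` one truncation vanishes, so the error in the product there
is `XY` itself. -/
theorem abs_covariance_le (h : FourthMoment X μ K) (h' : FourthMoment Y μ K) {X' Y' : α → ℝ}
    (hX' : AEStronglyMeasurable X' μ) (hY' : AEStronglyMeasurable Y' μ) {B : Set α}
    (hB : MeasurableSet B) {c l : ℝ} (hl : 0 < l) (hBl : μ.real B ≤ c * l ^ 2)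
    (h1 : ∀ᵐ a ∂μ, a ∉ B → X' a = X a ∧ Y' a = Y a)
    (h2 : ∀ᵐ a ∂μ, (X' a = X a ∨ X' a = 0) ∧ (Y' a = Y a ∨ Y' a = 0))
    (h3 : ∀ᵐ a ∂μ, a ∈ B → X' a = 0 ∨ Y' a = 0)
    (hind : ∫ a, X' a * Y' a ∂μ = (∫ a, X' a ∂μ) * ∫ a, Y' a ∂μ) :
    |covariance X Y μ| ≤ l * ((c + (K + 1)) * (2 * K + 3)) := by
  have hK := h.nonneg
  have hc : 0 ≤ c * l ^ 2 := measureReal_nonneg.trans hBl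
  have hc0 : 0 ≤ c := nonneg_of_mul_nonneg_left hc (by positivity)
  have hXi : Integrable X μ := h.memLp.integrable (by norm_num)
  have hYi : Integrable Y μ := h'.memLp.integrable (by norm_num)
  have hXYi : Integrable (fun a => X a * Y a) μ := h.memLp.integrable_mul h'.memLp
  have hXi' : Integrable X' μ := hXi.mono hX' (by
    filter_upwards [h2] with a ha
    rcases ha.1 with e | e <;> simp [e])
  have hYi' : Integrable Y' μ := hYi.mono hY' (by
    filter_upwards [h2] with a ha
    rcases ha.2 with e | e <;> simp [e])
  have hXYi' : Integrable (fun a => X' a * Y' a) μ := hXYi.mono (hX'.mul hY') (by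
    filter_upwards [h2] with a ha
    rcases ha.1 with e | e <;> rcases ha.2 with e' | e' <;> simp [e, e'] <;> positivity)
  have hdiff : ∀ {Z Z' : α → ℝ}, Integrable Z μ → Integrable Z' μ →
      (∀ᵐ a ∂μ, |Z a - Z' a| ≤ B.indicator (fun a => |Z a|) a) →
      |∫ a, Z a ∂μ - ∫ a, Z' a ∂μ| ≤ ∫ a, B.indicator (fun a => |Z a|) a ∂μ := by
    intro Z Z' hZ hZ' hle
    rw [← integral_sub hZ hZ']
    exact (abs_integral_le_integral_abs).trans
      (integral_mono_ae (hZ.sub hZ').abs (hZ.abs.indicator hB) hle)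
  have eX : |∫ a, X a ∂μ - ∫ a, X' a ∂μ| ≤ l * (c + (K + 1)) := by
    refine (hdiff hXi hXi' ?_).trans
      (setIntegral_abs_le h.meas h.integrable_sq h.integral_sq_le hl hB hBl)
    filter_upwards [h1, h2] with a ha1 ha2
    by_cases ha : a ∈ B
    · rw [Set.indicator_of_mem ha]
      rcases ha2.1 with e | e <;> simp [e]
    · rw [Set.indicator_of_notMem ha, (ha1 ha).1]; simp
  have eY : |∫ a, Y a ∂μ - ∫ a, Y' a ∂μ| ≤ l * (c + (K + 1)) := by
    refine (hdiff hYi hYi' ?_).trans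
      (setIntegral_abs_le h'.meas h'.integrable_sq h'.integral_sq_le hl hB hBl)
    filter_upwards [h1, h2] with a ha1 ha2
    by_cases ha : a ∈ B
    · rw [Set.indicator_of_mem ha]
      rcases ha2.2 with e | e <;> simp [e]
    · rw [Set.indicator_of_notMem ha, (ha1 ha).2]; simp
  have eXY : |∫ a, X a * Y a ∂μ - ∫ a, X' a * Y' a ∂μ| ≤ l * (c + K) := by
    refine (hdiff hXYi hXYi' ?_).trans (setIntegral_abs_le (h.meas.mul h'.meas)
      (h.integrable_mul_sq h') (h.integral_mul_sq_le h') hl hB hBl)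
    filter_upwards [h1, h3] with a ha1 ha3
    by_cases ha : a ∈ B
    · rw [Set.indicator_of_mem ha]
      rcases ha3 ha with e | e <;> simp [e]
    · rw [Set.indicator_of_notMem ha, (ha1 ha).1, (ha1 ha).2]; simp
  have bY : |∫ a, Y a ∂μ| ≤ K + 1 := abs_integral_le_integral_abs.trans h'.integral_abs_le
  have bX : |∫ a, X' a ∂μ| ≤ K + 1 := by
    refine (abs_integral_le_integral_abs.trans (integral_mono_ae hXi'.abs hXi.abs ?_)).trans
      h.integral_abs_le
    filter_upwards [h2] with a ha
    rcases ha.1 with e | e <;> simp [e]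
  rw [covariance_eq_sub h.memLp h'.memLp]
  have e : (∫ a, (X * Y) a ∂μ) - (∫ a, X a ∂μ) * ∫ a, Y a ∂μ =
      (∫ a, X a * Y a ∂μ - ∫ a, X' a * Y' a ∂μ) - (∫ a, X a ∂μ - ∫ a, X' a ∂μ) * (∫ a, Y a ∂μ)
        - (∫ a, X' a ∂μ) * (∫ a, Y a ∂μ - ∫ a, Y' a ∂μ) := by
    rw [hind]; simp only [Pi.mul_apply]; ring
  rw [e]
  refine (abs_sub _ _).trans ?_
  rw [abs_mul]
  refine (add_le_add_left (abs_sub _ _) _).trans ?_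
  rw [abs_mul]
  have hl' : 0 ≤ l * (c + (K + 1)) := by positivity
  calc _ ≤ l * (c + K) + l * (c + (K + 1)) * (K + 1) + (K + 1) * (l * (c + (K + 1))) := by
        gcongr
    _ ≤ _ := by nlinarith

end FourthMoment

end Approx

/-! ### Exponential decay of covariances -/

section Decay

variable {Ω : Type*} [MeasurableSpace Ω] {P : Measure Ω} [IsProbabilityMeasure P]
    {ρ : ℝ} {ξ : ℤ → ℕ → Ω → ℝ} {η : ℝ → Ω → ℤ → Bool}

theorem measurable_value_shift (Q : Data → (ℝ → ℤ → Bool) → ℝ → ℝ) (s : ℝ) (c : ℤ) :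
    Measurable fun d => value Q s (shift c d) :=
  measurable_value.comp ((measurable_const (a := s)).prodMk (measurable_shift c))

theorem IsTASEP.ae_law (h : IsTASEP P ρ ξ η) (h0 : 0 < ρ) (h1 : ρ < 1) {p : Data → Prop}
    (hp : MeasurableSet {d | p d}) (hd : ∀ d σ, Typical d σ → p d) : ∀ᵐ d ∂(law ρ), p d := by
  rw [← h.map_data h0 h1, ae_map_iff h.measurable_data.aemeasurable hp]
  filter_upwards [h.ae_typical h0 h1] with ω hω
  exact hd _ _ hω

theorem IsTASEP.ae_value_eq (h : IsTASEP P ρ ξ η) (h0 : 0 < ρ) (h1 : ρ < 1)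
    {Q : Data → (ℝ → ℤ → Bool) → ℝ → ℝ} (hQ : LocalObs Q) {s : ℝ} (hs : 0 ≤ s) (c : ℤ) (k : ℕ) :
    ∀ᵐ d ∂(law ρ), Good (code k s (shift c d)) →
      value Q s (shift c d) = codeValue Q k (code k s (shift c d)) := by
  have hc : Measurable fun d : Data => code k s (shift c d) :=
    (measurable_code_right k s).comp (measurable_shift c)
  refine h.ae_law h0 h1 ?_ fun d σ hd hg => ?_
  · have e : {d : Data | Good (code k s (shift c d)) →
        value Q s (shift c d) = codeValue Q k (code k s (shift c d))} =
        {d | Good (code k s (shift c d))}ᶜ ∪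
          {d | value Q s (shift c d) = codeValue Q k (code k s (shift c d))} := by
      ext d; simp [imp_iff_not_or]
    rw [e]
    exact (hc (measurableSet_setOfPred.2 (measurable_of_code (Good (k := k))))).compl.union
      (measurableSet_eq_fun (measurable_value_shift Q s c)
        ((measurable_of_code (codeValue Q k)).comp hc))
  · rw [hd.value_shift hQ c hs, hd.codeValue_shift hQ c hs hg]

/-- Both observables are set to zero off good windows of radius about `|x|/2`, which are disjoint;
the truncated variables are independent. The rate `θ` depends on `t` alone and `A` only on the
moment bound, uniformly over times up to `t`, as the time integral in the sum rule needs. -/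
theorem IsTASEP.abs_covariance_value_le (h : IsTASEP P ρ ξ η) (h0 : 0 < ρ) (h1 : ρ < 1) {t : ℝ}
    (ht : 0 ≤ t) : ∃ θ : ℝ, 0 < θ ∧ θ < 1 ∧ ∀ K : ℝ, ∃ A : ℝ, 0 ≤ A ∧
      ∀ Q Q' : Data → (ℝ → ℤ → Bool) → ℝ → ℝ, LocalObs Q → LocalObs Q' →
      ∀ s s' : ℝ, 0 ≤ s → s ≤ t → 0 ≤ s' → s' ≤ t →
      (∀ x, FourthMoment (fun d => value Q s (shift x d)) (law ρ) K) →
      (∀ x, FourthMoment (fun d => value Q' s' (shift x d)) (law ρ) K) → ∀ x : ℤ,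
      |covariance (fun d => value Q s (shift 0 d)) (fun d => value Q' s' (shift x d)) (law ρ)| ≤
        A * θ ^ x.natAbs := by
  have := isProbabilityMeasure_bern h0 h1
  obtain ⟨C, r, hC, hr0, hr1, hbad⟩ := law_real_not_good (ρ := ρ) ht
  -- The first root is the one lost in `setIntegral_abs_le`; the second accounts for `k` being about
  -- `|x|/2`. The factor `θ⁻¹ ^ 2` in the constant covers `|x| ≤ 2k + 2`.
  set q := √r with hq
  have hq0 : 0 < q := Real.sqrt_pos.2 hr0
  have hq1 : q < 1 := by rw [hq, Real.sqrt_lt' one_pos]; simpa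
  set θ := √q with hθ
  have hθ0 : 0 < θ := Real.sqrt_pos.2 hq0
  have hθ1 : θ < 1 := by rw [hθ, Real.sqrt_lt' one_pos]; simpa
  refine ⟨θ, hθ0, hθ1, fun K => ⟨|(2 * C + 1 + (K + 1)) * (2 * K + 3)| * θ⁻¹ ^ 2,
    by positivity, fun Q Q' hQ hQ' s s' hs hst hs' hst' hX hY x => ?_⟩⟩
  have hK : 0 ≤ K := (hX 0).nonneg
  have hθi : 1 ≤ θ⁻¹ ^ 2 := one_le_pow₀ ((one_le_inv₀ hθ0).2 hθ1.le)
  set E := (2 * C + 1 + (K + 1)) * (2 * K + 3) with hE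
  have hE0 : 0 ≤ E := by positivity
  rw [abs_of_nonneg hE0]
  by_cases hx : x = 0
  -- No window pair is disjoint when `x = 0`; zero truncations on the whole space give the bare
  -- moment bound.
  · subst hx
    have := (hX 0).abs_covariance_le (hY 0) (X' := 0) (Y' := 0) aestronglyMeasurable_const
      aestronglyMeasurable_const MeasurableSet.univ (c := 2 * C + 1) (l := 1) one_pos
      (by simp; linarith) (by simp) (by simp) (by simp) (by simp)
    refine this.trans ?_
    simp only [one_mul, Int.natAbs_zero, pow_zero, mul_one]
    exact le_mul_of_one_le_right hE0 hθi
  set k := (x.natAbs - 1) / 2 with hk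
  have hkx : 2 * (k : ℤ) < |x| := by rw [Int.abs_eq_natAbs]; omega
  have hkx' : x.natAbs ≤ 2 * k + 2 := by omega
  set G : Set Data := {d | Good (code k s (shift 0 d))} with hG
  set G' : Set Data := {d | Good (code k s' (shift x d))} with hG'
  have hc : ∀ s c, Measurable fun d : Data => code k s (shift c d) := fun s c =>
    (measurable_code_right k s).comp (measurable_shift c)
  have hGm : MeasurableSet G :=
    hc s 0 (measurableSet_setOfPred.2 (measurable_of_code (Good (k := k))))
  have hGm' : MeasurableSet G' :=
    hc s' x (measurableSet_setOfPred.2 (measurable_of_code (Good (k := k))))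
  classical
  let φ : (Data → (ℝ → ℤ → Bool) → ℝ → ℝ) → Code k → ℝ := fun Q c =>
    if Good c then codeValue Q k c else 0
  have hφ : ∀ Q s c, Measurable fun d : Data => φ Q (code k s (shift c d)) := fun Q s c =>
    (measurable_of_code (φ Q)).comp (hc s c)
  have hbad' : ∀ s ≤ t, ∀ c, (law ρ).real {d | Good (code k s (shift c d))}ᶜ ≤ C * r ^ k := by
    intro s hs c
    refine le_trans (le_of_eq ?_) (hbad s hs k)
    have hm : MeasurableSet {d : Data | ¬ Good (code k s d)} :=
      (measurable_code_right k s (measurableSet_setOfPred.2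
        (measurable_of_code (Good (k := k))))).compl
    exact (measurePreserving_shift ρ c).measureReal_preimage hm.nullMeasurableSet
  have hB : (law ρ).real (G ∩ G')ᶜ ≤ (2 * C + 1) * (q ^ k) ^ 2 := by
    rw [Set.compl_inter]
    refine (measureReal_union_le _ _).trans ((add_le_add (hbad' s hst 0) (hbad' s' hst' x)).trans ?_)
    rw [← pow_mul, mul_comm k, pow_mul, Real.sq_sqrt hr0.le]
    have : 0 ≤ r ^ k := by positivity
    linarith
  have hind := ((indepFun_code (ρ := ρ) hkx s s').comp (measurable_of_code (φ Q))
    (measurable_of_code (φ Q'))).integral_fun_mul_eq_mul_integral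
      (hφ Q s 0).aestronglyMeasurable (hφ Q' s' x).aestronglyMeasurable
  have key := (hX 0).abs_covariance_le (hY x) (hφ Q s 0).aestronglyMeasurable
    (hφ Q' s' x).aestronglyMeasurable (hGm.inter hGm').compl (pow_pos hq0 k) hB ?_ ?_ ?_ hind
  · refine key.trans (le_of_eq_of_le (mul_comm _ _) ?_)
    change E * q ^ k ≤ _
    rw [mul_assoc E]
    refine mul_le_mul_of_nonneg_left ?_ hE0
    have : q = θ ^ 2 := (Real.sq_sqrt hq0.le).symm
    rw [this, ← pow_mul, inv_pow, inv_mul_eq_div, le_div_iff₀ (by positivity), ← pow_add]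
    exact pow_le_pow_of_le_one hθ0.le hθ1.le hkx'
  · filter_upwards [h.ae_value_eq h0 h1 hQ hs 0 k, h.ae_value_eq h0 h1 hQ' hs' x k] with d w1 w2 hd
    rw [Set.notMem_compl_iff] at hd
    have hd1 : Good (code k s (shift 0 d)) := hd.1
    have hd2 : Good (code k s' (shift x d)) := hd.2
    exact ⟨by rw [w1 hd1]; exact if_pos hd1, by rw [w2 hd2]; exact if_pos hd2⟩
  · filter_upwards [h.ae_value_eq h0 h1 hQ hs 0 k, h.ae_value_eq h0 h1 hQ' hs' x k] with d w1 w2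
    constructor
    · by_cases hd : Good (code k s (shift 0 d))
      · left; rw [w1 hd]; exact if_pos hd
      · right; exact if_neg hd
    · by_cases hd : Good (code k s' (shift x d))
      · left; rw [w2 hd]; exact if_pos hd
      · right; exact if_neg hd
  · refine Eventually.of_forall fun d hd => ?_
    rw [Set.compl_inter] at hd
    rcases hd with hd | hd
    · left; exact if_neg hd
    · right; exact if_neg hd

end Decay

/-! ### Moments -/

section Moments

variable {Ω : Type*} [MeasurableSpace Ω] {P : Measure Ω} [IsProbabilityMeasure P]
    {ρ : ℝ} {ξ : ℤ → ℕ → Ω → ℝ} {η : ℝ → Ω → ℤ → Bool}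

/-- The current across `(0, 1)` as an observable. -/
noncomputable def currentObs (d : Data) (σ : ℝ → ℤ → Bool) (s : ℝ) : ℝ := pathCurrent (ring d) σ s 0

/-- The occupation of the origin as an observable. -/
def occObs (_ : Data) (σ : ℝ → ℤ → Bool) (s : ℝ) : ℝ := occ (σ s 0)

/-- The jump rate at the origin as an observable. -/
def rateObs (_ : Data) (σ : ℝ → ℤ → Bool) (s : ℝ) : ℝ := rate (σ s)

theorem localObs_currentObs : LocalObs currentObs := localObs_current

theorem localObs_occObs : LocalObs occObs := localObs_occ

theorem localObs_rateObs : LocalObs rateObs := localObs_rate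

theorem Typical.value_currentObs {d : Data} {σ : ℝ → ℤ → Bool} (h : Typical d σ) (x : ℤ) {s : ℝ}
    (hs : 0 ≤ s) : value currentObs s (shift x d) = pathCurrent (ring d) σ s x := by
  rw [h.value_shift localObs_currentObs x hs, currentObs]
  have e : ring (shift x d) = fun y n => ring d (y + x) n := rfl
  rw [e, pathCurrent_shift, zero_add]

theorem Typical.value_occObs {d : Data} {σ : ℝ → ℤ → Bool} (h : Typical d σ) (x : ℤ) {s : ℝ}
    (hs : 0 ≤ s) : value occObs s (shift x d) = occ (σ s x) := by
  rw [h.value_shift localObs_occObs x hs, occObs, zero_add]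

theorem Typical.value_rateObs {d : Data} {σ : ℝ → ℤ → Bool} (h : Typical d σ) {s : ℝ}
    (hs : 0 ≤ s) : value rateObs s (shift 0 d) = rate (σ s) := by
  rw [h.value_shift localObs_rateObs 0 hs, rateObs]
  simp

theorem IsTASEP.current_ae_eq (h : IsTASEP P ρ ξ η) (h0 : 0 < ρ) (h1 : ρ < 1) (x : ℤ) {s : ℝ}
    (hs : 0 ≤ s) :
    current ξ η s x =ᵐ[P] fun ω => value currentObs s (shift x (dataOf ξ η ω)) := by
  filter_upwards [h.ae_typical h0 h1] with ω hω
  rw [hω.value_currentObs x hs]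
  rfl

theorem IsTASEP.occ_ae_eq (h : IsTASEP P ρ ξ η) (h0 : 0 < ρ) (h1 : ρ < 1) (x : ℤ) {s : ℝ}
    (hs : 0 ≤ s) : (fun ω => occ (η s ω x)) =ᵐ[P]
      fun ω => value occObs s (shift x (dataOf ξ η ω)) := by
  filter_upwards [h.ae_typical h0 h1] with ω hω
  rw [hω.value_occObs x hs]

theorem IsTASEP.rate_ae_eq (h : IsTASEP P ρ ξ η) (h0 : 0 < ρ) (h1 : ρ < 1) {s : ℝ}
    (hs : 0 ≤ s) : (fun ω => rate (η s ω)) =ᵐ[P]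
      fun ω => value rateObs s (shift 0 (dataOf ξ η ω)) := by
  filter_upwards [h.ae_typical h0 h1] with ω hω
  rw [hω.value_rateObs hs]

theorem abs_rate_le (c : ℤ → Bool) : |rate c| ≤ 1 := by
  rw [rate]; cases c 0 <;> cases c 1 <;> simp [occ]

theorem fourthMoment_of_bound {α : Type*} [MeasurableSpace α] {μ : Measure α}
    [IsProbabilityMeasure μ] {X : α → ℝ} (hX : AEStronglyMeasurable X μ)
    (hb : ∀ᵐ a ∂μ, |X a| ≤ 1) {K : ℝ} (hK : 1 ≤ K) : FourthMoment X μ K := by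
  have hb4 : ∀ᵐ a ∂μ, X a ^ 4 ≤ 1 := by
    filter_upwards [hb] with a ha
    have : X a ^ 4 = |X a| ^ 4 := by rw [← abs_pow, abs_of_nonneg (by positivity)]
    rw [this]
    exact pow_le_one₀ (abs_nonneg _) ha
  have hi : Integrable (fun a => X a ^ 4) μ := Integrable.of_bound (hX.pow 4) 1 (by
    filter_upwards [hb4] with a ha
    rwa [Real.norm_eq_abs, abs_of_nonneg (by positivity)])
  refine ⟨hX, hi, (integral_mono_ae hi (integrable_const 1) hb4).trans ?_⟩
  simpa using hK

theorem IsTASEP.fourthMoment_occObs (h : IsTASEP P ρ ξ η) (h0 : 0 < ρ) (h1 : ρ < 1) {s : ℝ}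
    (hs : 0 ≤ s) (x : ℤ) {K : ℝ} (hK : 1 ≤ K) :
    FourthMoment (fun d => value occObs s (shift x d)) (law ρ) K := by
  have := isProbabilityMeasure_bern h0 h1
  refine fourthMoment_of_bound (measurable_value_shift _ s x).aestronglyMeasurable
    (h.ae_law h0 h1 (measurableSet_le (measurable_value_shift _ s x).abs measurable_const)
      fun d σ hd => ?_) hK
  rw [hd.value_occObs x hs]
  exact abs_occ_le _

theorem IsTASEP.fourthMoment_rateObs (h : IsTASEP P ρ ξ η) (h0 : 0 < ρ) (h1 : ρ < 1) {s : ℝ}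
    (hs : 0 ≤ s) (x : ℤ) {K : ℝ} (hK : 1 ≤ K) :
    FourthMoment (fun d => value rateObs s (shift x d)) (law ρ) K := by
  have := isProbabilityMeasure_bern h0 h1
  refine fourthMoment_of_bound (measurable_value_shift _ s x).aestronglyMeasurable
    (h.ae_law h0 h1 (measurableSet_le (measurable_value_shift _ s x).abs measurable_const)
      fun d σ hd => ?_) hK
  rw [hd.value_shift localObs_rateObs x hs]
  exact abs_rate_le _

/-- A current equal to `m + 1` forces ring `m` to have occurred, so its fourth power is at most the
sum of `(n+1)^4` over the rings `n` up to time `s`; the geometric tails of the ring times make this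
summable, uniformly in `s ≤ t` and `x`. -/
theorem IsTASEP.fourthMoment_currentObs (h : IsTASEP P ρ ξ η) (h0 : 0 < ρ) (h1 : ρ < 1) {t : ℝ} :
    ∃ K : ℝ, 1 ≤ K ∧ ∀ s, 0 ≤ s → s ≤ t → ∀ x,
      FourthMoment (fun d => value currentObs s (shift x d)) (law ρ) K := by
  have := isProbabilityMeasure_bern h0 h1
  set a : ℕ → ℝ := fun n => ((n : ℝ) + 1) ^ 4 * (Real.exp t * (1 / 2) ^ (n + 1)) with ha
  have ha0 : ∀ n, 0 ≤ a n := fun n => by positivity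
  have hsum : Summable a := by
    have h4 := (summable_nat_add_iff 1).2 (summable_pow_mul_geometric_of_norm_lt_one (R := ℝ) 4
      (r := 1 / 2) (by norm_num))
    refine (h4.mul_left (Real.exp t)).congr fun n => ?_
    simp only [ha]; push_cast; ring
  refine ⟨1 + ∑' n, a n, le_add_of_nonneg_right (tsum_nonneg ha0), fun s hs hst x => ?_⟩
  have hm := measurable_value_shift currentObs s x
  set B : ℕ → Set Data := fun n => {d | ring d x n ≤ s} with hB
  have hBm : ∀ n, MeasurableSet (B n) := fun n => measurableSet_le (measurable_ring x n)
    measurable_const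
  have hae : ∀ᵐ d ∂(law ρ), ENNReal.ofReal (value currentObs s (shift x d) ^ 4) ≤
      ∑' n, (B n).indicator (fun _ => ENNReal.ofReal (((n : ℝ) + 1) ^ 4)) d := by
    refine h.ae_law h0 h1 (measurableSet_le (hm.pow_const 4).ennreal_ofReal
      (Measurable.tsum fun n => measurable_const.indicator (hBm n))) fun d σ hd => ?_
    rw [hd.value_currentObs x hs]
    rcases Nat.eq_zero_or_pos (pathCurrent (ring d) σ s x) with hz | hz
    · simp [hz]
    · obtain ⟨m, hm⟩ := Nat.exists_eq_succ_of_ne_zero hz.ne'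
      have hmem : d ∈ B m := hd.path.current_le s x m (by omega)
      refine le_trans ?_ (ENNReal.le_tsum m)
      rw [Set.indicator_of_mem hmem, hm]
      push_cast
      exact le_rfl
  have hl : ∫⁻ d, ENNReal.ofReal (value currentObs s (shift x d) ^ 4) ∂(law ρ) ≤
      ENNReal.ofReal (∑' n, a n) := by
    refine (lintegral_mono_ae hae).trans ?_
    rw [lintegral_tsum fun n => (measurable_const.indicator (hBm n)).aemeasurable,
      ENNReal.ofReal_tsum_of_nonneg ha0 hsum]
    refine ENNReal.tsum_le_tsum fun n => ?_
    rw [lintegral_indicator_const (hBm n), ha, ENNReal.ofReal_mul (by positivity)]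
    gcongr
    have hsub : B n ⊆ {d | ring d x n ≤ t} := fun d (hd : ring d x n ≤ s) => hd.trans hst
    refine (measure_mono hsub).trans ?_
    rw [← ofReal_measureReal]
    exact ENNReal.ofReal_le_ofReal (law_real_ring_le x n t)
  have hi : Integrable (fun d => value currentObs s (shift x d) ^ 4) (law ρ) := by
    refine ⟨(hm.pow_const 4).aestronglyMeasurable, ?_⟩
    rw [hasFiniteIntegral_iff_ofReal (Eventually.of_forall fun d => by positivity)]
    exact hl.trans_lt ENNReal.ofReal_lt_top
  refine ⟨hm.aestronglyMeasurable, hi, ?_⟩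
  rw [integral_eq_lintegral_of_nonneg_ae (Eventually.of_forall fun d => by positivity) hi.1]
  refine (ENNReal.toReal_le_of_le_ofReal (tsum_nonneg ha0) hl).trans (by linarith)

end Moments

/-! ### Translation invariance and stationarity of covariances -/

section

theorem covariance_congr {α : Type*} [MeasurableSpace α] {μ : Measure α} {X X' Y Y' : α → ℝ}
    (hX : X =ᵐ[μ] X') (hY : Y =ᵐ[μ] Y') : covariance X Y μ = covariance X' Y' μ := by
  simp only [covariance]
  rw [integral_congr_ae hX, integral_congr_ae hY]
  refine integral_congr_ae ?_
  filter_upwards [hX, hY] with a h1 h2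
  rw [h1, h2]

variable {Ω : Type*} [MeasurableSpace Ω] {P : Measure Ω} [IsProbabilityMeasure P]
    {ρ : ℝ} {ξ : ℤ → ℕ → Ω → ℝ} {η : ℝ → Ω → ℤ → Bool}

theorem shift_add (x c : ℤ) (d : Data) : shift (x + c) d = shift x (shift c d) := by
  simp only [shift, add_assoc]

/-- Translation invariance of the process, inherited from that of the law of the data. -/
theorem IsTASEP.covariance_eq (h : IsTASEP P ρ ξ η) (h0 : 0 < ρ) (h1 : ρ < 1) {X Y : Ω → ℝ}
    {Q Q' : Data → (ℝ → ℤ → Bool) → ℝ → ℝ} {s s' : ℝ} {x y : ℤ}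
    (hX : X =ᵐ[P] fun ω => value Q s (shift x (dataOf ξ η ω)))
    (hY : Y =ᵐ[P] fun ω => value Q' s' (shift y (dataOf ξ η ω))) :
    covariance X Y P = covariance (fun d => value Q s (shift 0 d))
      (fun d => value Q' s' (shift (y - x) d)) (law ρ) := by
  have := isProbabilityMeasure_bern h0 h1
  rw [covariance_congr hX hY]
  have e1 := covariance_map_fun (μ := P) (Z := dataOf ξ η)
    (measurable_value_shift Q s x).aestronglyMeasurable
    (measurable_value_shift Q' s' y).aestronglyMeasurable h.measurable_data.aemeasurable
  rw [← e1, h.map_data h0 h1]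
  have e2 := covariance_map_fun (μ := law ρ) (Z := shift x)
    (measurable_value_shift Q s 0).aestronglyMeasurable
    (measurable_value_shift Q' s' (y - x)).aestronglyMeasurable (measurable_shift x).aemeasurable
  rw [(measurePreserving_shift ρ x).map_eq] at e2
  simp only [← shift_add, zero_add, sub_add_cancel] at e2
  exact e2.symm

theorem IsTASEP.memLp_value (h : IsTASEP P ρ ξ η) (h0 : 0 < ρ) (h1 : ρ < 1) {X : Ω → ℝ}
    {Q : Data → (ℝ → ℤ → Bool) → ℝ → ℝ} {s : ℝ} {x : ℤ}
    (hX : X =ᵐ[P] fun ω => value Q s (shift x (dataOf ξ η ω)))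
    (hQ : MemLp (fun d => value Q s (shift x d)) 2 (law ρ)) : MemLp X 2 P := by
  rw [memLp_congr_ae hX]
  rw [← h.map_data h0 h1] at hQ
  exact hQ.comp_of_map h.measurable_data.aemeasurable

theorem IsTASEP.memLp_current (h : IsTASEP P ρ ξ η) (h0 : 0 < ρ) (h1 : ρ < 1) {t : ℝ}
    (ht : 0 ≤ t) (x : ℤ) : MemLp (current ξ η t x) 2 P := by
  have := isProbabilityMeasure_bern h0 h1
  obtain ⟨K, _, hK⟩ := h.fourthMoment_currentObs h0 h1 (t := t)
  exact h.memLp_value h0 h1 (h.current_ae_eq h0 h1 x ht) (hK t ht le_rfl x).memLp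

theorem IsTASEP.memLp_local (h : IsTASEP P ρ ξ η) {t : ℝ} (ht : 0 ≤ t) {g : (ℤ → Bool) → ℝ}
    {W : Finset ℤ} (hg : DependsOn g (W : Set ℤ)) {C : ℝ} (hC : ∀ c, |g c| ≤ C) :
    MemLp (fun ω => g (η t ω)) 2 P :=
  MemLp.of_bound ((measurable_of_dependsOn hg).comp (h.measurable_config t ht)).aestronglyMeasurable
    C (Eventually.of_forall fun _ => hC _)

theorem dependsOn_occ (x : ℤ) : DependsOn (fun c : ℤ → Bool => occ (c x)) (({x} : Finset ℤ) : Set ℤ) :=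
  fun c c' hc => by simp only [hc x (by simp)]

theorem dependsOn_rate : DependsOn rate (({0, 1} : Finset ℤ) : Set ℤ) := fun c c' hc => by
  simp only [rate, hc 0 (by simp), hc 1 (by simp)]

theorem IsTASEP.memLp_occ (h : IsTASEP P ρ ξ η) {t : ℝ} (ht : 0 ≤ t) (x : ℤ) :
    MemLp (fun ω => occ (η t ω x)) 2 P :=
  h.memLp_local ht (g := fun c => occ (c x)) (dependsOn_occ x) fun _ => abs_occ_le _

theorem IsTASEP.memLp_rate (h : IsTASEP P ρ ξ η) {t : ℝ} (ht : 0 ≤ t) :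
    MemLp (fun ω => rate (η t ω)) 2 P := h.memLp_local ht dependsOn_rate abs_rate_le

theorem IsTASEP.stationary_local (h : IsTASEP P ρ ξ η) (h0 : 0 < ρ) (h1 : ρ < 1) {t : ℝ}
    (ht : 0 ≤ t) {g : (ℤ → Bool) → ℝ} {W : Finset ℤ} (hg : DependsOn g (W : Set ℤ)) {C : ℝ}
    (hC : ∀ c, |g c| ≤ C) : ∫ ω, g (η t ω) ∂P = ∫ ω, g (η 0 ω) ∂P := by
  refine h.stationary h0 h1 ht (a := -(W.sup Int.natAbs : ℕ)) (ℓ := 2 * W.sup Int.natAbs) ?_ hC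
  refine fun c c' hc => hg fun y hy => hc y ?_
  have : y.natAbs ≤ W.sup Int.natAbs := Finset.le_sup (f := Int.natAbs) hy
  simp only [Finset.coe_Icc, Set.mem_Icc]
  push_cast
  omega

theorem DependsOn.mul_union {f g : (ℤ → Bool) → ℝ} {W V : Finset ℤ} (hf : DependsOn f (W : Set ℤ))
    (hg : DependsOn g (V : Set ℤ)) :
    DependsOn (fun c => f c * g c) ((W ∪ V : Finset ℤ) : Set ℤ) := fun c c' hc => by
  have e1 : f c = f c' := hf fun y hy => hc y (by
    rw [Finset.coe_union]; exact Or.inl hy)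
  have e2 : g c = g c' := hg fun y hy => hc y (by
    rw [Finset.coe_union]; exact Or.inr hy)
  simp only [e1, e2]

theorem IsTASEP.covariance_stationary (h : IsTASEP P ρ ξ η) (h0 : 0 < ρ) (h1 : ρ < 1) {t : ℝ}
    (ht : 0 ≤ t) {f g : (ℤ → Bool) → ℝ} {W V : Finset ℤ} (hf : DependsOn f (W : Set ℤ))
    (hg : DependsOn g (V : Set ℤ)) (hfb : ∀ c, |f c| ≤ 1) (hgb : ∀ c, |g c| ≤ 1) :
    covariance (fun ω => f (η t ω)) (fun ω => g (η t ω)) P =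
      covariance (fun ω => f (η 0 ω)) (fun ω => g (η 0 ω)) P := by
  rw [covariance_eq_sub (h.memLp_local ht hf hfb) (h.memLp_local ht hg hgb),
    covariance_eq_sub (h.memLp_local le_rfl hf hfb) (h.memLp_local le_rfl hg hgb)]
  simp only [Pi.mul_apply]
  rw [h.stationary_local h0 h1 ht hf hfb, h.stationary_local h0 h1 ht hg hgb,
    h.stationary_local h0 h1 ht (g := fun c => f c * g c) (DependsOn.mul_union hf hg) (C := 1)]
  intro c
  rw [abs_mul]
  exact mul_le_one₀ (hfb c) (abs_nonneg _) (hgb c)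

theorem IsTASEP.integral_occ (h : IsTASEP P ρ ξ η) (h0 : 0 < ρ) (h1 : ρ < 1) {t : ℝ}
    (ht : 0 ≤ t) (x : ℤ) : ∫ ω, occ (η t ω x) ∂P = ρ := by
  rw [h.stationary_local h0 h1 ht (g := fun c => occ (c x)) (dependsOn_occ x) fun _ => abs_occ_le _]
  have hm : MeasurableSet {ω | η 0 ω x = true} :=
    ((measurable_pi_apply x).comp (h.measurable_config 0 le_rfl)) (measurableSet_singleton true)
  have e : (fun ω => occ (η 0 ω x)) = {ω | η 0 ω x = true}.indicator fun _ => (1 : ℝ) := by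
    funext ω
    by_cases hω : η 0 ω x = true
    · rw [Set.indicator_of_mem (by exact hω)]; simp [occ, hω]
    · rw [Set.indicator_of_notMem (by exact hω)]; simp [occ, hω]
  rw [e, integral_indicator_const _ hm, Measure.real, h.init_law, ENNReal.toReal_ofReal h0.le]
  simp

theorem occ_mul_self (b : Bool) : occ b * occ b = occ b := by cases b <;> simp [occ]

theorem IsTASEP.indepFun_occ (h : IsTASEP P ρ ξ η) {x y : ℤ} (hxy : x ≠ y) :
    IndepFun (fun ω => occ (η 0 ω x)) (fun ω => occ (η 0 ω y)) P :=
  (h.init_indep.indepFun hxy).comp measurable_occ measurable_occ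

theorem IsTASEP.covariance_occ (h : IsTASEP P ρ ξ η) (h0 : 0 < ρ) (h1 : ρ < 1) {t : ℝ}
    (ht : 0 ≤ t) (x y : ℤ) : covariance (fun ω => occ (η t ω x)) (fun ω => occ (η t ω y)) P =
      if x = y then chi ρ else 0 := by
  rw [h.covariance_stationary h0 h1 ht (f := fun c => occ (c x)) (g := fun c => occ (c y))
    (dependsOn_occ x) (dependsOn_occ y) (fun _ => abs_occ_le _) fun _ => abs_occ_le _]
  split_ifs with hxy
  · subst hxy
    rw [covariance_eq_sub (h.memLp_occ le_rfl x) (h.memLp_occ le_rfl x)]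
    simp only [Pi.mul_apply, occ_mul_self, h.integral_occ h0 h1 le_rfl, chi]
    ring
  · exact (h.indepFun_occ hxy).covariance_eq_zero (h.memLp_occ le_rfl x) (h.memLp_occ le_rfl y)

/-- At time zero the rate times `η_0` is the rate, the rate times `η_1` is zero, and all other sites
are independent of the rate. The two nonzero values add up to `χ(1-2ρ)`, the constant in the sum
rule. -/
theorem IsTASEP.covariance_rate_occ (h : IsTASEP P ρ ξ η) (h0 : 0 < ρ) (h1 : ρ < 1) {t : ℝ}
    (ht : 0 ≤ t) (y : ℤ) : covariance (fun ω => rate (η t ω)) (fun ω => occ (η t ω y)) P =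
      if y = 0 then chi ρ * (1 - ρ) else if y = 1 then -(chi ρ * ρ) else 0 := by
  rw [h.covariance_stationary h0 h1 ht (f := rate) (g := fun c => occ (c y))
    dependsOn_rate (dependsOn_occ y) abs_rate_le fun _ => abs_occ_le _]
  have hi : ∀ x, Integrable (fun ω => occ (η 0 ω x)) P := fun x =>
    (h.memLp_occ le_rfl x).integrable (by norm_num)
  have hii : ∀ x y, Integrable (fun ω => occ (η 0 ω x) * occ (η 0 ω y)) P := fun x y =>
    (h.memLp_occ le_rfl x).integrable_mul (h.memLp_occ le_rfl y)
  have e01 : ∫ ω, occ (η 0 ω 0) * occ (η 0 ω 1) ∂P = ρ * ρ := by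
    rw [(h.indepFun_occ (x := 0) (y := 1) (by norm_num)).integral_fun_mul_eq_mul_integral
      (hi 0).1 (hi 1).1, h.integral_occ h0 h1 le_rfl, h.integral_occ h0 h1 le_rfl]
  have er : ∫ ω, rate (η 0 ω) ∂P = ρ - ρ * ρ := by
    have : ∀ ω, rate (η 0 ω) = occ (η 0 ω 0) - occ (η 0 ω 0) * occ (η 0 ω 1) := fun ω => by
      rw [rate]; ring
    simp_rw [this]
    rw [integral_sub (hi 0) (hii 0 1), e01, h.integral_occ h0 h1 le_rfl]
  split_ifs with hy hy
  · subst hy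
    rw [covariance_eq_sub (h.memLp_rate le_rfl) (h.memLp_occ le_rfl 0)]
    have : ∀ ω, rate (η 0 ω) * occ (η 0 ω 0) = rate (η 0 ω) := fun ω => by
      rw [rate, mul_right_comm, occ_mul_self]
    simp only [Pi.mul_apply, this, er, h.integral_occ h0 h1 le_rfl, chi]
    ring
  · subst hy
    rw [covariance_eq_sub (h.memLp_rate le_rfl) (h.memLp_occ le_rfl 1)]
    have : ∀ ω, rate (η 0 ω) * occ (η 0 ω 1) = 0 := fun ω => by
      rw [rate]; cases η 0 ω 1 <;> simp [occ]
    simp only [Pi.mul_apply, this, er, h.integral_occ h0 h1 le_rfl, chi, integral_zero]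
    ring
  · refine IndepFun.covariance_eq_zero ?_ (h.memLp_rate le_rfl) (h.memLp_occ le_rfl y)
    have hm : ∀ x, Measurable fun ω => η 0 ω x := fun x =>
      (measurable_pi_apply x).comp (h.measurable_config 0 le_rfl)
    have := h.init_indep.indepFun_prodMk hm 0 1 y (Ne.symm ‹_›) (Ne.symm ‹_›)
    exact this.comp (φ := fun p : Bool × Bool => occ p.1 * (1 - occ p.2))
      (measurable_of_countable _) measurable_occ

end

/-! ### Covariances of the current -/

section

variable {Ω : Type*} [MeasurableSpace Ω] {P : Measure Ω} [IsProbabilityMeasure P]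
    {ρ : ℝ} {ξ : ℤ → ℕ → Ω → ℝ} {η : ℝ → Ω → ℤ → Bool}

/-- The covariance of the current through the origin and the occupation of `y`. -/
noncomputable def currentOcc (P : Measure Ω) (ξ : ℤ → ℕ → Ω → ℝ) (η : ℝ → Ω → ℤ → Bool) (t : ℝ)
    (y : ℤ) : ℝ := covariance (current ξ η t 0) (fun ω => occ (η t ω y)) P

/-- The covariance of the currents at the origin and at `x`. -/
noncomputable def currentCurrent (P : Measure Ω) (ξ : ℤ → ℕ → Ω → ℝ) (η : ℝ → Ω → ℤ → Bool) (t : ℝ)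
    (x : ℤ) : ℝ := covariance (current ξ η t 0) (current ξ η t x) P

namespace IsTASEP

theorem covariance_current_occ (h : IsTASEP P ρ ξ η) (h0 : 0 < ρ) (h1 : ρ < 1) {t : ℝ}
    (ht : 0 ≤ t) (x y : ℤ) : covariance (current ξ η t x) (fun ω => occ (η t ω y)) P =
      currentOcc P ξ η t (y - x) := by
  rw [currentOcc, h.covariance_eq h0 h1 (h.current_ae_eq h0 h1 x ht) (h.occ_ae_eq h0 h1 y ht),
    h.covariance_eq h0 h1 (h.current_ae_eq h0 h1 0 ht) (h.occ_ae_eq h0 h1 (y - x) ht), sub_zero]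

theorem covariance_current_current (h : IsTASEP P ρ ξ η) (h0 : 0 < ρ) (h1 : ρ < 1) {t : ℝ}
    (ht : 0 ≤ t) (x y : ℤ) : covariance (current ξ η t x) (current ξ η t y) P =
      currentCurrent P ξ η t (y - x) := by
  rw [currentCurrent, h.covariance_eq h0 h1 (h.current_ae_eq h0 h1 x ht)
    (h.current_ae_eq h0 h1 y ht), h.covariance_eq h0 h1 (h.current_ae_eq h0 h1 0 ht)
    (h.current_ae_eq h0 h1 (y - x) ht), sub_zero]

theorem covariance_occ_occ_zero (h : IsTASEP P ρ ξ η) (h0 : 0 < ρ) (h1 : ρ < 1) {t : ℝ}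
    (ht : 0 ≤ t) (x y : ℤ) : covariance (fun ω => occ (η t ω x)) (fun ω => occ (η 0 ω y)) P =
      S P ρ η (x - y) t := by
  have e : S P ρ η (x - y) t =
      covariance (fun ω => occ (η t ω (x - y))) (fun ω => occ (η 0 ω 0)) P := by
    rw [S, covariance, h.integral_occ h0 h1 ht, h.integral_occ h0 h1 le_rfl]
  rw [e, h.covariance_eq h0 h1 (h.occ_ae_eq h0 h1 x ht) (h.occ_ae_eq h0 h1 y le_rfl),
    h.covariance_eq h0 h1 (h.occ_ae_eq h0 h1 (x - y) ht) (h.occ_ae_eq h0 h1 0 le_rfl)]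
  congr! 4
  ring

theorem currentCurrent_neg (h : IsTASEP P ρ ξ η) (h0 : 0 < ρ) (h1 : ρ < 1) {t : ℝ}
    (ht : 0 ≤ t) (x : ℤ) : currentCurrent P ξ η t (-x) = currentCurrent P ξ η t x := by
  rw [← zero_sub, ← h.covariance_current_current h0 h1 ht x 0, covariance_comm, currentCurrent]

theorem variance_current (h : IsTASEP P ρ ξ η) (h0 : 0 < ρ) (h1 : ρ < 1) {t : ℝ}
    (ht : 0 ≤ t) (x : ℤ) : variance (current ξ η t x) P = currentCurrent P ξ η t 0 := by
  rw [← covariance_self (h.memLp_current h0 h1 ht x).aemeasurable,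
    h.covariance_current_current h0 h1 ht, sub_self]

theorem sum_occ_ae (h : IsTASEP P ρ ξ η) (h0 : 0 < ρ) (h1 : ρ < 1) {t : ℝ} (ht : 0 ≤ t) {a b : ℤ}
    (hab : a ≤ b) : (fun ω => ∑ y ∈ Finset.Ioc a b, occ (η t ω y)) =ᵐ[P] fun ω =>
      ∑ y ∈ Finset.Ioc a b, occ (η 0 ω y) + (current ξ η t a ω - current ξ η t b ω) := by
  filter_upwards [h.ae_typical h0 h1] with ω hω
  rw [hω.path.sum_occ ht hab, add_sub_assoc]
  rfl

theorem memLp_sum_occ (h : IsTASEP P ρ ξ η) {t : ℝ} (ht : 0 ≤ t) (W : Finset ℤ) :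
    MemLp (fun ω => ∑ y ∈ W, occ (η t ω y)) 2 P := memLp_finsetSum _ fun y _ => h.memLp_occ ht y

theorem variance_sum_occ (h : IsTASEP P ρ ξ η) (h0 : 0 < ρ) (h1 : ρ < 1) {t : ℝ} (ht : 0 ≤ t)
    (W : Finset ℤ) : variance (fun ω => ∑ y ∈ W, occ (η t ω y)) P = chi ρ * W.card := by
  rw [variance_fun_sum' fun y _ => h.memLp_occ ht y]
  simp only [h.covariance_occ h0 h1 ht, Finset.sum_ite_eq]
  rw [Finset.sum_congr rfl fun y hy => if_pos hy, Finset.sum_const, nsmul_eq_mul, mul_comm]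

theorem covariance_current_sum_occ (h : IsTASEP P ρ ξ η) (h0 : 0 < ρ) (h1 : ρ < 1) {t : ℝ}
    (ht : 0 ≤ t) (x : ℤ) (W : Finset ℤ) :
    covariance (current ξ η t x) (fun ω => ∑ y ∈ W, occ (η t ω y)) P =
      ∑ y ∈ W, currentOcc P ξ η t (y - x) := by
  rw [covariance_fun_sum_right' (fun y _ => h.memLp_occ ht y) (h.memLp_current h0 h1 ht x)]
  exact Finset.sum_congr rfl fun y _ => h.covariance_current_occ h0 h1 ht x y

/-- The block sums at times `0` and `t` have equal variance and differ by `N_t(a) - N_t(b)`.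
Expanding the variance of the difference leaves twice the covariance of the block sum with the net
current equal to the variance of the net current. -/
theorem sum_currentOcc_sub (h : IsTASEP P ρ ξ η) (h0 : 0 < ρ) (h1 : ρ < 1) {t : ℝ}
    (ht : 0 ≤ t) {a b : ℤ} (hab : a ≤ b) :
    ∑ y ∈ Finset.Ioc a b, currentOcc P ξ η t (y - a) -
      ∑ y ∈ Finset.Ioc a b, currentOcc P ξ η t (y - b) =
        currentCurrent P ξ η t 0 - currentCurrent P ξ η t (b - a) := by
  have hB := h.memLp_sum_occ ht (Finset.Ioc a b)
  have ha := h.memLp_current h0 h1 ht a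
  have hb := h.memLp_current h0 h1 ht b
  have hN := ha.sub hb
  have e1 : variance (fun ω => ∑ y ∈ Finset.Ioc a b, occ (η 0 ω y)) P =
      variance (fun ω => ∑ y ∈ Finset.Ioc a b, occ (η t ω y) -
        (current ξ η t a - current ξ η t b) ω) P := by
    refine variance_congr ?_
    filter_upwards [h.sum_occ_ae h0 h1 ht hab] with ω hω
    simp only [Pi.sub_apply]
    linarith
  rw [variance_fun_sub hB hN, h.variance_sum_occ h0 h1 le_rfl, h.variance_sum_occ h0 h1 ht,
    variance_sub ha hb, h.variance_current h0 h1 ht, h.variance_current h0 h1 ht,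
    h.covariance_current_current h0 h1 ht, covariance_comm, covariance_sub_left ha hb hB,
    h.covariance_current_sum_occ h0 h1 ht, h.covariance_current_sum_occ h0 h1 ht] at e1
  linarith

/-- Pair the conservation law at site `1` with the occupation of `x + 1` at time `t`; the equal-time
covariance produces the mass `χ` at `x = 0`. -/
theorem currentOcc_sub (h : IsTASEP P ρ ξ η) (h0 : 0 < ρ) (h1 : ρ < 1) {t : ℝ}
    (ht : 0 ≤ t) (x : ℤ) : currentOcc P ξ η t x - currentOcc P ξ η t (x + 1) =
      S P ρ η x t - if x = 0 then chi ρ else 0 := by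
  have e0 : (fun ω => occ (η t ω 1) - occ (η 0 ω 1)) =ᵐ[P] current ξ η t 0 - current ξ η t 1 := by
    filter_upwards [h.evolution] with ω hω
    rw [hω t ht 1, Pi.sub_apply, sub_self]
    ring
  have e1 := covariance_congr e0 (ae_eq_refl (μ := P) fun ω => occ (η t ω (x + 1)))
  rw [covariance_fun_sub_left (h.memLp_occ ht 1) (h.memLp_occ le_rfl 1) (h.memLp_occ ht (x + 1)),
    covariance_sub_left (h.memLp_current h0 h1 ht 0) (h.memLp_current h0 h1 ht 1)
      (h.memLp_occ ht (x + 1)), h.covariance_occ h0 h1 ht, h.covariance_current_occ h0 h1 ht,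
    h.covariance_current_occ h0 h1 ht,
    covariance_comm (fun ω => occ (η 0 ω 1)), h.covariance_occ_occ_zero h0 h1 ht,
    sub_zero, add_sub_cancel_right] at e1
  have : (1 = x + 1) ↔ x = 0 := by omega
  simp only [this] at e1
  linarith

/-- The height variance in terms of the covariances of the current, to the right. -/
theorem v_of_nonneg (h : IsTASEP P ρ ξ η) (h0 : 0 < ρ) (h1 : ρ < 1) {t : ℝ}
    (ht : 0 ≤ t) {x : ℤ} (hx : 0 ≤ x) : v P ξ η x t =
      4 * (currentCurrent P ξ η t 0 - 2 * ∑ y ∈ Finset.Ioc 0 x, currentOcc P ξ η t y + chi ρ * x) := by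
  have hB := h.memLp_sum_occ ht (Finset.Ioc 0 x)
  have hN := h.memLp_current h0 h1 ht 0
  have hIcc : Finset.Icc 1 x = Finset.Ioc 0 x := by ext; simp; omega
  have e : height ξ η t x = fun ω => 2 * (current ξ η t 0 ω -
      ∑ y ∈ Finset.Ioc 0 x, occ (η t ω y)) + x := by
    funext ω
    rw [height, M, if_pos hx, hIcc, Finset.sum_sub_distrib, ← Finset.mul_sum]
    simp only [Finset.sum_const, Int.card_Ioc, nsmul_eq_mul, mul_one]
    have : (((x - 0).toNat : ℕ) : ℝ) = x := by
      rw [sub_zero]; exact_mod_cast Int.toNat_of_nonneg hx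
    rw [this]; ring
  have hs : MemLp (fun ω => current ξ η t 0 ω - ∑ y ∈ Finset.Ioc 0 x, occ (η t ω y)) 2 P :=
    hN.sub hB
  rw [v, e, variance_add_const (hs.1.const_mul 2), variance_const_mul, variance_fun_sub hN hB,
    h.variance_current h0 h1 ht, h.variance_sum_occ h0 h1 ht, h.covariance_current_sum_occ h0 h1 ht]
  simp only [sub_zero, Int.card_Ioc]
  have : ((x.toNat : ℕ) : ℝ) = x := by exact_mod_cast Int.toNat_of_nonneg hx
  rw [this]; ring

/-- The height variance in terms of the covariances of the current, to the left. -/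
theorem v_of_nonpos (h : IsTASEP P ρ ξ η) (h0 : 0 < ρ) (h1 : ρ < 1) {t : ℝ}
    (ht : 0 ≤ t) {x : ℤ} (hx : x ≤ 0) : v P ξ η x t =
      4 * (currentCurrent P ξ η t 0 + 2 * ∑ y ∈ Finset.Ioc x 0, currentOcc P ξ η t y - chi ρ * x) := by
  have hB := h.memLp_sum_occ ht (Finset.Ioc x 0)
  have hN := h.memLp_current h0 h1 ht 0
  have hIcc : Finset.Icc (x + 1) 0 = Finset.Ioc x 0 := by ext; simp
  have hcard : (((0 - x).toNat : ℕ) : ℝ) = -x := by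
    have := Int.toNat_of_nonneg (show 0 ≤ 0 - x by omega)
    rw [← Int.cast_natCast, this]; push_cast; ring
  have e : height ξ η t x = fun ω => 2 * (current ξ η t 0 ω +
      ∑ y ∈ Finset.Ioc x 0, occ (η t ω y)) + x := by
    funext ω
    by_cases hx0 : x = 0
    · subst hx0; simp [height, M]
    rw [height, M, if_neg (by omega), hIcc, Finset.sum_sub_distrib, ← Finset.mul_sum]
    simp only [Finset.sum_const, Int.card_Ioc, nsmul_eq_mul, mul_one]
    rw [hcard]; ring
  have hs : MemLp (fun ω => current ξ η t 0 ω + ∑ y ∈ Finset.Ioc x 0, occ (η t ω y)) 2 P :=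
    hN.add hB
  rw [v, e, variance_add_const (hs.1.const_mul 2), variance_const_mul, variance_fun_add hN hB,
    h.variance_current h0 h1 ht, h.variance_sum_occ h0 h1 ht, h.covariance_current_sum_occ h0 h1 ht]
  simp only [sub_zero, Int.card_Ioc]
  rw [hcard]; ring

/-- The increments of `v` are `±4χ - 8c`, with `c` the covariance `currentOcc`. The sign change at
the origin cancels the mass in `currentOcc_sub`. -/
theorem v_second_difference (h : IsTASEP P ρ ξ η) (h0 : 0 < ρ) (h1 : ρ < 1) {t : ℝ}
    (ht : 0 ≤ t) (x : ℤ) :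
    v P ξ η (x + 1) t - 2 * v P ξ η x t + v P ξ η (x - 1) t = 8 * S P ρ η x t := by
  have hr : ∀ y : ℤ, 0 ≤ y → v P ξ η (y + 1) t - v P ξ η y t =
      4 * chi ρ - 8 * currentOcc P ξ η t (y + 1) := by
    intro y hy
    rw [h.v_of_nonneg h0 h1 ht hy, h.v_of_nonneg h0 h1 ht (by omega : 0 ≤ y + 1)]
    have : Finset.Ioc 0 (y + 1) = insert (y + 1) (Finset.Ioc 0 y) := by ext; simp; omega
    rw [this, Finset.sum_insert (by simp)]
    push_cast; ring
  have hl : ∀ y : ℤ, y < 0 → v P ξ η (y + 1) t - v P ξ η y t =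
      -4 * chi ρ - 8 * currentOcc P ξ η t (y + 1) := by
    intro y hy
    rw [h.v_of_nonpos h0 h1 ht hy.le, h.v_of_nonpos h0 h1 ht (by omega : y + 1 ≤ 0)]
    have : Finset.Ioc y 0 = insert (y + 1) (Finset.Ioc (y + 1) 0) := by ext; simp; omega
    rw [this, Finset.sum_insert (by simp)]
    push_cast; ring
  have hc := h.currentOcc_sub h0 h1 ht x
  rcases lt_trichotomy x 0 with hx | hx | hx
  · have e1 := hl x hx
    have e2 := hl (x - 1) (by omega)
    rw [sub_add_cancel] at e2
    rw [if_neg hx.ne] at hc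
    linarith
  · have e1 := hr x hx.ge
    have e2 := hl (x - 1) (by omega)
    rw [sub_add_cancel] at e2
    rw [if_pos hx] at hc
    linarith
  · have e1 := hr x hx.le
    have e2 := hr (x - 1) (by omega)
    rw [sub_add_cancel] at e2
    rw [if_neg hx.ne'] at hc
    linarith

/-- `sum_currentOcc_sub` on `(0, |x|]` gives the difference of the sums over the two half windows.
It trades twice the one-sided sum in `v_of_nonneg` or `v_of_nonpos` for the symmetric sum, and the
current variance for the covariance at `x`. -/
theorem v_eq (h : IsTASEP P ρ ξ η) (h0 : 0 < ρ) (h1 : ρ < 1) {t : ℝ} (ht : 0 ≤ t) (x : ℤ) :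
    v P ξ η x t = 4 * chi ρ * |(x : ℝ)| + 4 * currentCurrent P ξ η t x -
      4 * (x.sign : ℝ) * ∑ y ∈ Finset.Icc (-|x| + 1) |x|, currentOcc P ξ η t y := by
  have hsplit : ∀ n : ℤ, 0 ≤ n → ∑ y ∈ Finset.Icc (-n + 1) n, currentOcc P ξ η t y =
      ∑ y ∈ Finset.Ioc (-n) 0, currentOcc P ξ η t y + ∑ y ∈ Finset.Ioc 0 n, currentOcc P ξ η t y := by
    intro n hn
    rw [← Finset.sum_union]
    · congr 1; ext; simp; omega
    · rw [Finset.disjoint_left]; intro y; simp only [Finset.mem_Ioc]; omega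
  have hmain : ∀ n : ℤ, 0 ≤ n → ∑ y ∈ Finset.Ioc 0 n, currentOcc P ξ η t y -
      ∑ y ∈ Finset.Ioc (-n) 0, currentOcc P ξ η t y =
        currentCurrent P ξ η t 0 - currentCurrent P ξ η t n := by
    intro n hn
    have := h.sum_currentOcc_sub h0 h1 ht hn
    simp only [sub_zero] at this
    rw [← this]
    congr 1
    refine Finset.sum_bij' (fun y _ => y + n) (fun y _ => y - n) ?_ ?_ ?_ ?_ ?_ <;>
      intro y hy <;> simp only [Finset.mem_Ioc] at * <;> first | omega | simp
  rcases lt_trichotomy x 0 with hx | hx | hx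
  · have e1 := hsplit (-x) (by omega)
    have e2 := hmain (-x) (by omega)
    rw [neg_neg] at e1 e2
    rw [h.currentCurrent_neg h0 h1 ht] at e2
    have hxr : (x : ℝ) < 0 := by exact_mod_cast hx
    rw [h.v_of_nonpos h0 h1 ht hx.le, abs_of_neg hx, abs_of_neg hxr, Int.sign_eq_neg_one_of_neg hx,
      neg_neg, e1]
    push_cast
    linarith
  · subst hx
    rw [h.v_of_nonneg h0 h1 ht le_rfl]
    simp
  · have e1 := hsplit x hx.le
    have e2 := hmain x hx.le
    have hxr : 0 < (x : ℝ) := by exact_mod_cast hx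
    rw [h.v_of_nonneg h0 h1 ht hx.le, abs_of_pos hx, abs_of_pos hxr, Int.sign_eq_one_of_pos hx, e1]
    push_cast
    linarith

end IsTASEP

end

/-! ### The sum rule -/

section

variable {Ω : Type*} [MeasurableSpace Ω] {P : Measure Ω} [IsProbabilityMeasure P]
    {ρ : ℝ} {ξ : ℤ → ℕ → Ω → ℝ} {η : ℝ → Ω → ℤ → Bool}

namespace IsTASEP

theorem exists_decay (h : IsTASEP P ρ ξ η) (h0 : 0 < ρ) (h1 : ρ < 1) {t : ℝ} (ht : 0 ≤ t) :
    ∃ θ A : ℝ, 0 < θ ∧ θ < 1 ∧ 0 ≤ A ∧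
      (∀ x, |currentOcc P ξ η t x| ≤ A * θ ^ x.natAbs) ∧
      (∀ x, |currentCurrent P ξ η t x| ≤ A * θ ^ x.natAbs) ∧
      ∀ s, 0 ≤ s → s ≤ t → ∀ x,
        |covariance (fun ω => rate (η s ω)) (current ξ η s x) P| ≤ A * θ ^ x.natAbs := by
  obtain ⟨θ, hθ0, hθ1, hθ⟩ := h.abs_covariance_value_le h0 h1 ht
  obtain ⟨K, hK1, hK⟩ := h.fourthMoment_currentObs h0 h1 (t := t)
  obtain ⟨A, hA, hb⟩ := hθ K
  refine ⟨θ, A, hθ0, hθ1, hA, fun x => ?_, fun x => ?_, fun s hs hst x => ?_⟩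
  · rw [currentOcc, h.covariance_eq h0 h1 (h.current_ae_eq h0 h1 0 ht) (h.occ_ae_eq h0 h1 x ht),
      sub_zero]
    exact hb _ _ localObs_currentObs localObs_occObs t t ht le_rfl ht le_rfl (hK t ht le_rfl)
      (fun x => h.fourthMoment_occObs h0 h1 ht x hK1) x
  · rw [currentCurrent, h.covariance_eq h0 h1 (h.current_ae_eq h0 h1 0 ht)
      (h.current_ae_eq h0 h1 x ht), sub_zero]
    exact hb _ _ localObs_currentObs localObs_currentObs t t ht le_rfl ht le_rfl (hK t ht le_rfl)
      (hK t ht le_rfl) x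
  · rw [h.covariance_eq h0 h1 (h.rate_ae_eq h0 h1 hs) (h.current_ae_eq h0 h1 x hs), sub_zero]
    exact hb _ _ localObs_rateObs localObs_currentObs s s hs hst hs hst
      (fun x => h.fourthMoment_rateObs h0 h1 hs x hK1) (hK s hs hst) x

theorem current_ae_ringSum (h : IsTASEP P ρ ξ η) (h0 : 0 < ρ) (h1 : ρ < 1) (t : ℝ) :
    current ξ η t 0 =ᵐ[P]
      fun ω => ringSum 0 (fun s d => rate (leftConfig s d)) t (dataOf ξ η ω) := by
  filter_upwards [h.ae_typical h0 h1] with ω hω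
  rw [← hω.pathCurrent_eq]
  rfl

theorem ringSum_const_mul (f : Data → ℝ) (H : ℝ → Data → ℝ) (x : ℤ) (t : ℝ) (d : Data) :
    ringSum x (fun s d => f d * H s d) t d = f d * ringSum x H t d := by
  simp only [ringSum, ← tsum_mul_left, mul_ite, mul_zero]

theorem abs_sum_occ_le (W : Finset ℤ) (c : ℤ → Bool) : |∑ y ∈ W, occ (c y)| ≤ W.card := by
  refine (Finset.abs_sum_le_sum_abs _ _).trans ((Finset.sum_le_sum fun y _ => abs_occ_le _).trans ?_)
  simp

theorem measurable_sum_occ (W : Finset ℤ) : Measurable fun c : ℤ → Bool => ∑ y ∈ W, occ (c y) :=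
  Finset.measurable_fun_sum _ fun y _ => measurable_occ.comp (measurable_pi_apply y)

theorem covariance_current_sum_occ_zero (h : IsTASEP P ρ ξ η) (h0 : 0 < ρ) (h1 : ρ < 1) {t : ℝ}
    (ht : 0 ≤ t) (W : Finset ℤ) :
    IntegrableOn (fun s => covariance (fun ω => rate (η s ω))
      (fun ω => ∑ y ∈ W, occ (η 0 ω y)) P) (Set.Ioc 0 t) ∧
    covariance (current ξ η t 0) (fun ω => ∑ y ∈ W, occ (η 0 ω y)) P =
      ∫ s in Set.Ioc 0 t, covariance (fun ω => rate (η s ω))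
        (fun ω => ∑ y ∈ W, occ (η 0 ω y)) P := by
  have hrm : Measurable rate := measurable_of_dependsOn dependsOn_rate
  -- A factor depending only on the initial configuration is untouched by resampling waiting times,
  -- so the compensator formula applies to its product with the rate.
  set F : Data → (ℤ → Bool) → ℝ := fun d c => (∑ y ∈ W, occ (d.2 y)) * rate c with hF
  have hFm : Measurable (Function.uncurry F) :=
    ((measurable_sum_occ W).comp (measurable_snd.comp measurable_fst)).mul (hrm.comp measurable_snd)
  have hFb : ∀ d c, |F d c| ≤ W.card := fun d c => by
    rw [hF, abs_mul]
    exact (mul_le_mul (abs_sum_occ_le W _) (abs_rate_le c) (abs_nonneg _)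
      (Nat.cast_nonneg _)).trans_eq (mul_one _)
  set G : Data → (ℤ → Bool) → ℝ := fun _ c => rate c with hG
  have hGm : Measurable (Function.uncurry G) := hrm.comp measurable_snd
  have hGb : ∀ d c, |G d c| ≤ 1 := fun d c => abs_rate_le c
  have iF := h.integrableOn_expect h0 h1 hFm hFb t
  have iG := h.integrableOn_expect h0 h1 hGm hGb t
  have eF := (h.ringSum_left h0 h1 0 hFm (fun _ _ _ _ => rfl) hFb t).2
  have eG := (h.ringSum_left h0 h1 0 hGm (fun _ _ _ _ => rfl) hGb t).2
  set m := ∫ ω, ∑ y ∈ W, occ (η 0 ω y) ∂P with hm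
  have hcov : ∀ s ∈ Set.Ioc 0 t, (∫ ω, F (dataOf ξ η ω) (η s ω) ∂P) -
      (∫ ω, G (dataOf ξ η ω) (η s ω) ∂P) * m =
        covariance (fun ω => rate (η s ω)) (fun ω => ∑ y ∈ W, occ (η 0 ω y)) P := by
    intro s hs
    rw [covariance_eq_sub (h.memLp_rate hs.1.le) (h.memLp_sum_occ le_rfl W)]
    congr 1
    refine integral_congr_ae (Eventually.of_forall fun ω => ?_)
    simp only [hF, Pi.mul_apply, dataOf]
    ring
  have iFG := iF.sub (iG.mul_const m)
  refine ⟨iFG.congr_fun (fun s hs => hcov s hs) measurableSet_Ioc, ?_⟩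
  rw [← setIntegral_congr_fun measurableSet_Ioc hcov, integral_sub iF (iG.mul_const m),
    integral_mul_const, ← eF, ← eG,
    covariance_eq_sub (h.memLp_current h0 h1 ht 0) (h.memLp_sum_occ le_rfl W)]
  congr 1
  · refine integral_congr_ae ?_
    filter_upwards [h.current_ae_ringSum h0 h1 t] with ω hω
    simp only [hF, Pi.mul_apply]
    rw [ringSum_const_mul (fun d => ∑ y ∈ W, occ (d.2 y)), hω, mul_comm]
    rfl
  · rw [integral_congr_ae (h.current_ae_ringSum h0 h1 t)]

theorem covariance_rate_sum_occ (h : IsTASEP P ρ ξ η) (h0 : 0 < ρ) (h1 : ρ < 1) {s : ℝ}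
    (hs : 0 ≤ s) {n : ℕ} (hn : 1 ≤ n) : covariance (fun ω => rate (η s ω))
      (fun ω => ∑ y ∈ Finset.Ioc (-n : ℤ) n, occ (η s ω y)) P = chi ρ * (1 - 2 * ρ) := by
  rw [covariance_fun_sum_right' (fun y _ => h.memLp_occ hs y) (h.memLp_rate hs)]
  simp only [h.covariance_rate_occ h0 h1 hs]
  rw [Finset.sum_eq_add (0 : ℤ) 1 (by norm_num) (fun y _ hy => by rw [if_neg hy.1, if_neg hy.2])
    (fun hy => absurd (Finset.mem_Ioc.2 (by omega)) hy)
    (fun hy => absurd (Finset.mem_Ioc.2 (by omega)) hy)]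
  simp only [if_true, one_ne_zero, if_false]
  ring

/-- The sum rule. Conservation is used twice, first from `t` back to `0` against the current, then
from `0` to `s` against the rate; only the second use leaves an error, the covariances of the rate
with the currents at `±n`. -/
theorem abs_sum_currentOcc_sub_le (h : IsTASEP P ρ ξ η) (h0 : 0 < ρ) (h1 : ρ < 1) {t : ℝ}
    (ht : 0 ≤ t) {θ A : ℝ}
    (hr : ∀ s, 0 ≤ s → s ≤ t → ∀ x,
      |covariance (fun ω => rate (η s ω)) (current ξ η s x) P| ≤ A * θ ^ x.natAbs)
    {n : ℕ} (hn : 1 ≤ n) :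
    |∑ y ∈ Finset.Ioc (-n : ℤ) n, currentOcc P ξ η t y - chi ρ * (1 - 2 * ρ) * t| ≤
      (2 * A * t) * θ ^ n := by
  set W := Finset.Ioc (-n : ℤ) n with hW
  have hab : (-n : ℤ) ≤ n := by omega
  obtain ⟨hi, he⟩ := h.covariance_current_sum_occ_zero h0 h1 ht W
  have e1 : ∑ y ∈ W, currentOcc P ξ η t y =
      covariance (current ξ η t 0) (fun ω => ∑ y ∈ W, occ (η 0 ω y)) P := by
    have := h.covariance_current_sum_occ h0 h1 ht 0 W
    simp only [sub_zero] at this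
    have hl := (h.memLp_current h0 h1 ht (-n)).sub (h.memLp_current h0 h1 ht n)
    rw [← this, covariance_congr (ae_eq_refl _) (h.sum_occ_ae h0 h1 ht hab)]
    have e := covariance_add_right (h.memLp_current h0 h1 ht 0) (h.memLp_sum_occ le_rfl W) hl
    refine (Eq.trans ?_ e).trans ?_
    · rfl
    -- The currents at `-n` and `n` have the same covariance with the current at `0`, so the
    -- boundary terms cancel exactly.
    · rw [covariance_sub_right (h.memLp_current h0 h1 ht 0) (h.memLp_current h0 h1 ht _)
        (h.memLp_current h0 h1 ht _), h.covariance_current_current h0 h1 ht,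
        h.covariance_current_current h0 h1 ht, sub_zero, sub_zero, h.currentCurrent_neg h0 h1 ht]
      ring
  have e2 : ∀ s ∈ Set.Ioc 0 t, ‖covariance (fun ω => rate (η s ω))
      (fun ω => ∑ y ∈ W, occ (η 0 ω y)) P - chi ρ * (1 - 2 * ρ)‖ ≤ 2 * A * θ ^ n := by
    intro s hs
    have hs0 := hs.1.le
    have hl := (h.memLp_current h0 h1 hs0 (-n)).sub (h.memLp_current h0 h1 hs0 n)
    have hc := covariance_congr (ae_eq_refl (μ := P) fun ω => rate (η s ω))
      (h.sum_occ_ae h0 h1 hs0 hab)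
    rw [h.covariance_rate_sum_occ h0 h1 hs0 hn] at hc
    have e := covariance_add_right (h.memLp_rate hs0) (h.memLp_sum_occ le_rfl W) hl
    have hc' := hc.trans e
    rw [covariance_sub_right (h.memLp_rate hs0) (h.memLp_current h0 h1 hs0 _)
      (h.memLp_current h0 h1 hs0 _)] at hc'
    have b1 := hr s hs0 hs.2 (-n)
    have b2 := hr s hs0 hs.2 n
    rw [Int.natAbs_neg] at b1
    rw [Int.natAbs_natCast] at b1 b2
    rw [hc', Real.norm_eq_abs]
    rw [abs_le] at b1 b2 ⊢
    constructor <;> linarith [b1.1, b1.2, b2.1, b2.2]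
  have e3 := norm_setIntegral_le_of_norm_le_const (μ := volume) (s := Set.Ioc 0 t) (by simp) e2
  rw [integral_sub hi (integrable_const _), ← he] at e3
  simp only [integral_const, MeasurableSet.univ, measureReal_restrict_apply, Set.univ_inter,
    Real.volume_real_Ioc_of_le ht, sub_zero, smul_eq_mul, Real.norm_eq_abs] at e3
  rw [e1]
  calc _ = |covariance (current ξ η t 0) (fun ω => ∑ y ∈ W, occ (η 0 ω y)) P -
        t * (chi ρ * (1 - 2 * ρ))| := by rw [mul_comm t]
    _ ≤ _ := e3.trans_eq (by ring)

end IsTASEP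

end

/-! ### Summation by parts on the integers -/

section Parts

theorem summable_of_decay {u : ℤ → ℝ} {θ K : ℝ} (h0 : 0 < θ) (h1 : θ < 1)
    (hu : ∀ x, |u x| ≤ K * (1 + |(x : ℝ)|) ^ 2 * θ ^ x.natAbs) : Summable u := by
  have hn : Summable fun n : ℕ => K * (1 + (n : ℝ)) ^ 2 * θ ^ n := by
    have hθ : ‖θ‖ < 1 := by rwa [Real.norm_eq_abs, abs_of_pos h0]
    have s0 := summable_pow_mul_geometric_of_norm_lt_one 0 hθ
    have s1 := summable_pow_mul_geometric_of_norm_lt_one 1 hθ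
    have s2 := summable_pow_mul_geometric_of_norm_lt_one 2 hθ
    refine (((s0.add (s1.mul_left 2)).add s2).mul_left K).congr fun n => ?_
    ring
  refine Summable.of_norm_bounded (g := fun x : ℤ => K * (1 + |(x : ℝ)|) ^ 2 * θ ^ x.natAbs) ?_ hu
  refine Summable.of_nat_of_neg ?_ ?_ <;> simpa using hn

theorem decay_comp_add {w : ℤ → ℝ} {θ K : ℝ} (h0 : 0 < θ) (h1 : θ < 1)
    (hw : ∀ x, |w x| ≤ K * θ ^ x.natAbs) {k : ℤ} (hk : k.natAbs ≤ 1) (x : ℤ) :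
    |w (x + k)| ≤ K * θ⁻¹ * θ ^ x.natAbs := by
  have hK : 0 ≤ K := by simpa using (abs_nonneg _).trans (hw 0)
  refine (hw (x + k)).trans ?_
  rw [mul_assoc]
  refine mul_le_mul_of_nonneg_left ?_ hK
  rw [inv_mul_eq_div, le_div_iff₀ h0, ← pow_succ]
  exact pow_le_pow_of_le_one h0.le h1.le (by omega)

theorem hasSum_mul_second_difference {p w : ℤ → ℝ} {θ K M : ℝ} (h0 : 0 < θ) (h1 : θ < 1)
    (hw : ∀ x, |w x| ≤ K * θ ^ x.natAbs) (hp : ∀ x : ℤ, |p x| ≤ M * (1 + |(x : ℝ)|) ^ 2) :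
    HasSum (fun x => p x * (w (x + 1) - 2 * w x + w (x - 1)))
      (∑' x, (p (x + 1) - 2 * p x + p (x - 1)) * w x) := by
  have hs : ∀ k : ℤ, k.natAbs ≤ 1 → Summable fun x => p x * w (x + k) := by
    intro k hk
    refine summable_of_decay (K := M * (K * θ⁻¹)) h0 h1 fun x => ?_
    rw [abs_mul]
    calc _ ≤ M * (1 + |(x : ℝ)|) ^ 2 * (K * θ⁻¹ * θ ^ x.natAbs) :=
          mul_le_mul (hp x) (decay_comp_add h0 h1 hw hk x) (abs_nonneg _)
            ((abs_nonneg _).trans (hp x))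
      _ = _ := by ring
  have s1 := hs 1 (by norm_num)
  have s0 := hs 0 (by norm_num)
  have s2 := hs (-1) (by norm_num)
  simp only [add_zero, ← sub_eq_add_neg] at s0 s2
  have t1 : HasSum (fun x => p (x - 1) * w x) (∑' x, p x * w (x + 1)) := by
    have := (Equiv.hasSum_iff (Equiv.subRight (1 : ℤ))).2 s1.hasSum
    simpa [Function.comp_def] using this
  have t2 : HasSum (fun x => p (x + 1) * w x) (∑' x, p x * w (x - 1)) := by
    have := (Equiv.hasSum_iff (Equiv.addRight (1 : ℤ))).2 s2.hasSum
    simpa [Function.comp_def] using this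
  have e1 : HasSum (fun x => p x * (w (x + 1) - 2 * w x + w (x - 1)))
      (∑' x, p x * w (x + 1) - 2 * ∑' x, p x * w x + ∑' x, p x * w (x - 1)) := by
    refine (((s1.hasSum.sub (s0.hasSum.mul_left 2)).add s2.hasSum).congr_fun ?_)
    intro x; ring
  have e2 : HasSum (fun x => (p (x + 1) - 2 * p x + p (x - 1)) * w x)
      (∑' x, p x * w (x + 1) - 2 * ∑' x, p x * w x + ∑' x, p x * w (x - 1)) := by
    have := (t2.sub (s0.hasSum.mul_left 2)).add t1
    have e : ∑' x, p x * w (x + 1) - 2 * ∑' x, p x * w x + ∑' x, p x * w (x - 1) =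
        ∑' x, p x * w (x - 1) - 2 * ∑' x, p x * w x + ∑' x, p x * w (x + 1) := by ring
    rw [e]
    refine this.congr_fun ?_
    intro x; ring
  rw [e2.tsum_eq]
  exact e1

/-- `|x - m|` is affine on either side of `m`, so its second difference on the integers lives on the
two sites `⌊m⌋` and `⌊m⌋ + 1` around `m`. -/
theorem hasSum_mul_kink (p : ℤ → ℝ) (m : ℝ) :
    HasSum (fun x : ℤ => p x * (|((x + 1 : ℤ) : ℝ) - m| - 2 * |(x : ℝ) - m| + |((x - 1 : ℤ) : ℝ) - m|))
      (p ⌊m⌋ * (2 - 2 * Int.fract m) + p (⌊m⌋ + 1) * (2 * Int.fract m)) := by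
  have hm : m = ⌊m⌋ + Int.fract m := (Int.floor_add_fract m).symm
  set f := Int.fract m with hf
  set n := ⌊m⌋ with hn
  have f0 : 0 ≤ f := Int.fract_nonneg m
  have f1 : f < 1 := Int.fract_lt_one m
  have hl : ∀ y : ℤ, y ≤ n → |(y : ℝ) - m| = m - y := fun y hy => by
    have : (y : ℝ) ≤ n := by exact_mod_cast hy
    rw [abs_of_nonpos (by linarith)]; ring
  have hr : ∀ y : ℤ, n < y → |(y : ℝ) - m| = y - m := fun y hy => by
    have : (n : ℝ) + 1 ≤ y := by exact_mod_cast hy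
    rw [abs_of_nonneg (by linarith)]
  have key := hasSum_sum_of_ne_finset_zero (L := .unconditional ℤ) (s := {n, n + 1}) (f := fun x : ℤ =>
    p x * (|((x + 1 : ℤ) : ℝ) - m| - 2 * |(x : ℝ) - m| + |((x - 1 : ℤ) : ℝ) - m|)) ?_
  · rw [Finset.sum_pair (by omega), hr (n + 1) (by omega), hl n le_rfl, hl (n - 1) (by omega),
      hr (n + 1 + 1) (by omega), hl (n + 1 - 1) (by omega)] at key
    convert key using 1
    push_cast
    rw [hm]; ring
  · intro x hx
    simp only [Finset.mem_insert, Finset.mem_singleton, not_or] at hx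
    rcases lt_or_gt_of_ne hx.1 with hlt | hgt
    · rw [hl _ (by omega), hl _ (by omega), hl _ (by omega)]
      push_cast; ring
    · rw [hr _ (by omega), hr _ (by omega), hr _ (by omega)]
      push_cast; ring

/-- Moments of the second difference of a function which is exponentially close to a kink. -/
theorem hasSum_mul_of_kink {p V T : ℤ → ℝ} {θ K M m c : ℝ} (h0 : 0 < θ) (h1 : θ < 1)
    (hV : ∀ x : ℤ, abs (V x - 4 * c * |(x : ℝ) - m|) ≤ K * θ ^ x.natAbs)
    (hT : ∀ x, V (x + 1) - 2 * V x + V (x - 1) = 8 * T x)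
    (hp : ∀ x : ℤ, |p x| ≤ M * (1 + |(x : ℝ)|) ^ 2) :
    HasSum (fun x => p x * T x)
      ((1 / 8) * ((∑' x : ℤ, (p (x + 1) - 2 * p x + p (x - 1)) * (V x - 4 * c * |(x : ℝ) - m|)) +
        4 * c * (p ⌊m⌋ * (2 - 2 * Int.fract m) + p (⌊m⌋ + 1) * (2 * Int.fract m)))) := by
  refine (((hasSum_mul_second_difference h0 h1 hV hp).add
    ((hasSum_mul_kink p m).mul_left (4 * c))).mul_left (1 / 8)).congr_fun fun x => ?_
  have : T x = (1 / 8) * (V (x + 1) - 2 * V x + V (x - 1)) := by rw [hT]; ring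
  rw [this]; ring

theorem pow_natAbs_eq_exp {θ : ℝ} (h0 : 0 < θ) (x : ℤ) :
    θ ^ x.natAbs = Real.exp (-(-Real.log θ) * |(x : ℝ)|) := by
  have : |(x : ℝ)| = (x.natAbs : ℝ) := by rw [Nat.cast_natAbs]; push_cast; rfl
  rw [this, neg_neg, mul_comm, Real.exp_nat_mul, Real.exp_log h0]

/-- The two expressions coincide when `|x| ≥ |m|` and `x ≠ 0`. At the finitely many other sites `|x|
≤ ⌈|m|⌉`, and the negative power of `θ` offsets `θ ^ |x|`. -/
theorem kink_sub_le {θ c m : ℝ} (h0 : 0 < θ) (h1 : θ < 1) (hc : 0 ≤ c) (x : ℤ) :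
    |4 * c * (|(x : ℝ)| - x.sign * m - |(x : ℝ) - m|)| ≤
      8 * c * |m| * θ⁻¹ ^ ⌈|m|⌉₊ * θ ^ x.natAbs := by
  have hxr : |(x : ℝ)| = (x.natAbs : ℝ) := by rw [Nat.cast_natAbs]; push_cast; rfl
  rw [abs_mul, abs_of_nonneg (by positivity : 0 ≤ 4 * c)]
  by_cases hx : |m| ≤ |(x : ℝ)| ∧ x ≠ 0
  · have e : |(x : ℝ)| - x.sign * m - |(x : ℝ) - m| = 0 := by
      rcases lt_or_gt_of_ne hx.2 with h | h
      · have hr : (x : ℝ) < 0 := by exact_mod_cast h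
        have := hx.1
        rw [abs_of_neg hr] at this
        rw [Int.sign_eq_neg_one_of_neg h, abs_of_neg hr,
          abs_of_nonpos (by linarith [neg_abs_le m])]
        push_cast; ring
      · have hr : 0 < (x : ℝ) := by exact_mod_cast h
        have := hx.1
        rw [abs_of_pos hr] at this
        rw [Int.sign_eq_one_of_pos h, abs_of_pos hr, abs_of_nonneg (by linarith [le_abs_self m])]
        push_cast; ring
    rw [e, abs_zero, mul_zero]
    positivity
  · have hn : x.natAbs ≤ ⌈|m|⌉₊ := by
      by_cases hx0 : x = 0
      · simp [hx0]
      have : |(x : ℝ)| < |m| := not_le.1 fun hh => hx ⟨hh, hx0⟩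
      rw [hxr] at this
      exact_mod_cast this.le.trans (Nat.le_ceil _)
    have hb : |(|(x : ℝ)| - x.sign * m - |(x : ℝ) - m|)| ≤ 2 * |m| := by
      have b1 : |(|(x : ℝ)| - |(x : ℝ) - m|)| ≤ |m| := by
        refine (abs_abs_sub_abs_le_abs_sub _ _).trans ?_
        simp
      have b2 : |(x.sign : ℝ) * m| ≤ |m| := by
        rcases Int.sign_trichotomy x with h | h | h <;> rw [h] <;> simp
      calc _ = |(|(x : ℝ)| - |(x : ℝ) - m|) - x.sign * m| := by congr 1; ring
        _ ≤ _ := (abs_sub _ _).trans (by linarith)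
    have hθ : 1 ≤ θ⁻¹ ^ ⌈|m|⌉₊ * θ ^ x.natAbs := by
      rw [inv_pow, inv_mul_eq_div, le_div_iff₀ (by positivity), one_mul]
      exact pow_le_pow_of_le_one h0.le h1.le hn
    calc _ ≤ 4 * c * (2 * |m|) := by gcongr
      _ = 8 * c * |m| * 1 := by ring
      _ ≤ 8 * c * |m| * (θ⁻¹ ^ ⌈|m|⌉₊ * θ ^ x.natAbs) := by gcongr
      _ = _ := by ring

end Parts

/-! ### Kink asymptotics of the height variance and the moment identities -/

section

variable {Ω : Type*} [MeasurableSpace Ω] {P : Measure Ω} [IsProbabilityMeasure P]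
    {ρ : ℝ} {ξ : ℤ → ℕ → Ω → ℝ} {η : ℝ → Ω → ℤ → Bool}

theorem chi_pos (h0 : 0 < ρ) (h1 : ρ < 1) : 0 < chi ρ := mul_pos h0 (sub_pos.2 h1)

/-- The height variance is exponentially close to a kink. -/
theorem IsTASEP.exists_v_sub_le (h : IsTASEP P ρ ξ η) (h0 : 0 < ρ) (h1 : ρ < 1) {t : ℝ}
    (ht : 0 ≤ t) : ∃ θ K : ℝ, 0 < θ ∧ θ < 1 ∧ ∀ x : ℤ,
      abs (v P ξ η x t - 4 * chi ρ * |(x : ℝ) - (1 - 2 * ρ) * t|) ≤ K * θ ^ x.natAbs := by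
  obtain ⟨θ, A, hθ0, hθ1, hA0, -, hC, hr⟩ := h.exists_decay h0 h1 ht
  set m := (1 - 2 * ρ) * t with hm
  refine ⟨θ, 4 * A + 4 * (2 * A * t) + 8 * chi ρ * |m| * θ⁻¹ ^ ⌈|m|⌉₊, hθ0, hθ1, fun x => ?_⟩
  have hk := kink_sub_le (m := m) hθ0 hθ1 (chi_pos h0 h1).le x
  have hI : Finset.Icc (-|x| + 1) |x| = Finset.Ioc (-(x.natAbs : ℤ)) x.natAbs := by
    rw [Int.abs_eq_natAbs]; ext y; simp
  have hv := h.v_eq h0 h1 ht x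
  rw [hI] at hv
  set R := ∑ y ∈ Finset.Ioc (-(x.natAbs : ℤ)) x.natAbs, currentOcc P ξ η t y with hR
  have hs : |(x.sign : ℝ) * (R - chi ρ * m)| ≤ (2 * A * t) * θ ^ x.natAbs := by
    by_cases hx : x = 0
    · subst hx; simp; positivity
    have hb := h.abs_sum_currentOcc_sub_le h0 h1 ht hr (n := x.natAbs) (by omega)
    rw [mul_assoc (chi ρ), ← hm, ← hR] at hb
    rw [abs_mul]
    have : |(x.sign : ℝ)| ≤ 1 := by rcases Int.sign_trichotomy x with h | h | h <;> rw [h] <;> simp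
    exact (mul_le_of_le_one_left (abs_nonneg _) this).trans hb
  -- Three exponentially small errors: the covariance of distant currents, the defect in the sum
  -- rule, and the difference between `|x| - sgn(x) m` and `|x - m|`.
  have e : v P ξ η x t - 4 * chi ρ * |(x : ℝ) - m| = 4 * currentCurrent P ξ η t x -
      4 * ((x.sign : ℝ) * (R - chi ρ * m)) +
        4 * chi ρ * (|(x : ℝ)| - x.sign * m - |(x : ℝ) - m|) := by
    rw [hv]; ring
  have hCx := hC x
  rw [e, add_mul, add_mul]
  rw [abs_le] at hCx hs hk ⊢
  constructor <;> linarith [hCx.1, hCx.2, hs.1, hs.2, hk.1, hk.2]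

theorem IsTASEP.hasSum_second_moment (h : IsTASEP P ρ ξ η) (h0 : 0 < ρ) (h1 : ρ < 1) {t : ℝ}
    (ht : 0 ≤ t) : HasSum (fun x : ℤ => ((x : ℝ) - (1 - 2 * ρ) * t) ^ 2 * S P ρ η x t)
      (1 / 4 * (∑' x : ℤ, (v P ξ η x t - 4 * chi ρ * |(x : ℝ) - (1 - 2 * ρ) * t|)) +
        chi ρ * (Int.fract ((1 - 2 * ρ) * t) * (1 - Int.fract ((1 - 2 * ρ) * t)))) := by
  obtain ⟨θ, K, hθ0, hθ1, hV⟩ := h.exists_v_sub_le h0 h1 ht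
  set m := (1 - 2 * ρ) * t with hm
  have key := hasSum_mul_of_kink (p := fun x : ℤ => ((x : ℝ) - m) ^ 2) (M := (1 + |m|) ^ 2) hθ0 hθ1
    hV (h.v_second_difference h0 h1 ht) fun x => by
      rw [abs_pow, ← mul_pow]
      refine pow_le_pow_left₀ (abs_nonneg _) ((abs_sub _ _).trans ?_) 2
      nlinarith [abs_nonneg m, abs_nonneg (x : ℝ)]
  -- The quadratic weight has second difference `2`, and with `f = {m}` the kink contributes `f²(2 -
  -- 2f) + (1 - f)² 2f = 2f(1 - f)`.
  convert key using 1
  have e1 : ∀ x : ℤ, (((x + 1 : ℤ) : ℝ) - m) ^ 2 - 2 * ((x : ℝ) - m) ^ 2 +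
      (((x - 1 : ℤ) : ℝ) - m) ^ 2 = 2 := fun x => by push_cast; ring
  simp only [e1, tsum_mul_left]
  have e2 : m - ⌊m⌋ = Int.fract m := rfl
  have e3 : ((⌊m⌋ : ℝ) - m) = -Int.fract m := by rw [← e2]; ring
  push_cast
  rw [e3, show ((⌊m⌋ : ℝ) + 1 - m) = 1 - Int.fract m by rw [← e2]; ring]
  ring

theorem IsTASEP.hasSum_abs_moment (h : IsTASEP P ρ ξ η) (h0 : 0 < ρ) (h1 : ρ < 1) {t : ℝ}
    (ht : 0 ≤ t) :
    HasSum (fun x : ℤ => |(x : ℝ) - (⌊(1 - 2 * ρ) * t⌋ : ℝ)| * S P ρ η x t)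
      (1 / 4 * v P ξ η ⌊(1 - 2 * ρ) * t⌋ t) := by
  obtain ⟨θ, K, hθ0, hθ1, hV⟩ := h.exists_v_sub_le h0 h1 ht
  set m := (1 - 2 * ρ) * t with hm
  have key := hasSum_mul_of_kink (p := fun x : ℤ => |(x : ℝ) - ⌊m⌋|) (M := 1 + |(⌊m⌋ : ℝ)|) hθ0 hθ1
    hV (h.v_second_difference h0 h1 ht) fun x => by
      rw [abs_abs]
      refine (abs_sub _ _).trans ?_
      nlinarith [abs_nonneg (⌊m⌋ : ℝ), abs_nonneg (x : ℝ),
        mul_nonneg (abs_nonneg (⌊m⌋ : ℝ)) (abs_nonneg (x : ℝ)),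
        mul_nonneg (abs_nonneg (⌊m⌋ : ℝ)) (sq_nonneg (x : ℝ)), sq_abs (x : ℝ)]
  -- The weight `|x - ⌊m⌋|` has second difference `2` at `⌊m⌋` and `0` elsewhere, so only `v -
  -- 4χ{m}` at `⌊m⌋` survives; the kink mass `2{m}` at `⌊m⌋ + 1`, where the weight is one, cancels
  -- the correction.
  convert key using 1
  have e1 : ∀ x : ℤ, |((x + 1 : ℤ) : ℝ) - ⌊m⌋| - 2 * |(x : ℝ) - ⌊m⌋| + |((x - 1 : ℤ) : ℝ) - ⌊m⌋| =
      if x = ⌊m⌋ then 2 else 0 := fun x => by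
    rcases lt_trichotomy x ⌊m⌋ with hx | hx | hx
    · have hr : (x : ℝ) + 1 ≤ ⌊m⌋ := by exact_mod_cast hx
      rw [if_neg hx.ne]; push_cast
      rw [abs_of_nonpos (by linarith), abs_of_nonpos (by linarith), abs_of_nonpos (by linarith)]
      ring
    · rw [if_pos hx, hx]; push_cast; norm_num
    · have hr : (⌊m⌋ : ℝ) + 1 ≤ x := by exact_mod_cast hx
      rw [if_neg hx.ne']; push_cast
      rw [abs_of_nonneg (by linarith), abs_of_nonneg (by linarith), abs_of_nonneg (by linarith)]
      ring
  have e2 : |(⌊m⌋ : ℝ) - m| = Int.fract m := by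
    rw [abs_sub_comm]; exact abs_of_nonneg (Int.fract_nonneg m)
  simp only [e1, ite_mul, zero_mul, tsum_ite_eq]
  rw [e2]
  push_cast
  simp only [sub_self, abs_zero, zero_mul, add_sub_cancel_left, abs_one]
  ring

end

end TASEP

/-! ### Assembly of the assertions -/

theorem lemma4p1 {Ω : Type*} [MeasurableSpace Ω] (P : Measure Ω) [IsProbabilityMeasure P]
    (ρ : ℝ) (hρ0 : 0 < ρ) (hρ1 : ρ < 1)
    (ξ : ℤ → ℕ → Ω → ℝ) (η : ℝ → Ω → ℤ → Bool) (hη : TASEP.IsTASEP P ρ ξ η) :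
    -- the currents are square integrable, so that all variances and covariances make sense
    (∀ t : ℝ, 0 ≤ t → ∀ x : ℤ, MemLp (TASEP.current ξ η t x) 2 P) ∧
    -- the formula for the height variance
    (∀ t : ℝ, 0 ≤ t → ∀ x : ℤ,
      TASEP.v P ξ η x t =
        4 * TASEP.chi ρ * |(x : ℝ)|
          + 4 * covariance (TASEP.current ξ η t 0) (TASEP.current ξ η t x) P
          - 4 * (x.sign : ℝ) * covariance (TASEP.current ξ η t 0)
              (fun ω => ∑ y ∈ Finset.Icc (-|x| + 1) |x|, TASEP.occ (η t ω y)) P) ∧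
    -- exponential decay of the covariances
    (∀ t : ℝ, 0 ≤ t → ∃ C₁ C₂ : ℝ, 0 < C₂ ∧ ∀ x : ℤ,
      |covariance (TASEP.current ξ η t 0) (fun ω => TASEP.occ (η t ω x)) P|
          ≤ C₁ * Real.exp (-C₂ * |(x : ℝ)|) ∧
      |covariance (TASEP.current ξ η t 0) (TASEP.current ξ η t x) P|
          ≤ C₁ * Real.exp (-C₂ * |(x : ℝ)|)) ∧
    -- the resulting behaviour of the height variance at spatial infinity
    (∀ t : ℝ, 0 ≤ t → ∃ C₃ C₄ : ℝ, 0 < C₄ ∧ ∀ x : ℤ,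
      abs (TASEP.v P ξ η x t - 4 * TASEP.chi ρ * |(x : ℝ) - (1 - 2 * ρ) * t|)
          ≤ C₃ * Real.exp (-C₄ * |(x : ℝ)|)) ∧
    -- the diffusivity in terms of the height variance
    (∀ t : ℝ, 0 < t →
      Summable (fun x : ℤ => ((x : ℝ) - (1 - 2 * ρ) * t) ^ 2 * TASEP.S P ρ η x t) ∧
      Summable (fun x : ℤ =>
        TASEP.v P ξ η x t - 4 * TASEP.chi ρ * |(x : ℝ) - (1 - 2 * ρ) * t|) ∧
      TASEP.D P ρ η t =
        (4 * TASEP.chi ρ * t)⁻¹ * (∑' x : ℤ,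
          (TASEP.v P ξ η x t - 4 * TASEP.chi ρ * |(x : ℝ) - (1 - 2 * ρ) * t|))
        + Int.fract ((1 - 2 * ρ) * t) * (1 - Int.fract ((1 - 2 * ρ) * t)) / t) ∧
    -- the absolute moment identity
    (∀ t : ℝ, 0 ≤ t →
      HasSum (fun x : ℤ => |(x : ℝ) - (⌊(1 - 2 * ρ) * t⌋ : ℝ)| * TASEP.S P ρ η x t)
        (1 / 4 * TASEP.v P ξ η ⌊(1 - 2 * ρ) * t⌋ t)) := by
  refine ⟨fun t ht x => hη.memLp_current hρ0 hρ1 ht x, fun t ht x => ?_, fun t ht => ?_,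
    fun t ht => ?_, fun t ht => ⟨(hη.hasSum_second_moment hρ0 hρ1 ht.le).summable, ?_, ?_⟩,
    fun t ht => hη.hasSum_abs_moment hρ0 hρ1 ht⟩
  · rw [hη.v_eq hρ0 hρ1 ht x, hη.covariance_current_sum_occ hρ0 hρ1 ht]
    simp only [sub_zero, TASEP.currentCurrent]
  · obtain ⟨θ, A, hθ0, hθ1, -, hc, hC, -⟩ := hη.exists_decay hρ0 hρ1 ht
    refine ⟨A, -Real.log θ, neg_pos.2 (Real.log_neg hθ0 hθ1), fun x => ?_⟩
    rw [← TASEP.pow_natAbs_eq_exp hθ0]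
    exact ⟨hc x, hC x⟩
  · obtain ⟨θ, K, hθ0, hθ1, hV⟩ := hη.exists_v_sub_le hρ0 hρ1 ht
    refine ⟨K, -Real.log θ, neg_pos.2 (Real.log_neg hθ0 hθ1), fun x => ?_⟩
    rw [← TASEP.pow_natAbs_eq_exp hθ0]
    exact hV x
  · obtain ⟨θ, K, hθ0, hθ1, hV⟩ := hη.exists_v_sub_le hρ0 hρ1 ht.le
    have hK : 0 ≤ K := by simpa using (abs_nonneg _).trans (hV 0)
    refine TASEP.summable_of_decay (K := K) hθ0 hθ1 fun x => (hV x).trans ?_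
    gcongr
    exact le_mul_of_one_le_right hK (one_le_pow₀ (le_add_of_nonneg_right (abs_nonneg _)))
  · have hχ := (TASEP.chi_pos hρ0 hρ1).ne'
    rw [TASEP.D, (hη.hasSum_second_moment hρ0 hρ1 ht.le).tsum_eq]
    field_simp
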